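/- Let $n\ge 3$ and let $c\in L^\infty(\mathbb R^n)$ be real-valued, bounded below by a positive constant, and (almost everywhere) constant outside a compact set. Suppose that the distribution $\partial_r c$ on $\mathbb R^n$, defined for $\varphi\in C_c^\infty(\mathbb R^n)$ by $$\langle \partial_r c,\varphi\rangle=-\int_{\mathbb R^n} c\,\operatorname{div}\!\Big(\varphi\,\frac{x}{|x|}\Big)\,dx=-\int_{\mathbb R^n} c\,\Big(\partial_r\varphi+\frac{n-1}{|x|}\varphi\Big)\,dx ,$$ is a compactly supported finite signed measure, and that it is bounded above by a radial measure, in the sense that there is a finite (nonnegative) Borel measure $\mu$ on $(0,\infty)$ such that for all Borel sets $A\subset\mathbb R^n$ $$(\partial_r c)(A)\le \int_{S^{n-1}}\int_{(0,\infty)} 1_A(r\theta)\,r^{n-1}\,d\mu(r)\,d\sigma(\theta),$$ where $\sigma$ is the surface measure on the unit sphere $S^{n-1}$. For $\operatorname{Im}\lambda>0$ let $R_c(\lambda)=(-c^2\Delta-\lambda^2)^{-1}\colon L^2(\mathbb R^n)\to L^2(\mathbb R^n)$ be the resolvent of $-c^2\Delta$ with domain $H^2(\mathbb R^n)$. Then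 there is a compact set $K\subset\mathbb R^n$ such that, for any $\chi_0,\chi_1\in C_c^\infty(\mathbb R^n)$ with $\operatorname{supp}\chi_1\cap K=\varnothing$, there are $C>0$ and $\lambda_1>0$ such that for all $\lambda\in\mathbb C$ with $\operatorname{Im}\lambda>0$ and $\operatorname{Re}\lambda\ge\lambda_1$ the resolvent $R_c(\lambda)$ exists as a bounded operator on $L^2(\mathbb R^n)$ and $$\|\chi_0R_c(\lambda)\chi_0\|_{L^2(\mathbb R^n)\to L^2(\mathbb R^n)}\le Ce^{C\operatorname{Re}\lambda},\qquad \|\chi_1R_c(\lambda)\chi_1\|_{L^2(\mathbb R^n)\to L^2(\mathbb R^n)}\le \frac{C}{\operatorname{Re}\lambda}.$$ -/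

import Mathlib

open MeasureTheory Set
open scoped ENNReal ContDiff SchwartzMap Laplacian

noncomputable section

/-- Euclidean space `ℝⁿ`. -/
abbrev Eucl (n : ℕ) : Type := EuclideanSpace ℝ (Fin n)

/-- The Hilbert space `L²(ℝⁿ)` of complex valued functions (Lebesgue measure). -/
abbrev L2 (n : ℕ) : Type := Lp ℂ 2 (volume : Measure (Eucl n))

/-- Multiplication by an `L^∞` function, as a bounded operator on `L²(ℝⁿ)`. -/
def mulL2 {n : ℕ} (a : Lp ℂ ∞ (volume : Measure (Eucl n))) : L2 n →L[ℂ] L2 n :=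
  LinearMap.mkContinuous
    { toFun := fun f => (a • f : L2 n)
      map_add' := fun f g => Lp.add_smul a f g
      map_smul' := fun z f => (Lp.smul_comm z a f).symm }
    ‖a‖ (fun f => Lp.norm_smul_le a f)

/-- Multiplication by a continuous compactly supported function `χ`, as a bounded operator on
`L²(ℝⁿ)`. -/
def cutoffOp {n : ℕ} (χ : Eucl n → ℂ) (hc : Continuous χ) (hs : HasCompactSupport χ) :
    L2 n →L[ℂ] L2 n :=
  mulL2 ((hc.memLp_top_of_hasCompactSupport hs volume).toLp χ)

/-- `u` lies in the Sobolev space `H²(ℝⁿ)` and `Δ u = w` (distributional Laplacian). -/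
def HasLaplacianL2 {n : ℕ} (u w : L2 n) : Prop :=
  TemperedDistribution.MemSobolev 2 2 (u : 𝓢'(Eucl n, ℂ)) ∧
    Δ (u : 𝓢'(Eucl n, ℂ)) = (w : 𝓢'(Eucl n, ℂ))

/-- `R` is the resolvent `R_c(lam) = (-c²Δ - lam²)⁻¹ : L²(ℝⁿ) → L²(ℝⁿ)`, where `-c²Δ` has
domain `H²(ℝⁿ)`: one has `R f = u` if and only if `u ∈ H²(ℝⁿ)` and `-c²Δu - lam² u = f`.
There is at most one such `R`. -/
def IsResolvent {n : ℕ} (c : Eucl n → ℝ) (lam : ℂ) (R : L2 n →L[ℂ] L2 n) : Prop :=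
  ∀ f u : L2 n, R f = u ↔
    ∃ w : L2 n, HasLaplacianL2 u w ∧
      ∀ᵐ x : Eucl n, -((c x : ℂ) ^ 2 * w x) - lam ^ 2 * u x = f x

/-- The finite signed measure `ν` is the distributional radial derivative `∂_r c` of `c`: as
`∂_r = (x / |x|) · ∇`, this says
`⟨ν, φ⟩ = - ∫ c div (φ x / |x|) dx = - ∫ c (∂_r φ + (n - 1) φ / |x|) dx`
for all real test functions `φ`. -/
def IsRadialDerivative {n : ℕ} (c : Eucl n → ℝ) (ν : SignedMeasure (Eucl n)) : Prop :=
  ∀ φ : Eucl n → ℝ, ContDiff ℝ ∞ φ → HasCompactSupport φ →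
    ∫ᵛ x, φ x ∂<•ν =
      -∫ x, c x * (fderiv ℝ φ x (‖x‖⁻¹ • x) + ((n : ℝ) - 1) / ‖x‖ * φ x)

/-- The radial measure on `ℝⁿ` that is identified, through polar coordinates, with the measure
`μ` on the half-line `(0, ∞)`: its value on `A` is
`∫_{S^{n-1}} ∫_{(0, ∞)} 1_A(r θ) r^{n-1} dμ(r) dσ(θ)`, with `σ` the surface measure.
In this way `g(r) dr` is identified with `g(|x|) dx`. -/
def radialMeasure (n : ℕ) (μ : Measure ℝ) : Measure (Eucl n) :=
  ((volume : Measure (Eucl n)).toSphere.prod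
      ((μ.restrict (Ioi 0)).withDensity fun r => ENNReal.ofReal (r ^ (n - 1)))).map
    fun p => p.2 • (p.1 : Eucl n)

/-- The signed measure `ν` is bounded above by the (nonnegative) measure `M`. -/
def SignedLE {n : ℕ} (ν : SignedMeasure (Eucl n)) (M : Measure (Eucl n)) : Prop :=
  ∀ A : Set (Eucl n), MeasurableSet A → ENNReal.ofReal (ν A) ≤ M A

/-- The signed measure `ν` is compactly supported. -/
def IsCompactlySupported {n : ℕ} (ν : SignedMeasure (Eucl n)) : Prop :=
  ∃ S : Set (Eucl n), IsCompact S ∧ ∀ A, MeasurableSet A → Disjoint A S → ν A = 0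

end

/-! Put `V = c⁻²` and `z = λ² = k² + iε`. The resolvent equation becomes `-Δu - zVu = Vf`. If `Im λ
≥ 1`, then `Im z ≥ Re λ`, and the imaginary part of the quadratic form already gives both bounds. So
suppose `0 < Im λ ≤ 1`; then `k` lies between `Re λ / 2` and `Re λ`, and `0 ≤ ε ≤ 4k`. What is
needed is a Carleman estimate with a radial weight `exp (k φ(|x|))`, where `φ'` is bounded
independently of `k` and vanishes for `|x| ≥ R₁`.

Use of the hypothesis. Since `∂_r c` lies below a radial measure, `c(x) - μ((0,|x|))` has
nonpositive radial derivative. After a change on a null set it decreases along every ray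
(`exists_speed_repr`), so `V` falls along rays no faster than some bounded monotone function `M` of
the radius rises (`exists_rayPotential`). Only decrease of `V` is harmful, and the control is
uniform in the angle, so a radial phase can compensate it.

Phase. For `v = e^{kφ}u`, multiply the conjugated equation by `(L² + |x|²)^{-1/2}` times `x·∇v +
(n-1)/2 v`. The commutator contains `k² r ((φ'²)' + ∂_r V) v²`. With `(φ'²)' = 8B`, where `B` is a
continuous majorant of the difference quotients of `M`, the bracket is positive. As `∫ B ≤ 2 sup M`,
the slope `φ'` stays bounded. Where `V` is constant, `φ'` is switched off by a cutoff that is slow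
on the logarithmic scale, and the term in `V` itself pays for this (`exists_carlemanWeight`).

Roughness. `V` is only measurable and bounded, so the identity uses its mean over radial segments of
length `δ = 1/(4kv₁)`, whose radial derivative is a difference quotient (`integral_radialMean_mul`).
The one-sided control bounds the difference between `V` and its mean by `δ` times that quotient plus
twice that of `M` (`RayPotential.abs_sub_radialMean_le`), and this error is absorbed by the term `k
r φ' |N/r|²`, `N` being the multiplier. The pointwise inequality is `CarlemanWeight.quad`, and its
integrated form is `integral_carleman_le`.

Conclusion. Terms carrying `ε` are controlled by the energy identity `ε∫V|u|² ≤ ∫V|f||u|`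
(`HelmholtzPair.energy`, `HelmholtzPair.estimate`). Test functions are a core for the Laplacian, so
the estimate passes to the resolvent (`norm_restrictL2_le`). In general the weight costs `exp(Ck)`.
If source and observation lie outside the ball of radius `R₁`, the weight there is constant and
maximal, the exponentials cancel, and `C/k` remains. Hence `K` is that ball. Existence of the
resolvent is a coercivity argument after conjugation with Bessel potentials (`exists_isResolvent`).
-/

noncomputable section

/-! ### Continuous majorants for the difference quotients of a bounded monotone function -/

/-- The mean of `M` over the interval `[r, r + δ]`. -/
def boxMean (M : ℝ → ℝ) (δ r : ℝ) : ℝ := δ⁻¹ * ∫ s in r..r + δ, M s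

/-- A continuous majorant of the difference quotient `(M (r + δ) - M r) / δ`. -/
def boxSlope (M : ℝ → ℝ) (δ r : ℝ) : ℝ := δ⁻¹ * (boxMean M δ (r + δ) - boxMean M δ (r - δ))

section boxMean

variable {M : ℝ → ℝ} {δ m : ℝ}

lemma boxMean_eq (hδ : 0 < δ) (M : ℝ → ℝ) (r : ℝ) :
    boxMean M δ r = ∫ s in (0 : ℝ)..1, M (r + δ * s) := by
  have := intervalIntegral.integral_comp_add_mul (a := 0) (b := 1) M hδ.ne' r
  simp only [mul_zero, add_zero, mul_one, smul_eq_mul] at this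
  rw [boxMean, this]

lemma intervalIntegrable_comp_add_mul (hM : Monotone M) (hδ : 0 < δ) (r a b : ℝ) :
    IntervalIntegrable (fun s => M (r + δ * s)) volume a b :=
  Monotone.intervalIntegrable
    (fun _ _ h => hM (by gcongr))

lemma continuous_boxMean (hM : Monotone M) (δ : ℝ) : Continuous (boxMean M δ) := by
  have h : ∀ a b, IntervalIntegrable M volume a b := fun a b => hM.intervalIntegrable
  have h1 : boxMean M δ =
      fun r => δ⁻¹ * ((∫ s in (0 : ℝ)..r + δ, M s) - ∫ s in (0 : ℝ)..r, M s) := by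
    funext r
    rw [boxMean, intervalIntegral.integral_interval_sub_left (h _ _) (h _ _)]
  rw [h1]
  have := intervalIntegral.continuous_primitive h 0
  fun_prop

lemma boxMean_nonneg (hδ : 0 < δ) (h0 : ∀ r, 0 ≤ M r) (r : ℝ) : 0 ≤ boxMean M δ r := by
  rw [boxMean_eq hδ]
  exact intervalIntegral.integral_nonneg (by norm_num) fun _ _ => h0 _

lemma boxMean_le (hM : Monotone M) (hδ : 0 < δ) (hm : ∀ r, M r ≤ m) (r : ℝ) :
    boxMean M δ r ≤ m := by
  rw [boxMean_eq hδ]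
  calc _ ≤ ∫ s in (0 : ℝ)..1, m :=
        intervalIntegral.integral_mono_on (by norm_num) (intervalIntegrable_comp_add_mul hM hδ _ _ _)
          (by simp) fun _ _ => hm _
    _ = m := by simp

lemma continuous_boxSlope (hM : Monotone M) (δ : ℝ) : Continuous (boxSlope M δ) := by
  have := continuous_boxMean hM δ
  unfold boxSlope
  fun_prop

/-- By monotonicity the mean over `[r + δ, r + 2δ]` is at least `M (r + δ)`, and the mean over `[r -
δ, r]` is at most `M r`. -/
lemma slope_le_boxSlope (hM : Monotone M) (hδ : 0 < δ) (r : ℝ) :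
    (M (r + δ) - M r) / δ ≤ boxSlope M δ r := by
  rw [boxSlope, div_eq_inv_mul]
  gcongr
  · calc M (r + δ) = ∫ _ in (0 : ℝ)..1, M (r + δ) := by simp
      _ ≤ ∫ s in (0 : ℝ)..1, M (r + δ + δ * s) :=
        intervalIntegral.integral_mono_on (by norm_num) (by simp)
          (intervalIntegrable_comp_add_mul hM hδ _ _ _)
          fun s hs => hM (by nlinarith [hs.1])
      _ = _ := (boxMean_eq hδ _ _).symm
  · calc _ = ∫ s in (0 : ℝ)..1, M (r - δ + δ * s) := boxMean_eq hδ _ _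
      _ ≤ ∫ _ in (0 : ℝ)..1, M r :=
        intervalIntegral.integral_mono_on (by norm_num)
          (intervalIntegrable_comp_add_mul hM hδ _ _ _) (by simp)
          fun s hs => hM (by nlinarith [hs.2])
      _ = M r := by simp

lemma boxSlope_nonneg (hM : Monotone M) (hδ : 0 < δ) (r : ℝ) : 0 ≤ boxSlope M δ r :=
  (div_nonneg (sub_nonneg.2 (hM (by linarith))) hδ.le).trans (slope_le_boxSlope hM hδ r)

lemma boxSlope_le (hM : Monotone M) (hδ : 0 < δ) (h0 : ∀ r, 0 ≤ M r) (hm : ∀ r, M r ≤ m) (r : ℝ) :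
    boxSlope M δ r ≤ m / δ := by
  rw [boxSlope, div_eq_inv_mul]
  have := boxMean_le hM hδ hm (r + δ)
  have := boxMean_nonneg hδ h0 (r - δ)
  gcongr
  linarith

lemma boxSlope_eq_zero (hδ : 0 < δ) {R : ℝ} (hR : ∀ r, R ≤ r → M r = M R) {r : ℝ}
    (hr : R + δ ≤ r) : boxSlope M δ r = 0 := by
  have key : ∀ r, R ≤ r → boxMean M δ r = M R := by
    intro r hr
    rw [boxMean_eq hδ]
    rw [intervalIntegral.integral_congr (g := fun _ => M R)]
    · simp
    · intro s hs
      rw [uIcc_of_le (by norm_num)] at hs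
      exact hR _ (by nlinarith [hs.1])
  rw [boxSlope, key _ (by linarith), key _ (by linarith), sub_self, mul_zero]

/-- The integral telescopes to two integrals of `boxMean` over intervals of length `2δ`, divided by
`δ`. The bound is independent of `δ`, which is what keeps the slope of the phase bounded as the
frequency grows. -/
lemma integral_boxSlope_le (hM : Monotone M) (hδ : 0 < δ) (h0 : ∀ r, 0 ≤ M r) (hm : ∀ r, M r ≤ m)
    (r : ℝ) : ∫ s in (0 : ℝ)..r, boxSlope M δ s ≤ 2 * m := by
  have hc := continuous_boxMean hM δ
  have hi : ∀ a b, IntervalIntegrable (boxMean M δ) volume a b := fun a b => hc.intervalIntegrable a b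
  have h1 : ∫ s in (0 : ℝ)..r, boxSlope M δ s =
      δ⁻¹ * ((∫ s in (r - δ)..(r + δ), boxMean M δ s) - ∫ s in (-δ)..δ, boxMean M δ s) := by
    simp only [boxSlope]
    rw [intervalIntegral.integral_const_mul, intervalIntegral.integral_sub
      (by exact (hc.comp (by fun_prop)).intervalIntegrable _ _)
      (by exact (hc.comp (by fun_prop)).intervalIntegrable _ _),
      intervalIntegral.integral_comp_add_right, intervalIntegral.integral_comp_sub_right]
    congr 1
    have e1 := intervalIntegral.integral_add_adjacent_intervals (hi (-δ) (r - δ)) (hi (r - δ) (r + δ))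
    have e2 := intervalIntegral.integral_add_adjacent_intervals (hi (-δ) δ) (hi δ (r + δ))
    simp only [zero_add, zero_sub]
    linarith
  have h2 : ∫ s in (r - δ)..(r + δ), boxMean M δ s ≤ ∫ _ in (r - δ)..(r + δ), m :=
    intervalIntegral.integral_mono_on (by linarith) (hi _ _) (by simp)
      fun s _ => boxMean_le hM hδ hm s
  have h3 : 0 ≤ ∫ s in (-δ)..δ, boxMean M δ s :=
    intervalIntegral.integral_nonneg (by linarith) fun s _ => boxMean_nonneg hδ h0 s
  rw [h1]
  rw [intervalIntegral.integral_const, smul_eq_mul] at h2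
  calc _ ≤ δ⁻¹ * ((r + δ - (r - δ)) * m) := by gcongr; linarith
    _ = 2 * m := by field_simp; ring

end boxMean

/-! ### The radial Carleman weight -/

/-- A smooth cutoff which varies slowly on the logarithmic scale. -/
lemma exists_slow_cutoff {R η : ℝ} (hR : 0 < R) (hη : 0 < η) :
    ∃ (R₁ : ℝ) (χ : ℝ → ℝ), R < R₁ ∧ ContDiff ℝ ∞ χ ∧ (∀ r, 0 ≤ χ r ∧ χ r ≤ 1) ∧
      (∀ r, 0 ≤ r → r ≤ R → χ r = 1) ∧ (∀ r, R₁ ≤ r → χ r = 0) ∧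
      ∀ r, 0 < r → r * |deriv χ r| ≤ η := by
  obtain ⟨S, hS0, hS⟩ : ∃ S : ℝ, 0 < S ∧ ∀ t, |deriv Real.smoothTransition t| ≤ S := by
    have hc : Continuous (deriv Real.smoothTransition) :=
      (Real.smoothTransition.contDiff (n := 1)).continuous_deriv le_rfl
    obtain ⟨C, hC⟩ := isCompact_Icc.exists_bound_of_continuousOn (s := Icc (0 : ℝ) 1) hc.continuousOn
    refine ⟨max C 1, by positivity, fun t => ?_⟩
    rcases lt_or_ge t 0 with h | h
    · have : Real.smoothTransition =ᶠ[nhds t] fun _ => 0 := by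
        filter_upwards [Iio_mem_nhds h] with s hs
        exact Real.smoothTransition.zero_of_nonpos (le_of_lt hs)
      rw [this.deriv_eq]; simp
    rcases le_or_gt t 1 with h' | h'
    · exact (hC t ⟨h, h'⟩).trans (le_max_left _ _)
    · have : Real.smoothTransition =ᶠ[nhds t] fun _ => 1 := by
        filter_upwards [Ioi_mem_nhds h'] with s hs
        exact Real.smoothTransition.one_of_one_le (le_of_lt hs)
      rw [this.deriv_eq]; simp
  -- The profile `q` below satisfies `r |q'(r)| ≤ 2θ`, so this `θ` gives `r |χ'(r)| ≤ 2θS = η`.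
  set θ : ℝ := η / (2 * S) with hθ
  have hθ0 : 0 < θ := by positivity
  have hpos : ∀ r : ℝ, 0 < 1 + r ^ 2 := fun r => by positivity
  set q : ℝ → ℝ := fun r => 1 + θ * (Real.log (1 + R ^ 2) - Real.log (1 + r ^ 2)) with hq
  have hq1 : ∀ r, HasDerivAt q (-(θ * (2 * r / (1 + r ^ 2)))) r := by
    intro r
    have h1 : HasDerivAt (fun r : ℝ => 1 + r ^ 2) (2 * r) r := by
      simpa using (hasDerivAt_pow 2 r).const_add 1
    have := (((h1.log (hpos r).ne').const_sub (Real.log (1 + R ^ 2))).const_mul θ).const_add 1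
    exact this.congr_deriv (by ring)
  have hqc : ContDiff ℝ ∞ q := by
    rw [hq]
    have : ContDiff ℝ ∞ fun r : ℝ => Real.log (1 + r ^ 2) :=
      ContDiff.log (by fun_prop) fun r => (hpos r).ne'
    fun_prop
  have hst : ContDiff ℝ ∞ Real.smoothTransition := Real.smoothTransition.contDiff
  -- The exponential is where `q` has dropped to `0`, in terms of `1 + r²`; the bound `r ≥ R + 1 ≥
  -- 1` is used to compare `r` with `1 + r²` and gives `R < R₁`.
  refine ⟨max (R + 1) (Real.exp (Real.log (1 + R ^ 2) + 1 / θ)), fun r => Real.smoothTransition (q r),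
    by simp, hst.comp hqc,
    fun r => ⟨Real.smoothTransition.nonneg _, Real.smoothTransition.le_one _⟩, ?_, ?_, ?_⟩
  · intro r h0 h
    apply Real.smoothTransition.one_of_one_le
    have : Real.log (1 + r ^ 2) ≤ Real.log (1 + R ^ 2) := Real.log_le_log (hpos r) (by gcongr)
    have := mul_nonneg hθ0.le (sub_nonneg.2 this)
    simp only [hq]; linarith
  · intro r hr
    apply Real.smoothTransition.zero_of_nonpos
    have h1 : R + 1 ≤ r := (le_max_left _ _).trans hr
    have h2 : Real.exp (Real.log (1 + R ^ 2) + 1 / θ) ≤ 1 + r ^ 2 :=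
      ((le_max_right _ _).trans hr).trans (by nlinarith)
    have h3 := Real.log_le_log (Real.exp_pos _) h2
    rw [Real.log_exp] at h3
    have h4 := mul_le_mul_of_nonneg_left h3 hθ0.le
    have : θ * (1 / θ) = 1 := by field_simp
    simp only [hq]; linarith
  · intro r hr
    have hd : HasDerivAt (fun r => Real.smoothTransition (q r))
        (deriv Real.smoothTransition (q r) * -(θ * (2 * r / (1 + r ^ 2)))) r :=
      ((hst.differentiable (by simp)).differentiableAt.hasDerivAt).comp r (hq1 r)
    rw [hd.deriv, abs_mul, abs_neg, abs_of_nonneg (a := θ * (2 * r / (1 + r ^ 2))) (by positivity)]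
    have h1 : r * (2 * r / (1 + r ^ 2)) ≤ 2 := by
      rw [mul_div_assoc', div_le_iff₀ (hpos r)]; nlinarith
    calc _ = |deriv Real.smoothTransition (q r)| * θ * (r * (2 * r / (1 + r ^ 2))) := by ring
      _ ≤ S * θ * 2 := by gcongr; exact hS _
      _ = η := by rw [hθ]; field_simp

/-- Properties of the radial phase `φ` (with derivatives `φ₁`, `φ₂`) of a Carleman weight at
frequency `k`, for a potential whose radial decrease is controlled by the increase of `M`. The
field `quad` is the pointwise positivity on which the Carleman estimate rests. -/
structure CarlemanWeight (M : ℝ → ℝ) (R₀ v₀ v₁ R₁ L T k δ : ℝ) (φ φ₁ φ₂ : ℝ → ℝ) : Prop where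
  hasDerivAt : ∀ r, HasDerivAt φ (φ₁ r) r
  hasDerivAt₁ : ∀ r, 0 < r → HasDerivAt φ₁ (φ₂ r) r
  continuous₁ : Continuous φ₁
  continuousOn₂ : ContinuousOn φ₂ (Ioi 0)
  zero : φ 0 = 0
  nonneg₁ : ∀ r, 0 ≤ r → 0 ≤ φ₁ r
  le₁ : ∀ r, 0 ≤ r → φ₁ r ≤ T
  eq_zero₁ : ∀ r, R₁ ≤ r → φ₁ r = 0
  -- In the application `W` is the radial mean of `V`, `d` the radial difference quotient of `V`,
  -- `e` the difference between `V` and its mean, `a = v` is the conjugated function and `b = N / r`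
  -- its modified radial derivative over the radius.
  quad : ∀ r d e W a b : ℝ, 0 < r → -((M (r + δ) - M r) / δ) ≤ d →
    |e| ≤ δ * (d + 2 * ((M (r + δ) - M r) / δ)) → |e| ≤ v₁ → v₀ ≤ W → (R₀ ≤ r → d = 0 ∧ e = 0) →
    k ^ 2 / 4 * v₀ * (L ^ 2 / (L ^ 2 + r ^ 2)) * a ^ 2 ≤
      k ^ 2 * (L ^ 2 / (L ^ 2 + r ^ 2) * (W + φ₁ r ^ 2) + r * (d + 2 * φ₁ r * φ₂ r)) * a ^ 2 +
        4 * k * r * φ₁ r * b ^ 2 - 2 * k ^ 2 * r * e * a * b + 2 * k * r * φ₂ r * a * b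

/-- In the region where the potential varies, the growth of the phase absorbs its decrease. -/
lemma quad_inner {k δ r τ B B₀ d e v₁ m a b : ℝ} (hk : 1 ≤ k) (hv₁ : 0 < v₁)
    (hδ : δ = 1 / (4 * k * v₁)) (hr : 0 < r) (hτ : 1 ≤ τ) (hτ3 : 128 * v₁ * m ≤ τ ^ 3)
    (hB₀ : B₀ ≤ B) (hB : 0 ≤ B) (hBm : B ≤ m / δ) (hd : -B₀ ≤ d)
    (he : |e| ≤ δ * (d + 2 * B₀)) (he' : |e| ≤ v₁) :
    0 ≤ k ^ 2 * r * (d + 8 * B) * a ^ 2 + 4 * k * r * τ * b ^ 2 - 2 * k ^ 2 * r * e * a * b +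
      2 * k * r * (4 * B / τ) * a * b := by
  have hδ0 : 0 < δ := by rw [hδ]; positivity
  have hτ0 : 0 < τ := by linarith
  -- the commutator with the unregularised potential
  have h1 : 2 * k ^ 2 * r * e * a * b ≤
      k * r * τ * b ^ 2 + k ^ 2 * r * ((d + 2 * B) / 4) * a ^ 2 := by
    have he2 : e ^ 2 ≤ v₁ * (δ * (d + 2 * B)) := by
      have : |e| * |e| ≤ v₁ * (δ * (d + 2 * B)) := by
        have : δ * (d + 2 * B₀) ≤ δ * (d + 2 * B) := by gcongr
        exact mul_le_mul he' (he.trans this) (abs_nonneg _) hv₁.le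
      rwa [← pow_two, sq_abs] at this
    -- This is the choice of `δ`: `k v₁ δ = 1/4` makes the roughness error a quarter of `d + 2B`.
    have he3 : k * e ^ 2 ≤ (d + 2 * B) / 4 := by
      calc k * e ^ 2 ≤ k * (v₁ * (δ * (d + 2 * B))) := by gcongr
        _ = _ := by rw [hδ]; field_simp
    have he4 : k * e ^ 2 / τ ≤ (d + 2 * B) / 4 :=
      (div_le_self (by positivity) hτ).trans he3
    have : 0 ≤ k * r * τ * (b - k * e * a / τ) ^ 2 := by positivity
    have h5 : k * r * τ * (b - k * e * a / τ) ^ 2 =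
        k * r * τ * b ^ 2 - 2 * k ^ 2 * r * e * a * b + k ^ 2 * r * (k * e ^ 2 / τ) * a ^ 2 := by
      field_simp
      ring
    have h6 : k ^ 2 * r * (k * e ^ 2 / τ) * a ^ 2 ≤ k ^ 2 * r * ((d + 2 * B) / 4) * a ^ 2 := by
      gcongr
    linarith
  -- The term with `φ'' = 4B/τ` is split by completing the square. Its cost `16B/τ³` is at most `k`
  -- because `B ≤ m/δ = 4kv₁m` and `τ³ ≥ 128 v₁ m`.
  have h2 : -(2 * k * r * (4 * B / τ) * a * b) ≤ k * r * τ * b ^ 2 + k ^ 2 * r * B * a ^ 2 := by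
    have hB2 : 16 * B / τ ^ 3 ≤ k := by
      rw [div_le_iff₀ (by positivity)]
      calc 16 * B ≤ 16 * (m / δ) := by gcongr
        _ = k * (64 * v₁ * m) := by rw [hδ]; field_simp; ring
        _ ≤ k * τ ^ 3 := by
          have : 0 ≤ m / δ := hB.trans hBm
          have hm : 0 ≤ m := by
            by_contra h
            push Not at h
            have := div_neg_of_neg_of_pos h hδ0
            linarith
          have : 0 ≤ v₁ * m := by positivity
          gcongr
          linarith
    have h5 : k * r * τ * (b + 4 * B * a / τ ^ 2) ^ 2 =
        k * r * τ * b ^ 2 + 2 * k * r * (4 * B / τ) * a * b +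
          k * r * B * (16 * B / τ ^ 3) * a ^ 2 := by
      field_simp
      ring
    have h6 : 0 ≤ k * r * τ * (b + 4 * B * a / τ ^ 2) ^ 2 := by positivity
    have h7 : k * r * B * (16 * B / τ ^ 3) * a ^ 2 ≤ k * r * B * k * a ^ 2 := by gcongr
    nlinarith
  -- After both errors the remaining bracket is `3d/4 + 13B/2`, which is nonnegative since `d ≥ -B₀
  -- ≥ -B`.
  have h3 : 0 ≤ k ^ 2 * r * (d + 8 * B - (d + 2 * B) / 4 - B) * a ^ 2 := by
    have : 0 ≤ d + 8 * B - (d + 2 * B) / 4 - B := by linarith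
    positivity
  have h4 : 0 ≤ k * r * τ * b ^ 2 := by positivity
  nlinarith

/-- In the region where the potential is constant, the phase may be switched off slowly. -/
lemma quad_outer {k r τ T χ χ' ℓ v₀ W η a b : ℝ} (hk : 1 ≤ k) (hr : 1 ≤ r) (hτ : 0 ≤ τ)
    (hτT : τ ≤ T) (hχ0 : 0 ≤ χ) (hχ1 : χ ≤ 1) (hη : r * |χ'| ≤ η) (hη1 : η ≤ 1)
    (hηT : η * (32 * (T ^ 2 + T)) ≤ v₀) (hv₀ : 0 < v₀) (hℓ : 1 / 2 ≤ ℓ) (hW : v₀ ≤ W) :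
    k ^ 2 / 4 * v₀ * ℓ * a ^ 2 ≤
      k ^ 2 * (ℓ * (W + (τ * χ ^ 2) ^ 2) + r * (2 * (τ * χ ^ 2) * (2 * τ * χ * χ'))) * a ^ 2 +
        4 * k * r * (τ * χ ^ 2) * b ^ 2 + 2 * k * r * (2 * τ * χ * χ') * a * b := by
  have hT : 0 ≤ T := hτ.trans hτT
  have hη0 : 0 ≤ η := le_trans (by positivity) hη
  have h1 : -(4 * T ^ 2 * η) ≤ r * (2 * (τ * χ ^ 2) * (2 * τ * χ * χ')) := by
    have : |r * (2 * (τ * χ ^ 2) * (2 * τ * χ * χ'))| ≤ 4 * T ^ 2 * η := by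
      have e : r * (2 * (τ * χ ^ 2) * (2 * τ * χ * χ')) = 4 * τ ^ 2 * χ ^ 3 * (r * χ') := by ring
      have e2 : |r * χ'| = r * |χ'| := by rw [abs_mul, abs_of_nonneg (by linarith : 0 ≤ r)]
      rw [e, abs_mul, e2, abs_of_nonneg (by positivity)]
      have : χ ^ 3 ≤ 1 := pow_le_one₀ hχ0 hχ1
      calc _ ≤ 4 * T ^ 2 * 1 * η := by gcongr
        _ = _ := by ring
    exact (abs_le.1 this).1
  -- The cross term completes a square with `4krτχ²b²`. The remainder is `krτχ'²a²`, with no power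
  -- of `χ` in a denominator; this is why the slope is cut off by `χ²` and not by `χ`.
  have h2 : -(2 * T * η * a ^ 2 * k) ≤
      4 * k * r * (τ * χ ^ 2) * b ^ 2 + 2 * k * r * (2 * τ * χ * χ') * a * b := by
    have e : 4 * k * r * (τ * χ ^ 2) * b ^ 2 + 2 * k * r * (2 * τ * χ * χ') * a * b =
        k * r * τ * ((2 * χ * b + χ' * a) ^ 2 - χ' ^ 2 * a ^ 2) := by ring
    have h3 : r * χ' ^ 2 ≤ η := by
      rw [← sq_abs]
      have h4 : |χ'| ≤ 1 := by
        have : |χ'| ≤ r * |χ'| := le_mul_of_one_le_left (abs_nonneg _) hr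
        linarith
      calc r * |χ'| ^ 2 = r * |χ'| * |χ'| := by ring
        _ ≤ r * |χ'| * 1 := by gcongr
        _ ≤ η := by linarith
    have h5 : τ * (r * χ' ^ 2) ≤ T * η := by gcongr
    have h6 : 0 ≤ k * r * τ * (2 * χ * b + χ' * a) ^ 2 := by positivity
    have h7 : k * a ^ 2 * (τ * (r * χ' ^ 2)) ≤ k * a ^ 2 * (T * η) := by gcongr
    have h8 : 0 ≤ k * a ^ 2 * (T * η) := by positivity
    rw [e]
    nlinarith
  have h3 : 4 * T ^ 2 * η + 2 * T * η ≤ v₀ / 8 := by nlinarith [mul_nonneg (sq_nonneg T) hη0, mul_nonneg hT hη0]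
  have h4 : ℓ * v₀ ≤ ℓ * (W + (τ * χ ^ 2) ^ 2) := by
    have : 0 ≤ (τ * χ ^ 2) ^ 2 := by positivity
    gcongr; linarith
  have h5 : 2 * T * η * a ^ 2 * k ≤ k ^ 2 * (2 * T * η) * a ^ 2 := by
    have : k ≤ k ^ 2 := by nlinarith
    have h0 : 0 ≤ 2 * T * η * a ^ 2 := by positivity
    nlinarith
  have h6 : v₀ / 8 ≤ 3 / 4 * (ℓ * v₀) := by nlinarith
  have h7 : 0 ≤ k ^ 2 * a ^ 2 * (ℓ * (W + (τ * χ ^ 2) ^ 2) - 1 / 4 * (ℓ * v₀) - 4 * T ^ 2 * η - 2 * T * η) := by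
    apply mul_nonneg (by positivity); linarith
  have h8 : 0 ≤ k ^ 2 * a ^ 2 * (r * (2 * (τ * χ ^ 2) * (2 * τ * χ * χ')) + 4 * T ^ 2 * η) := by
    apply mul_nonneg (by positivity); linarith
  nlinarith

/-- The potential term `ℓW ≥ ℓv₀` pays for the left side on its own, so only the terms without the
factor `ℓ` need a sign. -/
lemma quad_of_le {k ℓ v₀ W p X a Y : ℝ} (hℓ : 0 ≤ ℓ) (hv₀ : 0 ≤ v₀) (hW : v₀ ≤ W)
    (h : 0 ≤ k ^ 2 * X * a ^ 2 + Y) :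
    k ^ 2 / 4 * v₀ * ℓ * a ^ 2 ≤ k ^ 2 * (ℓ * (W + p ^ 2) + X) * a ^ 2 + Y := by
  have h4 : ℓ * v₀ ≤ ℓ * (W + p ^ 2) := by gcongr; nlinarith [sq_nonneg p]
  have h5 : 0 ≤ k ^ 2 * a ^ 2 * (ℓ * (W + p ^ 2) - ℓ * v₀ / 4) := by
    apply mul_nonneg (by positivity)
    nlinarith [mul_nonneg hℓ hv₀]
  linarith

/-- The slope is `φ' = τχ²` with `τ² = A² + 8∫B`. Then `(τ²)' = 8B` dominates the decrease of the
potential, while `B` vanishes beyond `R₀ + δ`, where only the cutoff acts. The radii and the slope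
bound are chosen before `k` and `δ`, so the loss `exp(kφ)` is exponential in `k` with a fixed rate.
-/
theorem exists_carlemanWeight {M : ℝ → ℝ} {m R₀ v₀ v₁ : ℝ} (hM : Monotone M) (h0 : ∀ r, 0 ≤ M r)
    (hm : ∀ r, M r ≤ m) (hR₀ : 0 < R₀) (hconst : ∀ r, R₀ ≤ r → M r = M R₀) (hv₀ : 0 < v₀)
    (hv₁ : 0 < v₁) :
    ∃ R₁ L T : ℝ, R₀ < R₁ ∧ R₁ ≤ L ∧ 1 ≤ T ∧ ∀ k δ : ℝ, 1 ≤ k → δ = 1 / (4 * k * v₁) → δ ≤ 1 →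
      ∃ φ φ₁ φ₂ : ℝ → ℝ, CarlemanWeight M R₀ v₀ v₁ R₁ L T k δ φ φ₁ φ₂ := by
  have hm0 : 0 ≤ m := (h0 0).trans (hm 0)
  -- With this `A`, both `τ ≥ 1` and `τ³ ≥ 128 v₁ m` hold, as `quad_inner` requires.
  set A : ℝ := 1 + 128 * v₁ * m with hA
  have hA1 : 1 ≤ A := by rw [hA]; nlinarith [mul_nonneg hv₁.le hm0]
  have hA3 : 128 * v₁ * m ≤ A ^ 3 := by
    have : A ≤ A ^ 3 := le_self_pow₀ hA1 (by norm_num)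
    linarith
  -- Since `8∫B ≤ 16m`, this bounds `τ` for every `δ`.
  set T : ℝ := √(A ^ 2 + 16 * m) with hT
  have hAT : A ≤ T := Real.le_sqrt_of_sq_le (by linarith)
  have hT1 : 1 ≤ T := hA1.trans hAT
  set η : ℝ := min 1 (v₀ / (32 * (T ^ 2 + T))) with hη
  have hη0 : 0 < η := by positivity
  have hηT : η * (32 * (T ^ 2 + T)) ≤ v₀ := by
    rw [← le_div_iff₀ (by positivity)]; exact min_le_right _ _
  obtain ⟨R₁, χ, hR₁, hχc, hχ01, hχ1, hχ0, hχd⟩ := exists_slow_cutoff (R := R₀ + 1) (by linarith) hη0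
  -- Taking `L = R₁` makes `L²/(L² + r²) ≥ 1/2` wherever the cutoff is active.
  refine ⟨R₁, R₁, T, by linarith, le_rfl, hT1, fun k δ hk hδ hδ1 => ?_⟩
  have hδ0 : 0 < δ := by rw [hδ]; positivity
  set B := boxSlope M δ with hB
  have hBc : Continuous B := continuous_boxSlope hM δ
  set P : ℝ → ℝ := fun r => A ^ 2 + 8 * ∫ s in (0 : ℝ)..r, B s with hP
  have hPd : ∀ r, HasDerivAt P (8 * B r) r := fun r =>
    ((hBc.integral_hasStrictDerivAt 0 r).hasDerivAt.const_mul 8).const_add (A ^ 2)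
  have hPpos : ∀ r, 0 ≤ r → A ^ 2 ≤ P r := fun r hr => by
    have := intervalIntegral.integral_nonneg (μ := volume) (f := B) hr
      fun s _ => boxSlope_nonneg hM hδ0 s
    simp only [hP]; linarith
  have hPle : ∀ r, P r ≤ A ^ 2 + 16 * m := fun r => by
    have := integral_boxSlope_le hM hδ0 h0 hm r
    simp only [hP, hB]; linarith
  set τ : ℝ → ℝ := fun r => √(P r) with hτ
  have hτA : ∀ r, 0 ≤ r → A ≤ τ r := fun r hr => Real.le_sqrt_of_sq_le (hPpos r hr)
  have hτT : ∀ r, τ r ≤ T := fun r => Real.sqrt_le_sqrt (hPle r)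
  have hPc : Continuous P := continuous_iff_continuousAt.2 fun r => (hPd r).continuousAt
  have hτc : Continuous τ := hPc.sqrt
  have hτd : ∀ r, 0 < r → HasDerivAt τ (4 * B r / τ r) r := fun r hr => by
    have hp : P r ≠ 0 := by nlinarith [hPpos r hr.le]
    exact ((hPd r).sqrt hp).congr_deriv (by
      have : τ r ≠ 0 := by linarith [hτA r hr.le]
      simp only [hτ] at this ⊢
      field_simp; ring)
  have hχdiff : ∀ r, HasDerivAt χ (deriv χ r) r := fun r =>
    (hχc.differentiable (by simp)).differentiableAt.hasDerivAt
  have hχ'c : Continuous (deriv χ) := hχc.continuous_deriv (by simp)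
  set φ₁ : ℝ → ℝ := fun r => τ r * χ r ^ 2 with hφ₁
  set φ₂ : ℝ → ℝ := fun r => 4 * B r / τ r * χ r ^ 2 + τ r * (2 * χ r * deriv χ r) with hφ₂
  have hφ₁c : Continuous φ₁ := hτc.mul (hχc.continuous.pow 2)
  refine ⟨fun r => ∫ s in (0 : ℝ)..r, φ₁ s, φ₁, φ₂, ?_⟩
  refine
    { hasDerivAt := fun r => (hφ₁c.integral_hasStrictDerivAt 0 r).hasDerivAt
      hasDerivAt₁ := fun r hr => ?_
      continuous₁ := hφ₁c
      continuousOn₂ := ?_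
      zero := by simp
      nonneg₁ := fun r hr => by
        have := hτA r hr
        simp only [hφ₁]
        have : 0 ≤ τ r := by linarith
        positivity
      le₁ := fun r hr => by
        have h1 := hτA r hr
        have h2 := hτT r
        have h3 : χ r ^ 2 ≤ 1 := pow_le_one₀ (hχ01 r).1 (hχ01 r).2
        calc τ r * χ r ^ 2 ≤ T * 1 := by gcongr
          _ = T := mul_one T
      eq_zero₁ := fun r hr => by simp [hφ₁, hχ0 r hr]
      quad := ?_ }
  · exact ((hτd r hr).mul ((hχdiff r).pow 2)).congr_deriv (by simp [hφ₂])
  · have h1 : ContinuousOn (fun r => 4 * B r / τ r) (Ioi 0) :=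
      (by fun_prop : Continuous fun r => 4 * B r).continuousOn.div hτc.continuousOn fun r hr => by
        have := hτA r (le_of_lt hr); linarith
    have h2 := hχc.continuous
    exact (h1.mul (by fun_prop)).add (by fun_prop)
  · intro r d e W a b hr hd he he' hW hout
    have hℓ0 : 0 ≤ R₁ ^ 2 / (R₁ ^ 2 + r ^ 2) := by positivity
    set ℓ := R₁ ^ 2 / (R₁ ^ 2 + r ^ 2) with hℓ
    rcases le_or_gt r (R₀ + 1) with h | h
    · have hχr := hχ1 r hr.le h
      have hτr := hτA r hr.le
      have hd0 : τ r * (2 * 1 * deriv χ r) = 0 := by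
        have : deriv χ r = 0 := by
          -- At the endpoint `r = R₀ + 1` the cutoff need not be locally constant, but it attains
          -- its maximum `1`.
          have hmax : IsLocalMax χ r := Filter.Eventually.of_forall fun s => by
            rw [hχr]; exact (hχ01 s).2
          exact hmax.deriv_eq_zero
        simp [this]
      have e1 : φ₁ r = τ r := by simp [hφ₁, hχr]
      have e2 : φ₂ r = 4 * B r / τ r := by
        simp only [hφ₂, hχr, hd0]; ring
      have e3 : 2 * τ r * (4 * B r / τ r) = 8 * B r := by
        have : τ r ≠ 0 := by linarith
        field_simp; ring
      have key := quad_inner (a := a) (b := b) (τ := τ r) (m := m) hk hv₁ hδ hr (hA1.trans hτr)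
        (hA3.trans (by gcongr)) (slope_le_boxSlope hM hδ0 r) (boxSlope_nonneg hM hδ0 r)
        (boxSlope_le hM hδ0 h0 hm r) hd he he'
      rw [e1, e2, e3]
      rw [← hB] at key
      refine (quad_of_le (X := r * (d + 8 * B r)) (p := τ r) (Y := 4 * k * r * τ r * b ^ 2 - 2 * k ^ 2 * r * e * a * b +
        2 * k * r * (4 * B r / τ r) * a * b) hℓ0 hv₀.le hW ?_).trans_eq (by ring)
      exact key.trans_eq (by ring)
    · obtain ⟨rfl, rfl⟩ := hout (le_trans (by simp) h.le)
      have hB0 : B r = 0 := boxSlope_eq_zero hδ0 hconst (le_trans (by gcongr) h.le)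
      have e2 : φ₂ r = 2 * τ r * χ r * deriv χ r := by simp only [hφ₂, hB0]; ring
      rcases le_or_gt r R₁ with h' | h'
      · have hr1 : 1 ≤ r := le_trans (by simpa using hR₀.le) h.le
        have hℓ2 : 1 / 2 ≤ ℓ := by
          have : r ^ 2 ≤ R₁ ^ 2 := by gcongr
          rw [hℓ, div_le_div_iff₀ (by norm_num) (by positivity)]
          clear_value ℓ
          clear * - this
          linarith
        have key := quad_outer (a := a) (b := b) (χ' := deriv χ r) hk hr1
          (zero_le_one.trans (hA1.trans (hτA r hr.le))) (hτT r) (hχ01 r).1 (hχ01 r).2 (hχd r hr)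
          (min_le_left _ _) hηT hv₀ hℓ2 hW
        rw [e2]
        refine key.trans_eq ?_
        simp only [hφ₁]
        ring
      · have hz : χ r = 0 := hχ0 r h'.le
        have e1 : φ₁ r = 0 := by simp [hφ₁, hz]
        rw [e2, e1, hz]
        exact (quad_of_le (X := 0) (Y := 0) (p := 0) hℓ0 hv₀.le hW (by simp)).trans_eq (by ring)

/-! ### Partial derivatives on Euclidean space -/

section PartialDerivatives

variable {n : ℕ}

/-- The partial derivative `∂ᵢ f` of a real function on `ℝⁿ`. -/
def pd (i : Fin n) (f : Eucl n → ℝ) (x : Eucl n) : ℝ := fderiv ℝ f x (EuclideanSpace.single i 1)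

variable {i j : Fin n} {f g : Eucl n → ℝ} {x : Eucl n}

lemma pd_add (hf : DifferentiableAt ℝ f x) (hg : DifferentiableAt ℝ g x) :
    pd i (fun y => f y + g y) x = pd i f x + pd i g x := by
  simp [pd, fderiv_fun_add hf hg]

lemma pd_sub (hf : DifferentiableAt ℝ f x) (hg : DifferentiableAt ℝ g x) :
    pd i (fun y => f y - g y) x = pd i f x - pd i g x := by
  simp [pd, fderiv_fun_sub hf hg]

lemma pd_mul (hf : DifferentiableAt ℝ f x) (hg : DifferentiableAt ℝ g x) :
    pd i (fun y => f y * g y) x = f x * pd i g x + pd i f x * g x := by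
  simp [pd, fderiv_fun_mul hf hg, mul_comm]

lemma pd_const_mul (hf : DifferentiableAt ℝ f x) (a : ℝ) :
    pd i (fun y => a * f y) x = a * pd i f x := by
  simp [pd, fderiv_const_mul hf]

lemma pd_pow_two (hf : DifferentiableAt ℝ f x) :
    pd i (fun y => f y ^ 2) x = 2 * f x * pd i f x := by
  have := pd_mul (i := i) hf hf
  simp only [← pow_two] at this
  rw [this]; ring

lemma pd_sum {ι : Type*} {s : Finset ι} {f : ι → Eucl n → ℝ}
    (hf : ∀ a ∈ s, DifferentiableAt ℝ (f a) x) :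
    pd i (fun y => ∑ a ∈ s, f a y) x = ∑ a ∈ s, pd i (f a) x := by
  simp [pd, fderiv_fun_sum hf]

lemma pd_coord : pd i (fun y : Eucl n => y j) x = if i = j then 1 else 0 := by
  have : (fun y : Eucl n => y j) = (EuclideanSpace.proj j : Eucl n →L[ℝ] ℝ) := rfl
  rw [pd, this, ContinuousLinearMap.fderiv]
  simp [eq_comm]

lemma pd_comp {h : ℝ → ℝ} {h' : ℝ} (hh : HasDerivAt h h' (f x)) (hf : DifferentiableAt ℝ f x) :
    pd i (fun y => h (f y)) x = h' * pd i f x := by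
  have : HasFDerivAt (fun y => h (f y)) (h' • fderiv ℝ f x) x := hh.comp_hasFDerivAt x hf.hasFDerivAt
  simp [pd, this.fderiv]

lemma pd_congr (h : f =ᶠ[nhds x] g) : pd i f x = pd i g x := by
  simp [pd, h.fderiv_eq]

lemma differentiableAt_coord (j : Fin n) (x : Eucl n) :
    DifferentiableAt ℝ (fun y : Eucl n => y j) x :=
  (EuclideanSpace.proj j : Eucl n →L[ℝ] ℝ).differentiableAt

lemma contDiff_coord (j : Fin n) : ContDiff ℝ ∞ (fun y : Eucl n => y j) :=
  (EuclideanSpace.proj j : Eucl n →L[ℝ] ℝ).contDiff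

lemma sum_sq_coord (x : Eucl n) : ∑ i, x i ^ 2 = ‖x‖ ^ 2 := by
  rw [EuclideanSpace.norm_sq_eq]; simp

lemma pd_norm_sq : pd i (fun y : Eucl n => ‖y‖ ^ 2) x = 2 * x i := by
  have : (fun y : Eucl n => ‖y‖ ^ 2) = fun y => ∑ j, y j ^ 2 := by
    funext y; rw [sum_sq_coord]
  rw [this, pd_sum (f := fun j y => y j ^ 2) fun a _ => (differentiableAt_coord a x).pow 2]
  simp_rw [pd_pow_two (differentiableAt_coord _ x), pd_coord]
  simp

lemma pd_norm (hx : x ≠ 0) : pd i (fun y : Eucl n => ‖y‖) x = x i / ‖x‖ := by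
  have h1 : (fun y : Eucl n => ‖y‖) = fun y => √(‖y‖ ^ 2) := by
    funext y; rw [Real.sqrt_sq (norm_nonneg _)]
  have h2 : ‖x‖ ^ 2 ≠ 0 := by simpa using hx
  have h3 : DifferentiableAt ℝ (fun y : Eucl n => ‖y‖ ^ 2) x :=
    (contDiff_norm_sq ℝ (n := 1)).differentiable (by simp) x
  rw [h1, pd_comp (Real.hasDerivAt_sqrt h2) h3, pd_norm_sq, Real.sqrt_sq (norm_nonneg _)]
  have : ‖x‖ ≠ 0 := by simpa using hx
  field_simp

lemma differentiableAt_norm' (hx : x ≠ 0) : DifferentiableAt ℝ (fun y : Eucl n => ‖y‖) x :=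
  (contDiffAt_norm ℝ hx (n := 1)).differentiableAt (by simp)

lemma ContDiffAt.pd {m k : WithTop ℕ∞} (hf : ContDiffAt ℝ k f x) (hmk : m + 1 ≤ k) (i : Fin n) :
    ContDiffAt ℝ m (pd i f) x :=
  (hf.fderiv_right hmk).clm_apply contDiffAt_const

lemma ContDiff.pd {m k : WithTop ℕ∞} (hf : ContDiff ℝ k f) (hmk : m + 1 ≤ k) (i : Fin n) :
    ContDiff ℝ m (pd i f) :=
  contDiff_iff_contDiffAt.2 fun _ => hf.contDiffAt.pd hmk i

lemma HasCompactSupport.pd (hf : HasCompactSupport f) (i : Fin n) : HasCompactSupport (pd i f) :=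
  hf.fderiv_apply ℝ _

lemma pd_pd_comm (hf : ContDiffAt ℝ 2 f x) : pd i (pd j f) x = pd j (pd i f) x := by
  have h := hf.isSymmSndFDerivAt (by simp)
  have hd : DifferentiableAt ℝ (fderiv ℝ f) x :=
    (hf.fderiv_right (m := 1) (by norm_num)).differentiableAt (by simp)
  have key : ∀ a b : Fin n, pd a (pd b f) x =
      fderiv ℝ (fderiv ℝ f) x (EuclideanSpace.single a 1) (EuclideanSpace.single b 1) := by
    intro a b
    have : pd b f = fun y => fderiv ℝ f y (EuclideanSpace.single b 1) := rfl
    rw [this, pd, fderiv_clm_apply hd (by fun_prop)]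
    simp
  rw [key, key, h]

lemma fderiv_self_eq_sum (f : Eucl n → ℝ) (x y : Eucl n) :
    fderiv ℝ f x y = ∑ i, y i * pd i f x := by
  conv_lhs => rw [← (EuclideanSpace.basisFun (Fin n) ℝ).sum_repr y]
  simp [pd, map_sum]

/-- The integral of a partial derivative of a compactly supported function vanishes. -/
lemma integral_pd_eq_zero (hf : ContDiff ℝ 1 f) (hs : HasCompactSupport f) (i : Fin n) :
    ∫ x, pd i f x = 0 := by
  have hc : Continuous (pd i f) := (hf.pd (m := 0) (by norm_num) i).continuous
  have h1 : Integrable (pd i f) := hc.integrable_of_hasCompactSupport (hs.pd i)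
  have h2 : Integrable f := hf.continuous.integrable_of_hasCompactSupport hs
  have := integral_mul_fderiv_eq_neg_fderiv_mul_of_integrable (μ := (volume : Measure (Eucl n)))
    (f := fun _ => (1 : ℝ)) (g := f) (v := EuclideanSpace.single i 1) (by simp)
    (by simp only [one_mul]; exact h1) (by simp only [one_mul]; exact h2)
    (by fun_prop) (fun x _ => hf.differentiable (by simp) x)
  simp only [one_mul, fderiv_fun_const, Pi.zero_apply, zero_apply, zero_mul,
    integral_zero, neg_zero] at this
  exact this

end PartialDerivatives

/-! ### A divergence inequality for fields singular at the origin -/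

section Divergence

variable {n : ℕ}

/-- A smooth function which vanishes near the origin and equals `1` outside a ball. -/
def awayFromZero (x : Eucl n) : ℝ := Real.smoothTransition (‖x‖ ^ 2 - 1)

lemma contDiff_awayFromZero : ContDiff ℝ ∞ (awayFromZero : Eucl n → ℝ) :=
  Real.smoothTransition.contDiff.comp ((contDiff_norm_sq ℝ).sub contDiff_const)

lemma awayFromZero_eq_zero {x : Eucl n} (hx : ‖x‖ ≤ 1) : awayFromZero x = 0 :=
  Real.smoothTransition.zero_of_nonpos (by nlinarith [norm_nonneg x])

lemma awayFromZero_eq_one {x : Eucl n} (hx : 2 ≤ ‖x‖) : awayFromZero x = 1 :=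
  Real.smoothTransition.one_of_one_le (by nlinarith [norm_nonneg x])

lemma hasCompactSupport_pd_awayFromZero (i : Fin n) :
    HasCompactSupport (pd i (awayFromZero : Eucl n → ℝ)) := by
  refine HasCompactSupport.intro (isCompact_closedBall (0 : Eucl n) 2) fun x hx => ?_
  have : (awayFromZero : Eucl n → ℝ) =ᶠ[nhds x] fun _ => 1 := by
    have hx' : 2 < ‖x‖ := by simpa using hx
    filter_upwards [(continuous_norm.continuousAt (x := x)).eventually (lt_mem_nhds hx')] with y hy
    exact awayFromZero_eq_one hy.le
  rw [pd_congr this]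
  simp [pd]

/-- A one-sided divergence theorem for vector fields that are bounded near a singularity at the
origin: if `div J ≥ h` away from the origin then `∫ h ≤ 0`. -/
theorem integral_nonpos_of_le_div (hn : 2 ≤ n) {J : Fin n → Eucl n → ℝ} {h : Eucl n → ℝ} {C : ℝ}
    (hJ : ∀ i x, x ≠ 0 → ContDiffAt ℝ 1 (J i) x) (hJs : ∀ i, HasCompactSupport (J i))
    (hJC : ∀ i x, |J i x| ≤ C) (hh : Integrable h)
    (hdiv : ∀ᵐ x, x ≠ 0 → h x ≤ ∑ i, pd i (J i) x) : ∫ x, h x ≤ 0 := by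
  have hC : 0 ≤ C := (abs_nonneg _).trans (hJC ⟨0, by omega⟩ 0)
  set I : ℝ := ∑ i : Fin n, ∫ x, |pd i (awayFromZero : Eucl n → ℝ) x| with hI
  set ζ : ℝ → Eucl n → ℝ := fun ε x => awayFromZero (ε⁻¹ • x) with hζ
  have hζc : ∀ ε, ContDiff ℝ ∞ (ζ ε) := fun ε => contDiff_awayFromZero.comp (by fun_prop)
  have hζ01 : ∀ ε x, 0 ≤ ζ ε x ∧ ζ ε x ≤ 1 := fun ε x =>
    ⟨Real.smoothTransition.nonneg _, Real.smoothTransition.le_one _⟩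
  have hpζ : ∀ ε i x, pd i (ζ ε) x = ε⁻¹ * pd i awayFromZero (ε⁻¹ • x) := by
    intro ε i x
    simp only [hζ, pd]
    rw [fderiv_comp_smul]
    simp
  -- The gradient of the cutoff at scale `ε` has size `1/ε` on a set of volume of order `εⁿ`, so for
  -- bounded `J` the error is of order `ε^(n-1)`, which tends to zero because `n ≥ 2`.
  have key : ∀ ε : ℝ, 0 < ε → ∫ x, ζ ε x * h x ≤ C * I * ε ^ (n - 1) := by
    intro ε hε
    have hKc : ∀ i, ContDiff ℝ 1 (fun x => ζ ε x * J i x) := by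
      intro i
      rw [contDiff_iff_contDiffAt]
      intro x
      by_cases hx : x = 0
      · have : (fun x => ζ ε x * J i x) =ᶠ[nhds x] fun _ => 0 := by
          rw [hx]
          filter_upwards [Metric.ball_mem_nhds (0 : Eucl n) hε] with y hy
          have hy' : ‖y‖ < ε := by simpa using hy
          have : ζ ε y = 0 := awayFromZero_eq_zero (by
            rw [norm_smul, norm_inv, Real.norm_of_nonneg hε.le, inv_mul_le_iff₀ hε]; linarith)
          simp [this]
        exact contDiffAt_const.congr_of_eventuallyEq this
      · exact ((hζc ε).of_le (by exact_mod_cast le_top)).contDiffAt.mul (hJ i x hx)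
    have hKs : ∀ i, HasCompactSupport (fun x => ζ ε x * J i x) := fun i => (hJs i).mul_left
    have hKd : ∀ i, Integrable (pd i (fun x => ζ ε x * J i x)) := fun i =>
      ((hKc i).pd (m := 0) (by norm_num) i).continuous.integrable_of_hasCompactSupport ((hKs i).pd i)
    have hsum : ∫ x, ∑ i, pd i (fun x => ζ ε x * J i x) x = 0 := by
      rw [integral_finsetSum _ fun i _ => hKd i]
      exact Finset.sum_eq_zero fun i _ => integral_pd_eq_zero (hKc i) (hKs i) i
    have hpi : ∀ i, Integrable (fun x => |pd i (ζ ε) x|) := by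
      intro i
      simp only [hpζ, abs_mul]
      apply Integrable.const_mul
      have h1 : Integrable (fun x : Eucl n => |pd i awayFromZero x|) :=
        ((contDiff_awayFromZero.pd (m := 0) (by simp)
        i).continuous.integrable_of_hasCompactSupport (hasCompactSupport_pd_awayFromZero i)).abs
      exact h1.comp_smul (inv_ne_zero hε.ne')
    have hle : ∫ x, ζ ε x * h x ≤
        ∫ x, (∑ i, pd i (fun x => ζ ε x * J i x) x) + C * ∑ i, |pd i (ζ ε) x| := by
      apply integral_mono_ae
      · exact hh.bdd_mul (c := 1) (hζc ε).continuous.aestronglyMeasurable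
          (Filter.Eventually.of_forall fun x => by
            rw [Real.norm_of_nonneg (hζ01 ε x).1]; exact (hζ01 ε x).2)
      · exact (integrable_finsetSum _ fun i _ => hKd i).add
          ((integrable_finsetSum _ fun i _ => hpi i).const_mul _)
      · have h0 : ∀ᵐ x : Eucl n, x ≠ 0 := by
          have : Nonempty (Fin n) := ⟨⟨0, by omega⟩⟩
          have : Nontrivial (Eucl n) := inferInstance
          exact Measure.ae_ne volume 0
        filter_upwards [hdiv, h0] with x hx hx0
        have e : ∀ i, pd i (fun x => ζ ε x * J i x) x =
            ζ ε x * pd i (J i) x + pd i (ζ ε) x * J i x := fun i =>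
          pd_mul ((hζc ε).differentiable (by simp) x) ((hJ i x hx0).differentiableAt (by simp))
        simp only [e]
        rw [Finset.sum_add_distrib, ← Finset.mul_sum, add_assoc, Finset.mul_sum (a := C),
          ← Finset.sum_add_distrib]
        have h1 := mul_le_mul_of_nonneg_left (hx hx0) (hζ01 ε x).1
        have h2 : 0 ≤ ∑ i, (pd i (ζ ε) x * J i x + C * |pd i (ζ ε) x|) := by
          refine Finset.sum_nonneg fun i _ => ?_
          have : |pd i (ζ ε) x * J i x| ≤ |pd i (ζ ε) x| * C := by
            rw [abs_mul]; exact mul_le_mul_of_nonneg_left (hJC i x) (abs_nonneg _)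
          linarith [(abs_le.1 this).1]
        linarith
    refine hle.trans ?_
    rw [integral_add (integrable_finsetSum _ fun i _ => hKd i)
          ((integrable_finsetSum _ fun i _ => hpi i).const_mul _), hsum, zero_add,
      integral_const_mul, integral_finsetSum _ fun i _ => hpi i, mul_assoc]
    refine mul_le_mul_of_nonneg_left (le_of_eq ?_) hC
    rw [hI, Finset.sum_mul]
    refine Finset.sum_congr rfl fun i _ => ?_
    simp only [hpζ, abs_mul]
    rw [integral_const_mul, Measure.integral_comp_smul volume
      (fun x => |pd i (awayFromZero : Eucl n → ℝ) x|) ε⁻¹]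
    simp only [finrank_euclideanSpace, Fintype.card_fin, smul_eq_mul, inv_pow, inv_inv]
    rw [abs_of_pos (inv_pos.2 hε), abs_of_pos (by positivity)]
    obtain ⟨m, rfl⟩ : ∃ m, n = m + 1 := ⟨n - 1, by omega⟩
    simp only [Nat.add_sub_cancel]
    field_simp
    ring
  -- let the cutoff radius tend to zero
  have hlim : Filter.Tendsto (fun m : ℕ => ∫ x, ζ (1 / ((m : ℝ) + 1)) x * h x) Filter.atTop
      (nhds (∫ x, h x)) := by
    refine tendsto_integral_of_dominated_convergence (fun x => ‖h x‖)
      (fun m => (hζc _).continuous.aestronglyMeasurable.mul hh.aestronglyMeasurable) hh.norm ?_ ?_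
    · intro m
      filter_upwards with x
      rw [norm_mul, Real.norm_of_nonneg (hζ01 _ x).1]
      exact mul_le_of_le_one_left (norm_nonneg _) (hζ01 _ x).2
    · have h0 : ∀ᵐ x : Eucl n, x ≠ 0 := by
        have : Nonempty (Fin n) := ⟨⟨0, by omega⟩⟩
        have : Nontrivial (Eucl n) := inferInstance
        exact Measure.ae_ne volume 0
      filter_upwards [h0] with x hx
      have hx' : 0 < ‖x‖ := norm_pos_iff.2 hx
      have hev : ∀ᶠ m : ℕ in Filter.atTop, ζ (1 / ((m : ℝ) + 1)) x * h x = h x := by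
        filter_upwards [Filter.eventually_ge_atTop ⌈2 / ‖x‖⌉₊] with m hm
        have hm' : 2 / ‖x‖ ≤ m := Nat.ceil_le.1 hm
        rw [div_le_iff₀ hx'] at hm'
        have : ζ (1 / ((m : ℝ) + 1)) x = 1 := awayFromZero_eq_one (by
          rw [norm_smul, one_div, inv_inv, Real.norm_of_nonneg (by positivity)]
          nlinarith)
        rw [this, one_mul]
      exact tendsto_const_nhds.congr' (hev.mono fun _ h => h.symm)
  have hlim2 : Filter.Tendsto (fun m : ℕ => C * I * (1 / ((m : ℝ) + 1)) ^ (n - 1)) Filter.atTop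
      (nhds 0) := by
    have := (tendsto_one_div_add_atTop_nhds_zero_nat (𝕜 := ℝ)).pow (n - 1)
    rw [zero_pow (by omega)] at this
    simpa using this.const_mul (C * I)
  exact le_of_tendsto_of_tendsto' hlim hlim2 fun m => key _ (by positivity)

end Divergence

/-! ### The multiplier identity -/

section Multiplier

variable {n : ℕ}

/-- The Euler field `x · ∇` applied to `v`. -/
def eulerD (v : Eucl n → ℝ) (x : Eucl n) : ℝ := ∑ j, x j * pd j v x

/-- The classical Laplacian `∑ᵢ ∂ᵢ² v`. -/
def lap (v : Eucl n → ℝ) (x : Eucl n) : ℝ := ∑ i, pd i (pd i v) x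

/-- `|∇ v|²`. -/
def gradSq (v : Eucl n → ℝ) (x : Eucl n) : ℝ := ∑ i, pd i v x ^ 2

/-- The bounded weight `(L² + |x|²)^(-1/2)`. -/
def gw (L : ℝ) (x : Eucl n) : ℝ := (√(L ^ 2 + ‖x‖ ^ 2))⁻¹

variable {L : ℝ} {x : Eucl n} {i : Fin n} {v q : Eucl n → ℝ}

lemma gw_pos (hL : 0 < L) (x : Eucl n) : 0 < gw L x := by
  have : 0 < L ^ 2 + ‖x‖ ^ 2 := by positivity
  unfold gw; positivity

lemma gw_sq (x : Eucl n) : gw L x ^ 2 = (L ^ 2 + ‖x‖ ^ 2)⁻¹ := by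
  have : 0 ≤ L ^ 2 + ‖x‖ ^ 2 := by positivity
  rw [gw, inv_pow, Real.sq_sqrt this]

lemma gw_sq_mul (hL : 0 < L) (x : Eucl n) : gw L x ^ 2 * (L ^ 2 + ‖x‖ ^ 2) = 1 := by
  rw [gw_sq, inv_mul_cancel₀ (by positivity)]

lemma contDiff_gw (hL : 0 < L) : ContDiff ℝ ∞ (gw L : Eucl n → ℝ) := by
  have h : ∀ x : Eucl n, L ^ 2 + ‖x‖ ^ 2 ≠ 0 := fun x => by positivity
  have h1 : ContDiff ℝ ∞ fun x : Eucl n => L ^ 2 + ‖x‖ ^ 2 :=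
    contDiff_const.add (contDiff_norm_sq ℝ)
  exact (h1.sqrt h).inv fun x => by have := h x; positivity

lemma pd_gw (hL : 0 < L) : pd i (gw L) x = -(gw L x ^ 3 * x i) := by
  have h0 : 0 < L ^ 2 + ‖x‖ ^ 2 := by positivity
  have h1 : DifferentiableAt ℝ (fun y : Eucl n => ‖y‖ ^ 2) x :=
    (contDiff_norm_sq ℝ (n := 1)).differentiable (by simp) x
  have h2 : HasDerivAt (fun s : ℝ => (√(L ^ 2 + s))⁻¹)
      (-(1 / (2 * √(L ^ 2 + ‖x‖ ^ 2))) / √(L ^ 2 + ‖x‖ ^ 2) ^ 2) (‖x‖ ^ 2) := by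
    have h3 : HasDerivAt (fun s : ℝ => L ^ 2 + s) 1 (‖x‖ ^ 2) := (hasDerivAt_id _).const_add _
    exact (h3.sqrt h0.ne').inv (Real.sqrt_pos.2 h0).ne'
  have h4 := pd_comp (i := i) h2 h1
  change pd i (gw L) x = _ at h4
  rw [h4, pd_norm_sq, gw]
  have := (Real.sqrt_pos.2 h0).ne'
  field_simp

/-- The vector field whose divergence produces the Carleman energy identity. -/
def energyField (L : ℝ) (q v : Eucl n → ℝ) (i : Fin n) (y : Eucl n) : ℝ :=
  gw L y * (2 * (eulerD v y * pd i v y) - gradSq v y * y i) +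
    ((n : ℝ) - 1) * (gw L y * (v y * pd i v y)) +
    ((n : ℝ) - 1) / 2 * (v y ^ 2 * (gw L y ^ 3 * y i)) + q y * (v y ^ 2 * y i)

lemma pd_eulerD (hv : ContDiffAt ℝ 2 v x) :
    pd i (eulerD v) x = pd i v x + ∑ j, x j * pd i (pd j v) x := by
  have hd : ∀ j, DifferentiableAt ℝ (pd j v) x := fun j =>
    (hv.pd (m := 1) (by norm_num) j).differentiableAt (by simp)
  unfold eulerD
  rw [pd_sum fun j _ => (differentiableAt_coord j x).fun_mul (hd j)]
  simp_rw [pd_mul (differentiableAt_coord _ x) (hd _), pd_coord]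
  rw [Finset.sum_add_distrib]
  simp [add_comm]

lemma pd_gradSq (hv : ContDiffAt ℝ 2 v x) :
    pd i (gradSq v) x = 2 * ∑ j, pd j v x * pd i (pd j v) x := by
  have hd : ∀ j, DifferentiableAt ℝ (pd j v) x := fun j =>
    (hv.pd (m := 1) (by norm_num) j).differentiableAt (by simp)
  unfold gradSq
  rw [pd_sum fun j _ => (hd j).fun_pow 2]
  simp_rw [pd_pow_two (hd _)]
  rw [Finset.mul_sum]
  exact Finset.sum_congr rfl fun j _ => by ring

lemma ContDiffAt.eulerD {m k : WithTop ℕ∞} (hv : ContDiffAt ℝ k v x) (hmk : m + 1 ≤ k)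
    (hm : m ≤ ((⊤ : ℕ∞) : WithTop ℕ∞)) : ContDiffAt ℝ m (eulerD v) x :=
  ContDiffAt.sum fun j _ => (((contDiff_coord j).of_le hm).contDiffAt).mul (hv.pd hmk j)

lemma ContDiffAt.gradSq {m k : WithTop ℕ∞} (hv : ContDiffAt ℝ k v x) (hmk : m + 1 ≤ k) :
    ContDiffAt ℝ m (gradSq v) x :=
  ContDiffAt.sum fun j _ => (hv.pd hmk j).pow 2

lemma contDiffAt_energyField (hL : 0 < L) (hv : ContDiffAt ℝ 2 v x) (hq : ContDiffAt ℝ 1 q x)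
    (i : Fin n) : ContDiffAt ℝ 1 (energyField L q v i) x := by
  have hg : ContDiffAt ℝ 1 (gw L) x := ((contDiff_gw hL).of_le (by exact_mod_cast le_top)).contDiffAt
  have hD := hv.eulerD (m := 1) (by norm_num) (by simp)
  have hG := hv.gradSq (m := 1) (by norm_num)
  have hp := hv.pd (m := 1) (by norm_num) i
  have hv1 : ContDiffAt ℝ 1 v x := hv.of_le (by norm_num)
  have hc : ContDiffAt ℝ 1 (fun y : Eucl n => y i) x :=
    ((contDiff_coord i).of_le (by exact_mod_cast le_top)).contDiffAt
  exact (((hg.mul ((contDiffAt_const.mul (hD.mul hp)).sub (hG.mul hc))).add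
    (contDiffAt_const.mul (hg.mul (hv1.mul hp)))).add
    (contDiffAt_const.mul ((hv1.pow 2).mul ((hg.pow 3).mul hc)))).add (hq.mul ((hv1.pow 2).mul hc))

lemma pd_energyField (hL : 0 < L) (hv : ContDiffAt ℝ 2 v x) (hq : DifferentiableAt ℝ q x)
    (i : Fin n) :
    pd i (energyField L q v i) x =
      -(gw L x ^ 3 * x i) * (2 * (eulerD v x * pd i v x) - gradSq v x * x i) +
      gw L x * (2 * (eulerD v x * pd i (pd i v) x +
        (pd i v x + ∑ j, x j * pd i (pd j v) x) * pd i v x) -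
        (gradSq v x + 2 * (∑ j, pd j v x * pd i (pd j v) x) * x i)) +
      ((n : ℝ) - 1) * (-(gw L x ^ 3 * x i) * (v x * pd i v x) +
        gw L x * (v x * pd i (pd i v) x + pd i v x ^ 2)) +
      ((n : ℝ) - 1) / 2 * (2 * v x * pd i v x * (gw L x ^ 3 * x i) +
        v x ^ 2 * (gw L x ^ 3 - 3 * gw L x ^ 5 * x i ^ 2)) +
      (pd i q x * (v x ^ 2 * x i) + q x * (2 * v x * pd i v x * x i + v x ^ 2)) := by
  have hg : DifferentiableAt ℝ (gw L) x := (contDiff_gw hL).differentiable (by simp) x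
  have hD := (hv.eulerD (m := 1) (by norm_num) (by simp)).differentiableAt (by simp)
  have hG := (hv.gradSq (m := 1) (by norm_num)).differentiableAt (by simp)
  have hp := (hv.pd (m := 1) (by norm_num) i).differentiableAt (by simp)
  have hv1 : DifferentiableAt ℝ v x := hv.differentiableAt (by simp)
  have hc := differentiableAt_coord i x
  have hg3 : pd i (fun y => gw L y ^ 3) x = -(3 * gw L x ^ 5 * x i) := by
    have h1 : HasDerivAt (fun s : ℝ => s ^ 3) (3 * gw L x ^ 2) (gw L x) := by
      simpa using hasDerivAt_pow 3 (gw L x)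
    rw [pd_comp h1 hg, pd_gw hL]; ring
  have hci : pd i (fun y : Eucl n => y i) x = 1 := by simp [pd_coord]
  have e1 : pd i (fun y => 2 * (eulerD v y * pd i v y) - gradSq v y * y i) x =
      2 * (eulerD v x * pd i (pd i v) x + (pd i v x + ∑ j, x j * pd i (pd j v) x) * pd i v x) -
        (gradSq v x + 2 * (∑ j, pd j v x * pd i (pd j v) x) * x i) := by
    rw [pd_sub ((hD.fun_mul hp).const_mul 2) (hG.fun_mul hc), pd_const_mul (hD.fun_mul hp), pd_mul hD hp,
      pd_mul hG hc, pd_eulerD hv, pd_gradSq hv, hci]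
    ring
  have e2 : pd i (fun y => v y * pd i v y) x = v x * pd i (pd i v) x + pd i v x ^ 2 := by
    rw [pd_mul hv1 hp]; ring
  have e3 : pd i (fun y => gw L y ^ 3 * y i) x = gw L x ^ 3 - 3 * gw L x ^ 5 * x i ^ 2 := by
    rw [pd_mul (hg.fun_pow 3) hc, hci, hg3]; ring
  have d1 : DifferentiableAt ℝ (fun y => 2 * (eulerD v y * pd i v y) - gradSq v y * y i) x :=
    ((hD.mul hp).const_mul 2).sub (hG.mul hc)
  have d2 : DifferentiableAt ℝ (fun y => gw L y * (v y * pd i v y)) x := hg.mul (hv1.mul hp)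
  have d3 : DifferentiableAt ℝ (fun y => gw L y ^ 3 * y i) x := (hg.pow 3).mul hc
  have d4 : DifferentiableAt ℝ (fun y => v y ^ 2 * y i) x := (hv1.pow 2).mul hc
  have d5 : DifferentiableAt ℝ (fun y => v y ^ 2 * (gw L y ^ 3 * y i)) x := (hv1.pow 2).mul d3
  have d6 := hg.fun_mul d1
  have d7 := d2.const_mul ((n : ℝ) - 1)
  have d8 := d5.const_mul (((n : ℝ) - 1) / 2)
  unfold energyField
  rw [pd_add ((d6.fun_add d7).fun_add d8) (hq.fun_mul d4), pd_add (d6.fun_add d7) d8, pd_add d6 d7,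
    pd_mul hg d1, pd_const_mul d2, pd_mul hg (hv1.fun_mul hp), pd_const_mul d5,
    pd_mul (hv1.fun_pow 2) d3, pd_mul hq d4, pd_mul (hv1.fun_pow 2) hc, pd_pow_two hv1, e1, e2, e3,
    hci, pd_gw hL]
  ring

/-- This is the symmetry of the Hessian. The two sums arise with opposite signs from `2 (x·∇v) ∇v`
and `-|∇v|² x`, so that the divergence contains second derivatives only through the Laplacian. -/
lemma eulerD_mul_sum_comm (hv : ContDiffAt ℝ 2 v x) :
    ∑ i, (∑ j, x j * pd i (pd j v) x) * pd i v x =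
      ∑ i, (∑ j, pd j v x * pd i (pd j v) x) * x i := by
  simp_rw [Finset.sum_mul]
  rw [Finset.sum_comm]
  refine Finset.sum_congr rfl fun i _ => Finset.sum_congr rfl fun j _ => ?_
  rw [pd_pd_comm hv]; ring

/-- The divergence of `energyField`. -/
theorem sum_pd_energyField (hL : 0 < L) (hv : ContDiffAt ℝ 2 v x) (hq : DifferentiableAt ℝ q x) :
    ∑ i, pd i (energyField L q v i) x =
      2 * gw L x * (eulerD v x + ((n : ℝ) - 1) / 2 * v x) * lap v x +
      (gw L x + gw L x ^ 3 * ‖x‖ ^ 2) * gradSq v x - 2 * gw L x ^ 3 * eulerD v x ^ 2 +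
      ((n : ℝ) - 1) / 2 * (n * L ^ 2 + (n - 3) * ‖x‖ ^ 2) * gw L x ^ 5 * v x ^ 2 +
      (∑ i, x i * pd i q x) * v x ^ 2 + 2 * q x * v x * eulerD v x + n * q x * v x ^ 2 := by
  set g := gw L x with hg
  set D := eulerD v x with hD
  set G := gradSq v x with hG
  have s1 : ∑ i, x i * pd i v x = D := rfl
  have s2 : ∑ i, pd i v x ^ 2 = G := rfl
  have s3 : ∑ i, pd i (pd i v) x = lap v x := rfl
  have s4 := sum_sq_coord x
  have s5 := eulerD_mul_sum_comm hv
  set X := ∑ i, (∑ j, x j * pd i (pd j v) x) * pd i v x with hX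
  have hterm : ∀ i, pd i (energyField L q v i) x =
      (-2 * g ^ 3 * D) * (x i * pd i v x) + g ^ 3 * G * x i ^ 2 + 2 * g * D * pd i (pd i v) x +
      2 * g * pd i v x ^ 2 + 2 * g * ((∑ j, x j * pd i (pd j v) x) * pd i v x) - g * G -
      2 * g * ((∑ j, pd j v x * pd i (pd j v) x) * x i) +
      ((n : ℝ) - 1) * g * v x * pd i (pd i v) x + ((n : ℝ) - 1) * g * pd i v x ^ 2 +
      ((n : ℝ) - 1) / 2 * v x ^ 2 * g ^ 3 - 3 * (((n : ℝ) - 1) / 2) * v x ^ 2 * g ^ 5 * x i ^ 2 +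
      v x ^ 2 * (x i * pd i q x) + 2 * q x * v x * (x i * pd i v x) + q x * v x ^ 2 := by
    intro i
    rw [pd_energyField hL hv hq i]
    ring
  simp_rw [hterm]
  simp only [Finset.sum_add_distrib, Finset.sum_sub_distrib, ← Finset.mul_sum, Finset.sum_const,
    Finset.card_univ, Fintype.card_fin, nsmul_eq_mul]
  rw [s1, s2, s3, s4, ← hX, ← s5]
  have hgL : g ^ 2 * (L ^ 2 + ‖x‖ ^ 2) = 1 := gw_sq_mul hL x
  -- Writing `g³` as `g⁵(L² + |x|²)` collects the zero order terms into the factor `nL² + (n -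
  -- 3)|x|²`, which is nonnegative for `n ≥ 3`.
  have h3 : g ^ 3 = g ^ 5 * (L ^ 2 + ‖x‖ ^ 2) := by
    calc g ^ 3 = g ^ 3 * (g ^ 2 * (L ^ 2 + ‖x‖ ^ 2)) := by rw [hgL, mul_one]
      _ = _ := by ring
  linear_combination ((n : ℝ) * (((n : ℝ) - 1) / 2) * v x ^ 2) * h3

end Multiplier

/-! ### Conjugation by the weight and the pointwise lower bound -/

section Conjugation

variable {n : ℕ} {M : ℝ → ℝ} {R₀ v₀ v₁ R₁ L T k δ : ℝ} {φ φ₁ φ₂ : ℝ → ℝ} {u : Eucl n → ℝ}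
  {x : Eucl n} {i : Fin n}

/-- The function `u` conjugated by the radial weight `exp (k φ(|x|))`. -/
def weighted (k : ℝ) (φ : ℝ → ℝ) (u : Eucl n → ℝ) (x : Eucl n) : ℝ := Real.exp (k * φ ‖x‖) * u x

lemma CarlemanWeight.contDiffOn₁ (W : CarlemanWeight M R₀ v₀ v₁ R₁ L T k δ φ φ₁ φ₂) :
    ContDiffOn ℝ 1 φ₁ (Ioi 0) := by
  rw [show (1 : WithTop ℕ∞) = 0 + 1 by norm_num, contDiffOn_succ_iff_deriv_of_isOpen isOpen_Ioi]
  refine ⟨fun r hr => (W.hasDerivAt₁ r hr).differentiableAt.differentiableWithinAt, by simp, ?_⟩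
  rw [contDiffOn_zero]
  exact W.continuousOn₂.congr fun r hr => (W.hasDerivAt₁ r hr).deriv

lemma CarlemanWeight.contDiffAt₁ (W : CarlemanWeight M R₀ v₀ v₁ R₁ L T k δ φ φ₁ φ₂) {r : ℝ}
    (hr : 0 < r) : ContDiffAt ℝ 1 φ₁ r :=
  W.contDiffOn₁.contDiffAt (Ioi_mem_nhds hr)

lemma CarlemanWeight.contDiffAt (W : CarlemanWeight M R₀ v₀ v₁ R₁ L T k δ φ φ₁ φ₂) {r : ℝ}
    (hr : 0 < r) : ContDiffAt ℝ 2 φ r := by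
  have e : deriv φ = φ₁ := funext fun r => (W.hasDerivAt r).deriv
  have c2 : ContDiffOn ℝ 2 φ (Ioi 0) := by
    rw [show (2 : WithTop ℕ∞) = 1 + 1 by norm_num, contDiffOn_succ_iff_deriv_of_isOpen isOpen_Ioi]
    refine ⟨fun r _ => (W.hasDerivAt r).differentiableAt.differentiableWithinAt, by simp, ?_⟩
    rw [e]; exact W.contDiffOn₁
  exact c2.contDiffAt (Ioi_mem_nhds hr)

lemma contDiffAt_weighted (W : CarlemanWeight M R₀ v₀ v₁ R₁ L T k δ φ φ₁ φ₂)
    (hu : ContDiffAt ℝ 2 u x) (hx : x ≠ 0) : ContDiffAt ℝ 2 (weighted k φ u) x := by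
  have h1 : ContDiffAt ℝ 2 (fun y : Eucl n => φ ‖y‖) x :=
    (W.contDiffAt (norm_pos_iff.2 hx)).comp x (contDiffAt_norm ℝ hx)
  exact (contDiffAt_const.mul h1).exp.mul hu

lemma pd_weighted (W : CarlemanWeight M R₀ v₀ v₁ R₁ L T k δ φ φ₁ φ₂)
    (hu : DifferentiableAt ℝ u x) (hx : x ≠ 0) :
    pd i (weighted k φ u) x =
      Real.exp (k * φ ‖x‖) * (pd i u x + k * (φ₁ ‖x‖ / ‖x‖) * (x i * u x)) := by
  have hE : HasDerivAt (fun r => Real.exp (k * φ r)) (Real.exp (k * φ ‖x‖) * (k * φ₁ ‖x‖)) ‖x‖ :=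
    ((W.hasDerivAt ‖x‖).const_mul k).exp
  have hd : DifferentiableAt ℝ (fun y : Eucl n => Real.exp (k * φ ‖y‖)) x :=
    hE.differentiableAt.comp x (differentiableAt_norm' hx)
  unfold weighted
  rw [pd_mul hd hu, pd_comp hE (differentiableAt_norm' hx), pd_norm hx]
  ring

lemma eulerD_weighted (W : CarlemanWeight M R₀ v₀ v₁ R₁ L T k δ φ φ₁ φ₂)
    (hu : DifferentiableAt ℝ u x) (hx : x ≠ 0) :
    eulerD (weighted k φ u) x =
      Real.exp (k * φ ‖x‖) * (eulerD u x + k * ‖x‖ * φ₁ ‖x‖ * u x) := by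
  have h0 : ‖x‖ ≠ 0 := norm_ne_zero_iff.2 hx
  unfold eulerD
  simp_rw [pd_weighted W hu hx]
  have : ∀ j, x j * (Real.exp (k * φ ‖x‖) * (pd j u x + k * (φ₁ ‖x‖ / ‖x‖) * (x j * u x))) =
      Real.exp (k * φ ‖x‖) * (x j * pd j u x) +
        Real.exp (k * φ ‖x‖) * (k * (φ₁ ‖x‖ / ‖x‖) * u x) * x j ^ 2 := fun j => by ring
  simp_rw [this]
  rw [Finset.sum_add_distrib, ← Finset.mul_sum, ← Finset.mul_sum, sum_sq_coord]
  field_simp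

lemma lap_weighted (W : CarlemanWeight M R₀ v₀ v₁ R₁ L T k δ φ φ₁ φ₂)
    (hu : ContDiff ℝ 2 u) (hx : x ≠ 0) :
    lap (weighted k φ u) x = Real.exp (k * φ ‖x‖) * (lap u x +
      2 * k * (φ₁ ‖x‖ / ‖x‖) * eulerD u x +
      k * (φ₂ ‖x‖ + ((n : ℝ) - 1) * (φ₁ ‖x‖ / ‖x‖)) * u x + k ^ 2 * φ₁ ‖x‖ ^ 2 * u x) := by
  have hr : 0 < ‖x‖ := norm_pos_iff.2 hx
  set E := Real.exp (k * φ ‖x‖) with hE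
  set r := ‖x‖ with hr'
  have hterm : ∀ i, pd i (pd i (weighted k φ u)) x =
      E * pd i (pd i u) x + E * k * (φ₁ r / r) * 2 * (x i * pd i u x) +
      E * k * u x * (φ₂ r / r ^ 2 - φ₁ r / r ^ 3 + k * (φ₁ r / r) ^ 2) * x i ^ 2 +
      E * k * (φ₁ r / r) * u x := by
    intro i
    have hev : pd i (weighted k φ u) =ᶠ[nhds x] fun y => weighted k φ (pd i u) y +
        (fun y => k * (φ₁ ‖y‖ / ‖y‖)) y * weighted k φ (fun z => z i * u z) y := by
      filter_upwards [isOpen_compl_singleton.mem_nhds hx] with y hy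
      rw [pd_weighted W (hu.differentiable (by simp) y) hy]
      simp only [weighted]; ring
    have hpu : DifferentiableAt ℝ (pd i u) x := (hu.pd (m := 1) (by norm_num) i).differentiable (by simp) x
    have hui : DifferentiableAt ℝ u x := hu.differentiable (by simp) x
    have hci := differentiableAt_coord i x
    have hE' : HasDerivAt (fun r => Real.exp (k * φ r)) (E * (k * φ₁ r)) r :=
      ((W.hasDerivAt r).const_mul k).exp
    have hEd : DifferentiableAt ℝ (fun y : Eucl n => Real.exp (k * φ ‖y‖)) x :=
      DifferentiableAt.comp (g := fun r => Real.exp (k * φ r)) x hE'.differentiableAt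
        (differentiableAt_norm' hx)
    have hA : HasDerivAt (fun r => k * (φ₁ r / r)) (k * ((φ₂ r * r - φ₁ r * 1) / r ^ 2)) r :=
      ((W.hasDerivAt₁ r hr).div (hasDerivAt_id r) hr.ne').const_mul k
    have hAd : DifferentiableAt ℝ (fun y : Eucl n => k * (φ₁ ‖y‖ / ‖y‖)) x :=
      DifferentiableAt.comp (g := fun r => k * (φ₁ r / r)) x hA.differentiableAt
        (differentiableAt_norm' hx)
    have hd1 : DifferentiableAt ℝ (weighted k φ (pd i u)) x := hEd.fun_mul hpu
    have hd2 : DifferentiableAt ℝ (weighted k φ fun z : Eucl n => z i * u z) x :=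
      hEd.fun_mul (hci.fun_mul hui)
    rw [pd_congr hev, pd_add hd1 (hAd.fun_mul hd2), pd_mul hAd hd2,
      pd_weighted W hpu hx, pd_weighted W (hci.fun_mul hui) hx, pd_mul hci hui, pd_coord,
      pd_comp hA (differentiableAt_norm' hx), pd_norm hx]
    simp only [weighted, if_true, ← hr', ← hE]
    field_simp
    ring
  rw [lap]
  simp_rw [hterm]
  simp only [Finset.sum_add_distrib, ← Finset.mul_sum, Finset.sum_const,
    Finset.card_univ, Fintype.card_fin, nsmul_eq_mul]
  have s1 : ∑ i, x i * pd i u x = eulerD u x := rfl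
  have s2 : ∑ i, pd i (pd i u) x = lap u x := rfl
  rw [s1, s2, sum_sq_coord, ← hr']
  field_simp
  ring

lemma eulerD_sq_le (v : Eucl n → ℝ) (x : Eucl n) : eulerD v x ^ 2 ≤ ‖x‖ ^ 2 * gradSq v x := by
  rw [← sum_sq_coord]
  exact Finset.sum_mul_sq_le_sq_mul_sq _ _ _

/-- The modified radial derivative `x · ∇ v + (n - 1) / 2 v`. -/
def radN (v : Eucl n → ℝ) (x : Eucl n) : ℝ := eulerD v x + ((n : ℝ) - 1) / 2 * v x

/-- Pointwise lower bound for the divergence of the energy field of the conjugated function. -/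
theorem le_sum_pd_energyField (hn : 3 ≤ n) (hL : 0 < L)
    (W : CarlemanWeight M R₀ v₀ v₁ R₁ L T k δ φ φ₁ φ₂)
    (hu : ContDiff ℝ 2 u) (hx : x ≠ 0) {d V Vk : ℝ}
    (hd : -((M (‖x‖ + δ) - M ‖x‖) / δ) ≤ d)
    (he : |V - Vk| ≤ δ * (d + 2 * ((M (‖x‖ + δ) - M ‖x‖) / δ))) (he' : |V - Vk| ≤ v₁)
    (hVk : v₀ ≤ Vk) (hout : R₀ ≤ ‖x‖ → d = 0 ∧ V - Vk = 0) :
    L ^ 2 * gw L x ^ 3 * (eulerD (weighted k φ u) x ^ 2 / ‖x‖ ^ 2 +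
          k ^ 2 / 4 * v₀ * weighted k φ u x ^ 2) -
        2 * gw L x * Real.exp (k * φ ‖x‖) * |lap u x + k ^ 2 * V * u x| *
          |radN (weighted k φ u) x| -
        k ^ 2 * (Vk * (2 * gw L x * weighted k φ u x * radN (weighted k φ u) x +
          L ^ 2 * gw L x ^ 3 * weighted k φ u x ^ 2) +
          d * (‖x‖ * gw L x * weighted k φ u x ^ 2)) ≤
      ∑ i, pd i (energyField L (fun y => k ^ 2 * (gw L y * φ₁ ‖y‖ ^ 2)) (weighted k φ u) i) x := by
  have hr : 0 < ‖x‖ := norm_pos_iff.2 hx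
  have hv := contDiffAt_weighted W hu.contDiffAt hx
  have hgd : DifferentiableAt ℝ (gw L) x := (contDiff_gw hL).differentiable (by simp) x
  have hψ : HasDerivAt (fun r => φ₁ r ^ 2) (2 * φ₁ ‖x‖ * φ₂ ‖x‖) ‖x‖ := by
    simpa using (W.hasDerivAt₁ ‖x‖ hr).fun_pow 2
  have hψd : DifferentiableAt ℝ (fun y : Eucl n => φ₁ ‖y‖ ^ 2) x :=
    hψ.differentiableAt.comp x (differentiableAt_norm' hx)
  -- The coefficient `q = k² g φ'²` is chosen so that the divergence of `q v² x` cancels the product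
  -- of `-k² φ'² v` with the multiplier `2gN`. What remains is `k²(L² g³ φ'² + 2 g r φ' φ'') v²`.
  have hq : DifferentiableAt ℝ (fun y : Eucl n => k ^ 2 * (gw L y * φ₁ ‖y‖ ^ 2)) x :=
    (hgd.fun_mul hψd).const_mul _
  have hqs : ∑ i, x i * pd i (fun y : Eucl n => k ^ 2 * (gw L y * φ₁ ‖y‖ ^ 2)) x =
      k ^ 2 * (-(gw L x ^ 3 * ‖x‖ ^ 2 * φ₁ ‖x‖ ^ 2) + gw L x * ‖x‖ * (2 * φ₁ ‖x‖ * φ₂ ‖x‖)) := by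
    have : ∀ i, x i * pd i (fun y : Eucl n => k ^ 2 * (gw L y * φ₁ ‖y‖ ^ 2)) x =
        k ^ 2 * (-(gw L x ^ 3 * φ₁ ‖x‖ ^ 2) + gw L x / ‖x‖ * (2 * φ₁ ‖x‖ * φ₂ ‖x‖)) * x i ^ 2 := by
      intro i
      rw [pd_const_mul (hgd.fun_mul hψd), pd_mul hgd hψd, pd_comp hψ (differentiableAt_norm' hx),
        pd_norm hx, pd_gw hL]
      field_simp
      ring
    simp_rw [this]
    rw [← Finset.mul_sum, sum_sq_coord]
    field_simp
  rw [sum_pd_energyField hL hv hq, hqs]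
  -- Expressed through `N = x·∇v + (n-1)/2 v`, the first order term of the conjugated Laplacian and
  -- its companion `(n - 1)φ'/r` merge into `2k(φ'/r)N`. Times `2gN` this gives the positive term in
  -- `N²`.
  have hlap : lap (weighted k φ u) x = Real.exp (k * φ ‖x‖) * (lap u x + k ^ 2 * V * u x) -
      k ^ 2 * V * weighted k φ u x + 2 * k * (φ₁ ‖x‖ / ‖x‖) * radN (weighted k φ u) x +
      k * φ₂ ‖x‖ * weighted k φ u x - k ^ 2 * φ₁ ‖x‖ ^ 2 * weighted k φ u x := by
    rw [lap_weighted W hu hx, radN, eulerD_weighted W (hu.differentiable (by simp) x) hx, weighted]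
    field_simp
    ring
  have hquad := W.quad ‖x‖ d (V - Vk) Vk (weighted k φ u x) (radN (weighted k φ u) x / ‖x‖) hr hd he
    he' hVk hout
  have hgpos := gw_pos hL x
  have hg2 : L ^ 2 / (L ^ 2 + ‖x‖ ^ 2) = L ^ 2 * gw L x ^ 2 := by
    rw [gw_sq, div_eq_mul_inv]
  rw [hg2] at hquad
  have hCS := eulerD_sq_le (weighted k φ u) x
  have hDN : eulerD (weighted k φ u) x =
    radN (weighted k φ u) x - ((n : ℝ) - 1) / 2 * weighted k φ u x := by rw [radN]; ring
  have hNdef : eulerD (weighted k φ u) x + ((n : ℝ) - 1) / 2 * weighted k φ u x =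
    radN (weighted k φ u) x := rfl
  rw [hNdef, hlap]
  have hgL := gw_sq_mul hL x
  have hE : 0 < Real.exp (k * φ ‖x‖) := Real.exp_pos _
  set v := weighted k φ u x
  set D := eulerD (weighted k φ u) x
  set N := radN (weighted k φ u) x
  set G := gradSq (weighted k φ u) x
  set g := gw L x
  set r := ‖x‖
  set E := Real.exp (k * φ r)
  set s := lap u x + k ^ 2 * V * u x
  have hn' : (3 : ℝ) ≤ n := by exact_mod_cast hn
  clear_value v D N G g r E s
  -- the source term
  have hsrc : 0 ≤ 2 * g * E * (s * N + |s| * |N|) := by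
    have : -(|s| * |N|) ≤ s * N := by
      rw [← abs_mul]; exact neg_abs_le _
    have : 0 ≤ s * N + |s| * |N| := by linarith
    positivity
  -- positivity of the gradient terms
  have hgrad : L ^ 2 * g ^ 3 * (D ^ 2 / r ^ 2) ≤ (g + g ^ 3 * r ^ 2) * G - 2 * g ^ 3 * D ^ 2 := by
    have h1 : D ^ 2 / r ^ 2 ≤ G := by rw [div_le_iff₀ (by positivity)]; linarith
    have h2 : (g + g ^ 3 * r ^ 2) * (D ^ 2 / r ^ 2) ≤ (g + g ^ 3 * r ^ 2) * G := by gcongr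
    have h3 : (g + g ^ 3 * r ^ 2) * (D ^ 2 / r ^ 2) - 2 * g ^ 3 * D ^ 2 =
        L ^ 2 * g ^ 3 * (D ^ 2 / r ^ 2) := by
      have e2 : g = g ^ 3 * (L ^ 2 + r ^ 2) := by
        calc g = g * (g ^ 2 * (L ^ 2 + r ^ 2)) := by rw [hgL, mul_one]
          _ = _ := by ring
      have e1 : D ^ 2 = D ^ 2 / r ^ 2 * r ^ 2 := by field_simp
      set y := D ^ 2 / r ^ 2
      rw [e1]
      linear_combination y * e2
    linarith
  have hpot : 0 ≤ ((n : ℝ) - 1) / 2 * (n * L ^ 2 + (n - 3) * r ^ 2) * g ^ 5 * v ^ 2 := by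
    have : 0 ≤ (n : ℝ) - 1 := by linarith
    have : 0 ≤ (n : ℝ) - 3 := by linarith
    positivity
  have hq2 := mul_le_mul_of_nonneg_left hquad hgpos.le
  have hq3 : g * (k ^ 2 * (L ^ 2 * g ^ 2 * (Vk + φ₁ r ^ 2) + r * (d + 2 * φ₁ r * φ₂ r)) * v ^ 2 +
        4 * k * r * φ₁ r * (N / r) ^ 2 - 2 * k ^ 2 * r * (V - Vk) * v * (N / r) +
        2 * k * r * φ₂ r * v * (N / r)) =
      k ^ 2 * (L ^ 2 * g ^ 3 * (Vk + φ₁ r ^ 2) + g * r * (d + 2 * φ₁ r * φ₂ r)) * v ^ 2 +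
        4 * k * g * (φ₁ r / r) * N ^ 2 - 2 * k ^ 2 * g * (V - Vk) * v * N +
        2 * k * g * φ₂ r * v * N := by
    field_simp
  rw [hq3] at hq2
  have e2 : g = g ^ 3 * (L ^ 2 + r ^ 2) := by
    calc g = g * (g ^ 2 * (L ^ 2 + r ^ 2)) := by rw [hgL, mul_one]
      _ = _ := by ring
  have e3 : g * (k ^ 2 * φ₁ r ^ 2 * v ^ 2) = g ^ 3 * (L ^ 2 + r ^ 2) * (k ^ 2 * φ₁ r ^ 2 * v ^ 2) := by
    rw [← e2]
  rw [hDN] at *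
  linarith

end Conjugation

/-! ### Polar coordinates and integration by parts against radial means -/

section Polar

variable {n : ℕ}

/-- Integration in polar coordinates on `ℝⁿ`. -/
theorem integral_polar [NeZero n] {F : Eucl n → ℝ} (hF : Integrable F) :
    ∫ x, F x = ∫ θ, (∫ r in Ioi (0 : ℝ), r ^ (n - 1) * F (r • (θ : Eucl n)))
      ∂(volume : Measure (Eucl n)).toSphere := by
  have hdim : Module.finrank ℝ (Eucl n) = n := by simp
  set e := homeomorphUnitSphereProd (Eucl n) with he
  have hmp := (volume : Measure (Eucl n)).measurePreserving_homeomorphUnitSphereProd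
  rw [hdim] at hmp
  have hsymm : ∀ p : (Metric.sphere (0 : Eucl n) 1) × Ioi (0 : ℝ),
      ((e.symm p : ({0}ᶜ : Set (Eucl n))) : Eucl n) = p.2.1 • (p.1 : Eucl n) := fun p => rfl
  set G : (Metric.sphere (0 : Eucl n) 1) × Ioi (0 : ℝ) → ℝ := fun p => F (p.2.1 • (p.1 : Eucl n))
  have hGe : ∀ x : ({0}ᶜ : Set (Eucl n)), G (e x) = F x := by
    intro x
    have := hsymm (e x)
    rw [Homeomorph.symm_apply_apply] at this
    simp only [G]
    rw [← this]
  have hint : Integrable G ((volume : Measure (Eucl n)).toSphere.prod (.volumeIoiPow (n - 1))) := by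
    rw [← hmp.integrable_comp_emb (Homeomorph.measurableEmbedding _)]
    have h1 : IntegrableOn F ({0}ᶜ : Set (Eucl n)) := hF.integrableOn
    rw [integrableOn_iff_comap_subtypeVal (by measurability)] at h1
    exact h1.congr (Filter.Eventually.of_forall fun x => (hGe x).symm)
  have h0 : ∫ x, F x = ∫ p, G p ∂((volume : Measure (Eucl n)).toSphere.prod (.volumeIoiPow (n - 1))) := by
    rw [← hmp.integral_comp (Homeomorph.measurableEmbedding _)]
    have h1 : ∫ x, F x = ∫ x in ({0}ᶜ : Set (Eucl n)), F x := by
      rw [MeasureTheory.restrict_compl_singleton]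
    rw [h1, ← integral_subtype_comap (measurableSet_singleton _).compl]
    exact integral_congr_ae (Filter.Eventually.of_forall fun x => (hGe x).symm)
  rw [h0, integral_prod _ hint]
  refine integral_congr_ae (Filter.Eventually.of_forall fun θ => ?_)
  simp only [Measure.volumeIoiPow, ENNReal.ofReal, G]
  rw [integral_withDensity_eq_integral_smul,
    integral_subtype_comap measurableSet_Ioi
      (fun a => Real.toNNReal (a ^ (n - 1)) • F (a • (θ : Eucl n)))]
  · refine setIntegral_congr_fun measurableSet_Ioi fun r hr => ?_
    rw [NNReal.smul_def, Real.coe_toNNReal _ (pow_nonneg (le_of_lt hr) _), smul_eq_mul]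
  · exact (measurable_subtype_coe.pow_const _).real_toNNReal

/-- Integration by parts against a forward mean of a bounded function of one variable. -/
lemma integral_forwardMean_mul_deriv {V H H' : ℝ → ℝ} {C δ : ℝ} (hV : Measurable V)
    (hVC : ∀ r, |V r| ≤ C) (hδ : 0 < δ) (hH : Continuous H) (hHi : Integrable H)
    (hH' : Integrable H') (hd : ∀ r, r ≠ 0 → HasDerivAt H (H' r) r) :
    ∫ r, ((δ⁻¹ * ∫ s in (0 : ℝ)..δ, V (r + s)) * H' r + (V (r + δ) - V r) / δ * H r) = 0 := by
  have hVt : ∀ s, Measurable fun r => V (r + s) := fun s => hV.comp (measurable_id.add_const s)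
  have hb : ∀ (F : ℝ → ℝ) (s : ℝ), Integrable F → Integrable fun r => V (r + s) * F r :=
    fun F s hF => hF.bdd_mul (c := C) (hVt s).aestronglyMeasurable
      (Filter.Eventually.of_forall fun r => hVC _)
  have hprod : Integrable (fun p : ℝ × ℝ => V (p.1 + p.2) * H' p.1)
      (volume.prod (volume.restrict (Ioc 0 δ))) := by
    have h1 : Integrable (fun p : ℝ × ℝ => H' p.1) (volume.prod (volume.restrict (Ioc 0 δ))) := by
      simpa using hH'.mul_prod (ν := volume.restrict (Ioc 0 δ)) (integrable_const (1 : ℝ))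
    exact h1.bdd_mul (c := C) (hV.comp (measurable_fst.add measurable_snd)).aestronglyMeasurable
      (Filter.Eventually.of_forall fun r => hVC _)
  -- Integrability after the shear `(r, s) ↦ (r - s, s)`, which preserves the measure.
  have hprod2 : Integrable (fun p : ℝ × ℝ => V p.1 * H' (p.1 - p.2))
      (volume.prod (volume.restrict (Ioc 0 δ))) := by
    have hle : (volume : Measure ℝ).prod (volume.restrict (Ioc 0 δ)) ≤ volume.prod volume :=
      Measure.prod_mono le_rfl Measure.restrict_le_self
    have hmp : MeasurePreserving (fun p : ℝ × ℝ => (p.1 - p.2, p.2))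
        ((volume : Measure ℝ).prod (volume.restrict (Ioc 0 δ)))
        (volume.prod (volume.restrict (Ioc 0 δ))) := by
      have := MeasurePreserving.skew_product (μa := (volume : Measure ℝ).restrict (Ioc 0 δ))
        (μc := (volume : Measure ℝ)) (μd := (volume : Measure ℝ))
        (f := id) (MeasurePreserving.id _) (g := fun a b => b - a)
        (measurable_snd.sub measurable_fst)
        (Filter.Eventually.of_forall fun a => (measurePreserving_sub_right volume a).map_eq)
      exact (Measure.measurePreserving_swap.comp this).comp Measure.measurePreserving_swap
    have h1 : Integrable (fun p : ℝ × ℝ => H' (p.1 - p.2)) (volume.prod (volume.restrict (Ioc 0 δ))) := by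
      have h2 : Integrable (fun p : ℝ × ℝ => H' p.1) (volume.prod (volume.restrict (Ioc 0 δ))) := by
        simpa using hH'.mul_prod (ν := volume.restrict (Ioc 0 δ)) (integrable_const (1 : ℝ))
      exact hmp.integrable_comp_of_integrable h2
    exact h1.bdd_mul (c := C) (hV.comp measurable_fst).aestronglyMeasurable
      (Filter.Eventually.of_forall fun r => hVC _)
  -- Fubini and a translation move the averaging onto `H'`, where it integrates to `H(r) - H(r -
  -- δ)`. No regularity of `V` beyond measurability and boundedness is needed.
  have e1 : ∫ r, (∫ s in (0 : ℝ)..δ, V (r + s)) * H' r = ∫ r, V r * (H r - H (r - δ)) := by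
    calc ∫ r, (∫ s in (0 : ℝ)..δ, V (r + s)) * H' r
        = ∫ r, ∫ s in Ioc 0 δ, V (r + s) * H' r := by
          refine integral_congr_ae (Filter.Eventually.of_forall fun r => ?_)
          simp only
          rw [intervalIntegral.integral_of_le hδ.le, integral_mul_const]
      _ = ∫ s in Ioc 0 δ, ∫ r, V (r + s) * H' r := integral_integral_swap hprod
      _ = ∫ s in Ioc 0 δ, ∫ r, V r * H' (r - s) := by
          refine integral_congr_ae (Filter.Eventually.of_forall fun s => ?_)
          simp only
          rw [← integral_sub_right_eq_self (fun r => V (r + s) * H' r) s]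
          simp
      _ = ∫ r, ∫ s in Ioc 0 δ, V r * H' (r - s) := (integral_integral_swap hprod2).symm
      _ = ∫ r, V r * (H r - H (r - δ)) := by
          refine integral_congr_ae (Filter.Eventually.of_forall fun r => ?_)
          simp only
          rw [integral_const_mul, ← intervalIntegral.integral_of_le hδ.le,
            intervalIntegral.integral_comp_sub_left (fun s => H' s) r, sub_zero]
          congr 1
          exact integral_eq_of_hasDerivAt_off_countable H H' (countable_singleton (0 : ℝ))
            hH.continuousOn (fun x hx => hd x hx.2) hH'.intervalIntegrable
  have hsh : Integrable fun r => V r * H (r - δ) := by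
    have := (hb H δ hHi).comp_sub_right δ
    simpa using this
  have e2 : ∫ r, V r * H (r - δ) = ∫ r, V (r + δ) * H r := by
    rw [← integral_add_right_eq_self (fun r => V r * H (r - δ)) δ]
    simp
  have i0 : Integrable fun r => V r * H r := by simpa using hb H 0 hHi
  have i1 : Integrable fun r => (∫ s in (0 : ℝ)..δ, V (r + s)) * H' r := by
    have := hprod.integral_prod_left
    refine this.congr (Filter.Eventually.of_forall fun r => ?_)
    simp only
    rw [intervalIntegral.integral_of_le hδ.le, integral_mul_const]
  have hall : ∀ r, (δ⁻¹ * ∫ s in (0 : ℝ)..δ, V (r + s)) * H' r + (V (r + δ) - V r) / δ * H r =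
      δ⁻¹ * ((∫ s in (0 : ℝ)..δ, V (r + s)) * H' r + (V (r + δ) * H r - V r * H r)) := by
    intro r; field_simp
  simp_rw [hall]
  have i2 : Integrable fun r => V (r + δ) * H r - V r * H r := (hb H δ hHi).sub i0
  rw [integral_const_mul, integral_add i1 i2, integral_sub (hb H δ hHi) i0, e1]
  have e3 : ∫ r, V r * (H r - H (r - δ)) = (∫ r, V r * H r) - ∫ r, V r * H (r - δ) := by
    rw [← integral_sub i0 hsh]
    congr 1; funext r; ring
  rw [e3, e2]
  ring

/-- The mean of `V` over a radial segment of length `δ` starting at `x`. -/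
def radialMean (V : Eucl n → ℝ) (δ : ℝ) (x : Eucl n) : ℝ :=
  δ⁻¹ * ∫ s in (0 : ℝ)..δ, V ((1 + s / ‖x‖) • x)

/-- The radial difference quotient of `V` with step `δ`. -/
def radialSlope (V : Eucl n → ℝ) (δ : ℝ) (x : Eucl n) : ℝ :=
  (V ((1 + δ / ‖x‖) • x) - V x) / δ

lemma measurable_radialMean {V : Eucl n → ℝ} (hV : Measurable V) {δ : ℝ} (hδ : 0 < δ) :
    Measurable (radialMean V δ) := by
  have h : StronglyMeasurable (Function.uncurry fun (x : Eucl n) (s : ℝ) => V ((1 + s / ‖x‖) • x)) := by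
    apply Measurable.stronglyMeasurable
    apply hV.comp
    fun_prop
  have := h.integral_prod_right (ν := volume.restrict (Ioc 0 δ))
  unfold radialMean
  simp_rw [intervalIntegral.integral_of_le hδ.le]
  exact this.measurable.const_mul _

lemma measurable_radialSlope {V : Eucl n → ℝ} (hV : Measurable V) (δ : ℝ) :
    Measurable (radialSlope V δ) := by
  unfold radialSlope
  have : Measurable fun x : Eucl n => V ((1 + δ / ‖x‖) • x) := hV.comp (by fun_prop)
  exact (this.sub hV).div_const δ

lemma abs_radialMean_le {V : Eucl n → ℝ} {C δ : ℝ} (hVC : ∀ x, |V x| ≤ C) (hδ : 0 < δ) (x : Eucl n) :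
    |radialMean V δ x| ≤ C := by
  rw [radialMean, abs_mul, abs_of_pos (inv_pos.2 hδ), inv_mul_le_iff₀ hδ, ← Real.norm_eq_abs]
  have := intervalIntegral.norm_integral_le_of_norm_le_const (a := 0) (b := δ)
    (f := fun s => V ((1 + s / ‖x‖) • x)) (C := C) fun s _ => hVC _
  rwa [sub_zero, abs_of_pos hδ, mul_comm] at this

lemma abs_radialSlope_le {V : Eucl n → ℝ} {C δ : ℝ} (hVC : ∀ x, |V x| ≤ C) (hδ : 0 < δ)
    (x : Eucl n) : |radialSlope V δ x| ≤ 2 * C / δ := by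
  rw [radialSlope, abs_div, abs_of_pos hδ]
  have := abs_sub (V ((1 + δ / ‖x‖) • x)) (V x)
  have := hVC ((1 + δ / ‖x‖) • x)
  have := hVC x
  gcongr
  linarith

lemma integrable_of_bounded_of_support {f : Eucl n → ℝ} {C ρ : ℝ} (hf : AEStronglyMeasurable f)
    (hC : ∀ x, |f x| ≤ C) (hρ : ∀ x, ρ < ‖x‖ → f x = 0) : Integrable f := by
  have h1 : IntegrableOn f (Metric.closedBall 0 ρ) := by
    refine Measure.integrableOn_of_bounded (M := C) measure_closedBall_lt_top.ne hf
      (Filter.Eventually.of_forall hC)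
  refine (integrableOn_iff_integrable_of_support_subset fun x hx => ?_).1 h1
  by_contra h
  exact hx (hρ x (by simpa using h))

/-- Integration by parts against the radial mean of a bounded function: `P` plays the role of
`∂_r f + (n - 1) / r f`. -/
theorem integral_radialMean_mul (hn : 2 ≤ n) {V f P : Eucl n → ℝ} {C δ ρ C' : ℝ} (hV : Measurable V)
    (hVC : ∀ x, |V x| ≤ C) (hδ : 0 < δ) (hf : Measurable f) (hP : Measurable P)
    (hfC : ∀ x, |f x| ≤ C') (hPC : ∀ x, |P x| ≤ C') (hfρ : ∀ x, ρ < ‖x‖ → f x = 0)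
    (hPρ : ∀ x, ρ < ‖x‖ → P x = 0)
    (hd : ∀ θ : Eucl n, ‖θ‖ = 1 → ∀ r : ℝ, 0 < r →
      HasDerivAt (fun r : ℝ => r ^ (n - 1) * f (r • θ)) (r ^ (n - 1) * P (r • θ)) r) :
    ∫ x, (radialMean V δ x * P x + radialSlope V δ x * f x) = 0 := by
  have : NeZero n := ⟨by omega⟩
  have hC' : 0 ≤ C' := (abs_nonneg _).trans (hfC 0)
  have hint : Integrable fun x => radialMean V δ x * P x + radialSlope V δ x * f x := by
    refine Integrable.add ?_ ?_
    · exact (integrable_of_bounded_of_support hP.aestronglyMeasurable hPC hPρ).bdd_mul (c := C)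
        (measurable_radialMean hV hδ).aestronglyMeasurable
        (Filter.Eventually.of_forall fun x => abs_radialMean_le hVC hδ x)
    · exact (integrable_of_bounded_of_support hf.aestronglyMeasurable hfC hfρ).bdd_mul (c := 2 * C / δ)
        (measurable_radialSlope hV δ).aestronglyMeasurable
        (Filter.Eventually.of_forall fun x => abs_radialSlope_le hVC hδ x)
  rw [integral_polar hint]
  refine integral_eq_zero_of_ae (Filter.Eventually.of_forall fun θ => ?_)
  have hθ : ‖(θ : Eucl n)‖ = 1 := by simp
  have hnr : ∀ r : ℝ, 0 < r → ‖r • (θ : Eucl n)‖ = r := fun r hr => by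
    rw [norm_smul, hθ, mul_one, Real.norm_of_nonneg hr.le]
  -- Extending by zero to negative radii gives a function on the line. It is continuous at `0`
  -- because of the factor `r^(n-1)` with `n ≥ 2`, so no boundary term appears.
  set H : ℝ → ℝ := (Ioi 0).indicator fun r => r ^ (n - 1) * f (r • (θ : Eucl n)) with hH
  set H' : ℝ → ℝ := (Ioi 0).indicator fun r => r ^ (n - 1) * P (r • (θ : Eucl n)) with hH'
  have hsm : Measurable fun r : ℝ => r • (θ : Eucl n) := by fun_prop
  have hdH : ∀ r, r ≠ 0 → HasDerivAt H (H' r) r := by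
    intro r hr
    rcases lt_or_gt_of_ne hr with h | h
    · have e : H =ᶠ[nhds r] fun _ => 0 := by
        filter_upwards [Iio_mem_nhds h] with s hs
        simp only [hH]
        exact indicator_of_notMem (by simpa using le_of_lt hs) _
      have e' : H' r = 0 := indicator_of_notMem (by simpa using h.le) _
      rw [e']
      exact (hasDerivAt_const r (0 : ℝ)).congr_of_eventuallyEq e
    · have e : H =ᶠ[nhds r] fun r => r ^ (n - 1) * f (r • (θ : Eucl n)) := by
        filter_upwards [Ioi_mem_nhds h] with s hs
        exact indicator_of_mem hs _
      have e' : H' r = r ^ (n - 1) * P (r • (θ : Eucl n)) := indicator_of_mem (by simpa using h) _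
      rw [e']
      exact (hd θ hθ r h).congr_of_eventuallyEq e
  have hbd : ∀ (F : Eucl n → ℝ), (∀ x, |F x| ≤ C') → ∀ r : ℝ,
      |(Ioi (0 : ℝ)).indicator (fun r => r ^ (n - 1) * F (r • (θ : Eucl n))) r| ≤ C' * |r| ^ (n - 1) := by
    intro F hF r
    by_cases h : 0 < r
    · rw [indicator_of_mem (by simpa using h), abs_mul, abs_pow, mul_comm]
      gcongr
      exact hF _
    · rw [indicator_of_notMem (by simpa using h)]
      simp only [abs_zero]; positivity
  have hcont : Continuous H := by
    rw [continuous_iff_continuousAt]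
    intro r
    by_cases hr : r = 0
    · subst hr
      have h0 : H 0 = 0 := indicator_of_notMem (by simp) _
      rw [ContinuousAt, h0]
      refine squeeze_zero_norm (a := fun r => C' * |r| ^ (n - 1)) (fun r => hbd f hfC r) ?_
      have : Continuous fun r : ℝ => C' * |r| ^ (n - 1) := by fun_prop
      have h2 := this.tendsto 0
      simpa [zero_pow (by omega : n - 1 ≠ 0)] using h2
    · exact (hdH r hr).continuousAt
  have hi : ∀ (F : Eucl n → ℝ), Measurable F → (∀ x, |F x| ≤ C') → (∀ x, ρ < ‖x‖ → F x = 0) →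
      Integrable ((Ioi (0 : ℝ)).indicator fun r => r ^ (n - 1) * F (r • (θ : Eucl n))) := by
    intro F hFm hF hFρ
    have hm : Measurable ((Ioi (0 : ℝ)).indicator fun r => r ^ (n - 1) * F (r • (θ : Eucl n))) :=
      Measurable.indicator (by exact (measurable_id.pow_const _).mul (hFm.comp hsm)) measurableSet_Ioi
    have hz : ∀ r, r ∉ Icc 0 ρ →
        (Ioi (0 : ℝ)).indicator (fun r => r ^ (n - 1) * F (r • (θ : Eucl n))) r = 0 := by
      intro r hr
      by_cases h : 0 < r
      · rw [indicator_of_mem (by simpa using h), hFρ, mul_zero]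
        rw [hnr r h]
        by_contra h'
        exact hr ⟨h.le, not_lt.1 h'⟩
      · exact indicator_of_notMem (by simpa using h) _
    refine (integrableOn_iff_integrable_of_support_subset (s := Icc 0 ρ) fun r hr => ?_).1
      (Measure.integrableOn_of_bounded (M := C' * ρ ^ (n - 1)) measure_Icc_lt_top.ne
        hm.aestronglyMeasurable ?_)
    · by_contra h; exact hr (hz r h)
    · refine (ae_restrict_mem measurableSet_Icc).mono fun r hr => (hbd F hF r).trans ?_
      rw [abs_of_nonneg hr.1]
      have := hr.1
      have := hr.2
      gcongr
  have key := integral_forwardMean_mul_deriv (V := fun r => V (r • (θ : Eucl n))) (hV.comp hsm)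
    (fun r => hVC _) hδ hcont (hi f hf hfC hfρ) (hi P hP hPC hPρ) hdH
  refine Eq.trans ?_ key
  simp only
  rw [← integral_indicator measurableSet_Ioi]
  refine integral_congr_ae (Filter.Eventually.of_forall fun r => ?_)
  by_cases h : 0 < r
  · have hmem : r ∈ Ioi (0 : ℝ) := h
    have hsc : ∀ s : ℝ, (1 + s / ‖r • (θ : Eucl n)‖) • r • (θ : Eucl n) = (r + s) • (θ : Eucl n) := by
      intro s
      rw [hnr r h, smul_smul]
      congr 1
      field_simp
    simp only [hH, indicator_of_mem hmem, radialMean, radialSlope, hsc]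
    ring
  · have hmem : r ∉ Ioi (0 : ℝ) := h
    simp only [hH, indicator_of_notMem hmem, mul_zero, add_zero]

end Polar

/-! ### Locally bounded functions and potentials with controlled decrease -/

section Carleman

variable {n : ℕ} {f g : Eucl n → ℝ}

/-- Measurable and bounded on every ball. -/
def LocBdd (f : Eucl n → ℝ) : Prop :=
  Measurable f ∧ ∀ ρ : ℝ, ∃ C, ∀ x, ‖x‖ ≤ ρ → |f x| ≤ C

lemma LocBdd.add (hf : LocBdd f) (hg : LocBdd g) : LocBdd fun x => f x + g x := by
  refine ⟨hf.1.add hg.1, fun ρ => ?_⟩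
  obtain ⟨A, hA⟩ := hf.2 ρ
  obtain ⟨B, hB⟩ := hg.2 ρ
  exact ⟨A + B, fun x hx => (abs_add_le _ _).trans (add_le_add (hA x hx) (hB x hx))⟩

lemma LocBdd.mul (hf : LocBdd f) (hg : LocBdd g) : LocBdd fun x => f x * g x := by
  refine ⟨hf.1.mul hg.1, fun ρ => ?_⟩
  obtain ⟨A, hA⟩ := hf.2 ρ
  obtain ⟨B, hB⟩ := hg.2 ρ
  refine ⟨A * B, fun x hx => ?_⟩
  rw [abs_mul]
  exact mul_le_mul (hA x hx) (hB x hx) (abs_nonneg _) ((abs_nonneg _).trans (hA x hx))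

lemma LocBdd.of_continuous (hf : Continuous f) : LocBdd f := by
  refine ⟨hf.measurable, fun ρ => ?_⟩
  obtain ⟨C, hC⟩ := (isCompact_closedBall (0 : Eucl n) ρ).exists_bound_of_continuousOn
    hf.continuousOn
  exact ⟨C, fun x hx => by simpa using hC x (by simpa using hx)⟩

lemma LocBdd.of_abs_le (hg : LocBdd g) (hf : Measurable f) (h : ∀ x, |f x| ≤ |g x|) : LocBdd f := by
  refine ⟨hf, fun ρ => ?_⟩
  obtain ⟨C, hC⟩ := hg.2 ρ
  exact ⟨C, fun x hx => (h x).trans (hC x hx)⟩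

lemma LocBdd.const (a : ℝ) : LocBdd fun _ : Eucl n => a := .of_continuous continuous_const

lemma LocBdd.neg (hf : LocBdd f) : LocBdd fun x => -f x :=
  hf.of_abs_le hf.1.neg fun x => by simp

lemma LocBdd.sub (hf : LocBdd f) (hg : LocBdd g) : LocBdd fun x => f x - g x := by
  simpa [sub_eq_add_neg] using hf.add hg.neg

lemma LocBdd.abs (hf : LocBdd f) : LocBdd fun x => |f x| :=
  hf.of_abs_le hf.1.abs fun x => by simp

lemma LocBdd.pow (hf : LocBdd f) (m : ℕ) : LocBdd fun x => f x ^ m := by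
  induction m with
  | zero => simpa using LocBdd.const 1
  | succ m ih => simpa [pow_succ] using ih.mul hf

lemma LocBdd.sum {ι : Type*} {s : Finset ι} {f : ι → Eucl n → ℝ} (hf : ∀ a, LocBdd (f a)) :
    LocBdd fun x => ∑ a ∈ s, f a x := by
  classical
  induction s using Finset.induction_on with
  | empty => simpa using LocBdd.const 0
  | insert a s ha ih => simpa [Finset.sum_insert ha] using (hf a).add ih

lemma LocBdd.of_bounded {C : ℝ} (hf : Measurable f) (h : ∀ x, |f x| ≤ C) : LocBdd f :=
  ⟨hf, fun _ => ⟨C, fun x _ => h x⟩⟩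

lemma LocBdd.exists_bound {ρ : ℝ} (hf : LocBdd f) (h : ∀ x, ρ < ‖x‖ → f x = 0) :
    ∃ C, ∀ x, |f x| ≤ C := by
  obtain ⟨C, hC⟩ := hf.2 ρ
  refine ⟨max C 0, fun x => ?_⟩
  rcases le_or_gt ‖x‖ ρ with hx | hx
  · exact (hC x hx).trans (le_max_left _ _)
  · rw [h x hx, abs_zero]; exact le_max_right _ _

lemma LocBdd.integrable {ρ : ℝ} (hf : LocBdd f) (h : ∀ x, ρ < ‖x‖ → f x = 0) : Integrable f := by
  obtain ⟨C, hC⟩ := hf.exists_bound h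
  exact integrable_of_bounded_of_support hf.1.aestronglyMeasurable hC h

lemma radialMean_mem {V : Eucl n → ℝ} (hV : Measurable V) {δ a b : ℝ} (hδ : 0 < δ)
    {C : ℝ} (hC : ∀ x, |V x| ≤ C) {x : Eucl n}
    (h : ∀ s ∈ Icc 0 δ, V ((1 + s / ‖x‖) • x) ∈ Icc a b) : radialMean V δ x ∈ Icc a b := by
  have hm : Measurable fun s : ℝ => V ((1 + s / ‖x‖) • x) := hV.comp (by fun_prop)
  have hi : IntervalIntegrable (fun s : ℝ => V ((1 + s / ‖x‖) • x)) volume 0 δ := by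
    rw [intervalIntegrable_iff]
    exact Measure.integrableOn_of_bounded (M := C) (by simp) hm.aestronglyMeasurable
      (Filter.Eventually.of_forall fun s => hC _)
  have h1 := intervalIntegral.integral_mono_on hδ.le intervalIntegrable_const hi fun s hs => (h s hs).1
  have h2 := intervalIntegral.integral_mono_on hδ.le hi intervalIntegrable_const fun s hs => (h s hs).2
  simp only [intervalIntegral.integral_const, sub_zero, smul_eq_mul] at h1 h2
  rw [radialMean]
  constructor
  · rwa [le_inv_mul_iff₀ hδ]
  · rwa [inv_mul_le_iff₀ hδ]

/-- A potential bounded between `v₀` and `v₁`, constant outside a ball, and whose decrease along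
rays is controlled by the increase of `M`. -/
structure RayPotential (M : ℝ → ℝ) (R₀ v₀ v₁ : ℝ) (V : Eucl n → ℝ) : Prop where
  measurable : Measurable V
  lower : ∀ x, v₀ ≤ V x
  upper : ∀ x, V x ≤ v₁
  const : ∃ V₁, ∀ x, R₀ ≤ ‖x‖ → V x = V₁
  ray : ∀ x t, 1 ≤ t → -(M (t * ‖x‖) - M ‖x‖) ≤ V (t • x) - V x

variable {M : ℝ → ℝ} {R₀ v₀ v₁ R₁ L T k δ ρ : ℝ} {φ φ₁ φ₂ : ℝ → ℝ} {u V : Eucl n → ℝ} {x : Eucl n}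

lemma RayPotential.abs_le (hV : RayPotential M R₀ v₀ v₁ V) (hv₀ : 0 < v₀) (x : Eucl n) :
    |V x| ≤ v₁ := by
  rw [abs_of_nonneg (hv₀.le.trans (hV.lower x))]; exact hV.upper x

lemma RayPotential.radialSlope_ge (hV : RayPotential M R₀ v₀ v₁ V) (hδ : 0 < δ) (hx : x ≠ 0) :
    -((M (‖x‖ + δ) - M ‖x‖) / δ) ≤ radialSlope V δ x := by
  have hr : 0 < ‖x‖ := norm_pos_iff.2 hx
  have h := hV.ray x (1 + δ / ‖x‖) (by have : 0 ≤ δ / ‖x‖ := by positivity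
                                       linarith)
  rw [show (1 + δ / ‖x‖) * ‖x‖ = ‖x‖ + δ by field_simp] at h
  rw [radialSlope, ← neg_div]
  gcongr

/-- The one-sided control works in both directions. Going from `r` to `r + s` bounds `V` at `r + s`
from below by its value at `r`; going from `r + s` to `r + δ` bounds it from above by its value at
`r + δ`. Hence the oscillation over the segment is bounded by the net change of `V` plus that of
`M`. -/
lemma RayPotential.abs_sub_radialMean_le (hV : RayPotential M R₀ v₀ v₁ V) (hM : Monotone M)
    (hv₀ : 0 < v₀) (hδ : 0 < δ) (hx : x ≠ 0) :
    |V x - radialMean V δ x| ≤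
      δ * (radialSlope V δ x + 2 * ((M (‖x‖ + δ) - M ‖x‖) / δ)) := by
  have hr : 0 < ‖x‖ := norm_pos_iff.2 hx
  have key : radialMean V δ x ∈ Icc (V x - (M (‖x‖ + δ) - M ‖x‖))
      (V x + δ * radialSlope V δ x + (M (‖x‖ + δ) - M ‖x‖)) := by
    refine radialMean_mem hV.measurable hδ (hV.abs_le hv₀) fun s hs => ?_
    have hs0 : 0 ≤ s / ‖x‖ := div_nonneg hs.1 hr.le
    have h1 := hV.ray x (1 + s / ‖x‖) (by linarith)
    rw [show (1 + s / ‖x‖) * ‖x‖ = ‖x‖ + s by field_simp] at h1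
    have h2 := hV.ray ((1 + s / ‖x‖) • x) ((‖x‖ + δ) / (‖x‖ + s)) (by
      rw [one_le_div (by linarith [hs.1])]; linarith [hs.2])
    have hn : ‖(1 + s / ‖x‖) • x‖ = ‖x‖ + s := by
      rw [norm_smul, Real.norm_of_nonneg (by linarith)]; field_simp
    have hp : 0 < ‖x‖ + s := by linarith [hs.1]
    rw [hn, smul_smul, show (‖x‖ + δ) / (‖x‖ + s) * (‖x‖ + s) = ‖x‖ + δ by field_simp,
      show (‖x‖ + δ) / (‖x‖ + s) * (1 + s / ‖x‖) = 1 + δ / ‖x‖ by field_simp] at h2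
    have h3 : δ * radialSlope V δ x = V ((1 + δ / ‖x‖) • x) - V x := by
      rw [radialSlope]; field_simp
    have m1 : M (‖x‖ + s) ≤ M (‖x‖ + δ) := hM (by linarith [hs.2])
    have m2 : M ‖x‖ ≤ M (‖x‖ + s) := hM (by linarith [hs.1])
    rw [h3]
    constructor <;> linarith
  have hd := hV.radialSlope_ge hδ hx
  have e : δ * (radialSlope V δ x + 2 * ((M (‖x‖ + δ) - M ‖x‖) / δ)) =
      δ * radialSlope V δ x + 2 * (M (‖x‖ + δ) - M ‖x‖) := by field_simp
  have hd2 := mul_le_mul_of_nonneg_left hd hδ.le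
  rw [show δ * -((M (‖x‖ + δ) - M ‖x‖) / δ) = -(M (‖x‖ + δ) - M ‖x‖) by field_simp] at hd2
  have m0 : M ‖x‖ ≤ M (‖x‖ + δ) := hM (by linarith)
  rw [e, _root_.abs_le]
  constructor <;> linarith [key.1, key.2]

lemma RayPotential.radialMean_mem (hV : RayPotential M R₀ v₀ v₁ V) (hv₀ : 0 < v₀) (hδ : 0 < δ) :
    radialMean V δ x ∈ Icc v₀ v₁ :=
  _root_.radialMean_mem hV.measurable hδ (hV.abs_le hv₀) fun _ _ => ⟨hV.lower _, hV.upper _⟩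

lemma RayPotential.eq_zero_outside (hV : RayPotential M R₀ v₀ v₁ V) (hv₀ : 0 < v₀) (hδ : 0 < δ)
    (hx : x ≠ 0) (h : R₀ ≤ ‖x‖) : radialSlope V δ x = 0 ∧ V x - radialMean V δ x = 0 := by
  obtain ⟨V₁, h1⟩ := hV.const
  have hr : 0 < ‖x‖ := norm_pos_iff.2 hx
  have hs : ∀ s, 0 ≤ s → V ((1 + s / ‖x‖) • x) = V₁ := by
    intro s hs
    apply h1
    have : 0 ≤ s / ‖x‖ := by positivity
    rw [norm_smul, Real.norm_of_nonneg (by linarith)]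
    have : (1 + s / ‖x‖) * ‖x‖ = ‖x‖ + s := by field_simp
    linarith
  have hx1 := h1 x h
  have hm := _root_.radialMean_mem (a := V₁) (b := V₁) (x := x) hV.measurable hδ (hV.abs_le hv₀)
    fun s hs' => by rw [hs s hs'.1]; simp
  refine ⟨by rw [radialSlope, hs δ hδ.le, hx1]; simp, ?_⟩
  rw [hx1]
  linarith [hm.1, hm.2]

end Carleman

/-! ### Boundedness of the conjugated function and the weight identity on rays -/

section CarlemanIntegral

variable {n : ℕ} {M : ℝ → ℝ} {R₀ v₀ v₁ R₁ L T k δ ρ : ℝ} {φ φ₁ φ₂ : ℝ → ℝ} {u v V : Eucl n → ℝ}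
  {x : Eucl n} {i : Fin n}

lemma measurable_pd (f : Eucl n → ℝ) (i : Fin n) : Measurable (pd i f) :=
  measurable_fderiv_apply_const ℝ f _

lemma CarlemanWeight.continuous (W : CarlemanWeight M R₀ v₀ v₁ R₁ L T k δ φ φ₁ φ₂) :
    Continuous φ :=
  continuous_iff_continuousAt.2 fun r => (W.hasDerivAt r).continuousAt

lemma continuous_weighted (W : CarlemanWeight M R₀ v₀ v₁ R₁ L T k δ φ φ₁ φ₂) (hu : Continuous u) :
    Continuous (weighted k φ u) := by
  have := W.continuous
  unfold weighted
  fun_prop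

lemma locBdd_coord (i : Fin n) : LocBdd fun x : Eucl n => x i :=
  .of_continuous (contDiff_coord i).continuous

lemma locBdd_pd_weighted (W : CarlemanWeight M R₀ v₀ v₁ R₁ L T k δ φ φ₁ φ₂)
    (hu : ContDiff ℝ 2 u) (i : Fin n) : LocBdd (pd i (weighted k φ u)) := by
  have hp : Continuous (pd i u) := (hu.pd (m := 1) (by norm_num) i).continuous
  have c1 := W.continuous
  have c2 := W.continuous₁
  have c3 := hu.continuous
  -- The weight may fail to be differentiable at the origin. The last summand takes care of the
  -- value that the partial derivative has there.
  have h : LocBdd fun x : Eucl n => Real.exp (k * φ ‖x‖) * (|pd i u x| + |k * φ₁ ‖x‖ * u x|) +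
      |pd i (weighted k φ u) 0| := .of_continuous (by fun_prop)
  refine h.of_abs_le (measurable_pd _ _) fun x => ?_
  have hE : 0 < Real.exp (k * φ ‖x‖) := Real.exp_pos _
  refine le_trans ?_ (le_abs_self _)
  by_cases hx : x = 0
  · rw [hx]
    have := Real.exp_pos (k * φ ‖(0 : Eucl n)‖)
    have : 0 ≤ Real.exp (k * φ ‖(0 : Eucl n)‖) * (|pd i u 0| + |k * φ₁ ‖(0 : Eucl n)‖ * u 0|) := by
      positivity
    linarith
  · have hr : 0 < ‖x‖ := norm_pos_iff.2 hx
    have hxi : |x i / ‖x‖| ≤ 1 := by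
      rw [abs_div, abs_of_pos hr, div_le_one hr]
      simpa using PiLp.norm_apply_le x i
    rw [pd_weighted W (hu.differentiable (by simp) x) hx, abs_mul, abs_of_pos hE]
    have h2 : |pd i u x + k * (φ₁ ‖x‖ / ‖x‖) * (x i * u x)| ≤
        |pd i u x| + |k * φ₁ ‖x‖ * u x| := by
      refine (abs_add_le _ _).trans (add_le_add le_rfl ?_)
      rw [show k * (φ₁ ‖x‖ / ‖x‖) * (x i * u x) = x i / ‖x‖ * (k * φ₁ ‖x‖ * u x) by field_simp,
        abs_mul]
      exact mul_le_of_le_one_left (abs_nonneg _) hxi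
    have := mul_le_mul_of_nonneg_left h2 hE.le
    linarith [abs_nonneg (pd i (weighted k φ u) 0)]

lemma LocBdd.eulerD (h : ∀ j, LocBdd (pd j v)) : LocBdd (eulerD v) :=
  .sum fun j => (locBdd_coord j).mul (h j)

lemma LocBdd.gradSq (h : ∀ j, LocBdd (pd j v)) : LocBdd (gradSq v) :=
  .sum fun j => (h j).pow 2

lemma LocBdd.radN (hv : LocBdd v) (h : ∀ j, LocBdd (pd j v)) : LocBdd (radN v) :=
  (LocBdd.eulerD h).add ((LocBdd.const _).mul hv)

lemma LocBdd.eulerD_div (h : ∀ j, LocBdd (pd j v)) :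
    LocBdd fun x : Eucl n => _root_.eulerD v x ^ 2 / ‖x‖ ^ 2 := by
  refine (LocBdd.gradSq h).of_abs_le ?_ fun x => ?_
  · exact ((LocBdd.eulerD h).1.pow_const 2).div (measurable_norm.pow_const 2)
  · have h0 : 0 ≤ _root_.gradSq v x := Finset.sum_nonneg fun j _ => sq_nonneg _
    rw [abs_of_nonneg (by positivity), abs_of_nonneg h0]
    exact div_le_of_le_mul₀ (by positivity) h0 (by
      rw [mul_comm]; exact eulerD_sq_le v x)

lemma pd_eq_zero_of_outside (h : ∀ x, ρ < ‖x‖ → v x = 0) (hx : ρ < ‖x‖) : pd i v x = 0 := by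
  have : v =ᶠ[nhds x] fun _ => 0 := by
    filter_upwards [(continuous_norm.continuousAt (x := x)).eventually (lt_mem_nhds hx)] with y hy
    exact h y hy
  rw [pd_congr this]
  simp [pd]

lemma locBdd_gw (hL : 0 < L) : LocBdd (gw L : Eucl n → ℝ) :=
  .of_continuous (contDiff_gw hL).continuous

/-- The weight identity along a ray. -/
lemma hasDerivAt_ray (hn : 1 ≤ n) (hL : 0 < L) (hv : ∀ x, x ≠ 0 → DifferentiableAt ℝ v x)
    {θ : Eucl n} (hθ : ‖θ‖ = 1) {r : ℝ} (hr : 0 < r) :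
    HasDerivAt (fun r : ℝ => r ^ (n - 1) * (‖r • θ‖ * gw L (r • θ) * v (r • θ) ^ 2))
      (r ^ (n - 1) * (2 * gw L (r • θ) * v (r • θ) * radN v (r • θ) +
        L ^ 2 * gw L (r • θ) ^ 3 * v (r • θ) ^ 2)) r := by
  have hnr : ∀ s : ℝ, 0 < s → ‖s • θ‖ = s := fun s hs => by
    rw [norm_smul, hθ, mul_one, Real.norm_of_nonneg hs.le]
  have hrθ : r • θ ≠ 0 := by rw [← norm_pos_iff, hnr r hr]; exact hr
  have h1 : HasDerivAt (fun s : ℝ => v (s • θ)) (fderiv ℝ v (r • θ) θ) r := by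
    have h2 : HasDerivAt (fun s : ℝ => s • θ) θ r := by
      simpa using (hasDerivAt_id r).smul_const θ
    exact (hv _ hrθ).hasFDerivAt.comp_hasDerivAt r h2
  have hD : r * fderiv ℝ v (r • θ) θ = eulerD v (r • θ) := by
    rw [eulerD, ← fderiv_self_eq_sum v (r • θ) (r • θ), map_smul, smul_eq_mul]
  have hg : HasDerivAt (fun s : ℝ => (√(L ^ 2 + s ^ 2))⁻¹)
      (-((√(L ^ 2 + r ^ 2))⁻¹ ^ 3 * r)) r := by
    have h0 : 0 < L ^ 2 + r ^ 2 := by positivity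
    have h3 : HasDerivAt (fun s : ℝ => L ^ 2 + s ^ 2) (2 * r) r := by
      simpa using ((hasDerivAt_id r).fun_pow 2).const_add (L ^ 2)
    refine ((h3.sqrt h0.ne').inv (Real.sqrt_pos.2 h0).ne').congr_deriv ?_
    have := (Real.sqrt_pos.2 h0).ne'
    field_simp
  have h4 : HasDerivAt (fun s : ℝ => s ^ n * ((√(L ^ 2 + s ^ 2))⁻¹ * v (s • θ) ^ 2))
      (n * r ^ (n - 1) * ((√(L ^ 2 + r ^ 2))⁻¹ * v (r • θ) ^ 2) +
        r ^ n * (-((√(L ^ 2 + r ^ 2))⁻¹ ^ 3 * r) * v (r • θ) ^ 2 +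
          (√(L ^ 2 + r ^ 2))⁻¹ * (2 * v (r • θ) * fderiv ℝ v (r • θ) θ))) r := by
    simpa using (hasDerivAt_pow n r).fun_mul (hg.fun_mul (h1.fun_pow 2))
  have hpow : ∀ s : ℝ, s ^ n = s ^ (n - 1) * s := fun s => by
    rw [← pow_succ]; congr 1; omega
  have hev : (fun r : ℝ => r ^ (n - 1) * (‖r • θ‖ * gw L (r • θ) * v (r • θ) ^ 2)) =ᶠ[nhds r]
      fun s : ℝ => s ^ n * ((√(L ^ 2 + s ^ 2))⁻¹ * v (s • θ) ^ 2) := by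
    filter_upwards [Ioi_mem_nhds hr] with s hs
    rw [gw, hnr s hs, hpow]; ring
  refine (h4.congr_of_eventuallyEq hev).congr_deriv ?_
  have hgL := gw_sq_mul hL (r • θ)
  have hgd : (√(L ^ 2 + r ^ 2))⁻¹ = gw L (r • θ) := by rw [gw, hnr r hr]
  rw [hgd, hpow, radN, ← hD]
  rw [hnr r hr] at hgL
  generalize gw L (r • θ) = g at *
  linear_combination (-(r ^ (n - 1) * v (r • θ) ^ 2 * g)) * hgL

end CarlemanIntegral

/-! ### The integrated Carleman inequality -/

section CarlemanIntegral

variable {n : ℕ} {M : ℝ → ℝ} {R₀ v₀ v₁ R₁ L T k δ ρ : ℝ} {φ φ₁ φ₂ : ℝ → ℝ} {u v V : Eucl n → ℝ}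
  {x : Eucl n} {i : Fin n}

lemma continuous_lap (hu : ContDiff ℝ 2 u) : Continuous (lap u) := by
  unfold lap
  refine continuous_finsetSum _ fun i _ => ?_
  exact ((hu.pd (m := 1) (by norm_num) i).pd (m := 0) (by norm_num) i).continuous

lemma eulerD_eq_zero_of_outside (h : ∀ x, ρ < ‖x‖ → v x = 0) (hx : ρ < ‖x‖) : eulerD v x = 0 :=
  Finset.sum_eq_zero fun j _ => by rw [pd_eq_zero_of_outside h hx, mul_zero]

lemma radN_eq_zero_of_outside (h : ∀ x, ρ < ‖x‖ → v x = 0) (hx : ρ < ‖x‖) : radN v x = 0 := by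
  rw [radN, eulerD_eq_zero_of_outside h hx, h x hx]; ring

/-- Carleman estimate with the conjugated function. -/
theorem integral_carleman_le (hn : 3 ≤ n) (hL : 0 < L) (hM : Monotone M) (hδ : 0 < δ)
    (hv₀ : 0 < v₀) (W : CarlemanWeight M R₀ v₀ v₁ R₁ L T k δ φ φ₁ φ₂)
    (hV : RayPotential M R₀ v₀ v₁ V) (hu : ContDiff ℝ 2 u) (huρ : ∀ x, ρ < ‖x‖ → u x = 0) :
    Integrable (fun x => L ^ 2 * gw L x ^ 3 * (eulerD (weighted k φ u) x ^ 2 / ‖x‖ ^ 2 +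
      k ^ 2 / 4 * v₀ * weighted k φ u x ^ 2)) ∧
    Integrable (fun x => 2 * gw L x * Real.exp (k * φ ‖x‖) * |lap u x + k ^ 2 * V x * u x| *
      |radN (weighted k φ u) x|) ∧
    ∫ x, L ^ 2 * gw L x ^ 3 * (eulerD (weighted k φ u) x ^ 2 / ‖x‖ ^ 2 +
      k ^ 2 / 4 * v₀ * weighted k φ u x ^ 2) ≤
    ∫ x, 2 * gw L x * Real.exp (k * φ ‖x‖) * |lap u x + k ^ 2 * V x * u x| *
      |radN (weighted k φ u) x| := by
  have cφ := W.continuous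
  have cφ₁ := W.continuous₁
  have hp := locBdd_pd_weighted W hu
  have hvc := continuous_weighted W hu.continuous
  have hvb := LocBdd.of_continuous hvc
  have hvρ : ∀ x, ρ < ‖x‖ → weighted k φ u x = 0 := fun x hx => by rw [weighted, huρ x hx, mul_zero]
  have hgb := locBdd_gw (n := n) hL
  have hE : LocBdd fun x : Eucl n => Real.exp (k * φ ‖x‖) := .of_continuous (by fun_prop)
  have hr : LocBdd fun x : Eucl n => ‖x‖ := .of_continuous continuous_norm
  have hlap := LocBdd.of_continuous (continuous_lap hu)
  have hub := LocBdd.of_continuous hu.continuous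
  have hVb : LocBdd V := .of_bounded hV.measurable (hV.abs_le hv₀)
  have hN : LocBdd (radN (weighted k φ u)) := hvb.radN hp
  have hvd : ∀ x, x ≠ 0 → DifferentiableAt ℝ (weighted k φ u) x := fun x hx =>
    (contDiffAt_weighted W hu.contDiffAt hx).differentiableAt (by simp)
  set A : Eucl n → ℝ := fun x => L ^ 2 * gw L x ^ 3 * (eulerD (weighted k φ u) x ^ 2 / ‖x‖ ^ 2 +
      k ^ 2 / 4 * v₀ * weighted k φ u x ^ 2) with hA
  set B : Eucl n → ℝ := fun x => 2 * gw L x * Real.exp (k * φ ‖x‖) *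
      |lap u x + k ^ 2 * V x * u x| * |radN (weighted k φ u) x| with hB
  set P : Eucl n → ℝ := fun x => 2 * gw L x * weighted k φ u x * radN (weighted k φ u) x +
      L ^ 2 * gw L x ^ 3 * weighted k φ u x ^ 2 with hP
  set f : Eucl n → ℝ := fun x => ‖x‖ * gw L x * weighted k φ u x ^ 2 with hf
  set q : Eucl n → ℝ := fun y => k ^ 2 * (gw L y * φ₁ ‖y‖ ^ 2) with hq
  have hPb : LocBdd P := ((((LocBdd.const 2).mul hgb).mul hvb).mul hN).add
    (((LocBdd.const _).mul (hgb.pow 3)).mul (hvb.pow 2))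
  have hfb : LocBdd f := (hr.mul hgb).mul (hvb.pow 2)
  have hAb : LocBdd A := ((LocBdd.const _).mul (hgb.pow 3)).mul
    ((LocBdd.eulerD_div hp).add ((LocBdd.const _).mul (hvb.pow 2)))
  have hBb : LocBdd B := ((((LocBdd.const 2).mul hgb).mul hE).mul
    (hlap.add (((LocBdd.const _).mul hVb).mul hub)).abs).mul hN.abs
  have hAρ : ∀ x, ρ < ‖x‖ → A x = 0 := fun x hx => by
    simp only [hA, hvρ x hx, eulerD_eq_zero_of_outside hvρ hx]; simp
  have hBρ : ∀ x, ρ < ‖x‖ → B x = 0 := fun x hx => by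
    simp only [hB, radN_eq_zero_of_outside hvρ hx]; simp
  have hPρ : ∀ x, ρ < ‖x‖ → P x = 0 := fun x hx => by
    simp only [hP, hvρ x hx]; simp
  have hfρ : ∀ x, ρ < ‖x‖ → f x = 0 := fun x hx => by
    simp only [hf, hvρ x hx]; simp
  have hAi := hAb.integrable hAρ
  have hBi := hBb.integrable hBρ
  refine ⟨hAi, hBi, ?_⟩
  obtain ⟨C₁, hC₁⟩ := hPb.exists_bound hPρ
  obtain ⟨C₂, hC₂⟩ := hfb.exists_bound hfρ
  -- The bracket that is subtracted in the pointwise bound has integral zero: `P` equals `∂_r f +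
  -- (n-1)f/r`, and the difference quotient is the radial derivative of the mean.
  have hparts : ∫ x, (radialMean V δ x * P x + radialSlope V δ x * f x) = 0 :=
    integral_radialMean_mul (by omega) (C' := max C₁ C₂) hV.measurable (hV.abs_le hv₀) hδ hfb.1
      hPb.1 (fun x => (hC₂ x).trans (le_max_right _ _)) (fun x => (hC₁ x).trans (le_max_left _ _))
      hfρ hPρ (fun θ hθ r hr => hasDerivAt_ray (by omega) hL hvd hθ hr)
  have hmean : LocBdd (radialMean V δ) :=
    .of_bounded (measurable_radialMean hV.measurable hδ) (abs_radialMean_le (hV.abs_le hv₀) hδ)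
  have hslope : LocBdd (radialSlope V δ) :=
    .of_bounded (measurable_radialSlope hV.measurable δ) (abs_radialSlope_le (hV.abs_le hv₀) hδ)
  set Q : Eucl n → ℝ := fun x => radialMean V δ x * P x + radialSlope V δ x * f x with hQ
  have hQi : Integrable Q := ((hmean.mul hPb).add (hslope.mul hfb)).integrable fun x hx => by
    rw [hPρ x hx, hfρ x hx]; ring
  have hJb : ∀ i, LocBdd (energyField L q (weighted k φ u) i) := by
    intro i
    have hqb : LocBdd q := .of_continuous (by
      have := (contDiff_gw (n := n) hL).continuous
      fun_prop)
    have hi := locBdd_coord (n := n) i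
    exact (((hgb.mul (((LocBdd.const 2).mul ((LocBdd.eulerD hp).mul (hp i))).sub
      ((LocBdd.gradSq hp).mul hi))).add ((LocBdd.const _).mul (hgb.mul (hvb.mul (hp i))))).add
      ((LocBdd.const _).mul ((hvb.pow 2).mul ((hgb.pow 3).mul hi)))).add
      (hqb.mul ((hvb.pow 2).mul hi))
  have hJρ : ∀ i x, ρ < ‖x‖ → energyField L q (weighted k φ u) i x = 0 := by
    intro i x hx
    have h0 : gradSq (weighted k φ u) x = 0 :=
      Finset.sum_eq_zero fun j _ => by rw [pd_eq_zero_of_outside hvρ hx]; simp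
    rw [energyField, hvρ x hx, pd_eq_zero_of_outside hvρ hx, h0]
    ring
  choose C hC using fun i => (hJb i).exists_bound (hJρ i)
  -- The energy field is bounded with compact support and `C¹` off the origin, so the one-sided
  -- divergence theorem applies.
  have key : ∫ x, (A x - B x - k ^ 2 * Q x) ≤ 0 := by
    refine integral_nonpos_of_le_div (by omega) (J := energyField L q (weighted k φ u))
      (C := ∑ i, |C i|) (fun i x hx => ?_) (fun i => ?_) (fun i x => ?_)
      ((hAi.sub hBi).sub (hQi.const_mul _)) (Filter.Eventually.of_forall fun x hx => ?_)
    · refine contDiffAt_energyField hL (contDiffAt_weighted W hu.contDiffAt hx) ?_ i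
      have h1 : ContDiffAt ℝ 1 (fun y : Eucl n => φ₁ ‖y‖) x :=
        (W.contDiffAt₁ (norm_pos_iff.2 hx)).comp x (contDiffAt_norm ℝ hx)
      exact contDiffAt_const.mul ((((contDiff_gw hL).of_le (by simp)).contDiffAt).mul (h1.pow 2))
    · exact HasCompactSupport.intro (isCompact_closedBall 0 ρ) fun x hx =>
        hJρ i x (by simpa using hx)
    · exact (hC i x).trans ((le_abs_self _).trans
        (Finset.single_le_sum (f := fun i => |C i|) (fun j _ => abs_nonneg _) (Finset.mem_univ i)))
    · have hm := hV.radialMean_mem (x := x) hv₀ hδ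
      refine le_sum_pd_energyField hn hL W hu hx (hV.radialSlope_ge hδ hx)
        (hV.abs_sub_radialMean_le hM hv₀ hδ hx) ?_ hm.1 (hV.eq_zero_outside hv₀ hδ hx)
      rw [abs_le]
      constructor <;> linarith [hm.1, hm.2, hV.lower x, hV.upper x]
  have e1 : ∫ x, (A x - B x - k ^ 2 * Q x) = (∫ x, A x) - (∫ x, B x) - k ^ 2 * ∫ x, Q x := by
    rw [integral_sub (f := fun x => A x - B x) (hAi.sub hBi) (hQi.const_mul _), integral_sub hAi hBi,
      integral_const_mul]
  rw [e1, hparts] at key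
  linarith

end CarlemanIntegral

/-! ### Absorbing the source into the left side -/

section CarlemanAbsorb

/-- Complete the square. Inside a fixed ball `g⁻¹` is bounded by `L + ρ`, so the price of absorbing
into the decaying weight `L²g³` is a constant. -/
lemma two_mul_le_of_source {g L ρ r y E s : ℝ} (hg : 0 < g) (hL : 0 < L) (hr : 0 ≤ r) (hρ : r ≤ ρ)
    (hgρ : g⁻¹ ≤ L + ρ) :
    2 * g * E * s * (r * y) ≤ L ^ 2 * g ^ 3 * y ^ 2 + (L + ρ) * ρ ^ 2 / L ^ 2 * (E ^ 2 * s ^ 2) := by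
  have h1 : 0 ≤ (g * L ^ 2)⁻¹ * (L ^ 2 * g ^ 2 * y - r * E * s) ^ 2 := by positivity
  have h2 : (g * L ^ 2)⁻¹ * (L ^ 2 * g ^ 2 * y - r * E * s) ^ 2 =
      L ^ 2 * g ^ 3 * y ^ 2 - 2 * g * E * s * (r * y) + g⁻¹ * r ^ 2 / L ^ 2 * (E ^ 2 * s ^ 2) := by
    field_simp; ring
  have h3 : g⁻¹ * r ^ 2 / L ^ 2 * (E ^ 2 * s ^ 2) ≤
      (L + ρ) * ρ ^ 2 / L ^ 2 * (E ^ 2 * s ^ 2) := by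
    have : 0 ≤ L + ρ := by linarith
    gcongr
  linarith

lemma mul_le_of_source {g L ρ w E s m v₀ : ℝ} (hg : 0 < g) (hL : 0 < L) (hv₀ : 0 < v₀)
    (hgρ : g⁻¹ ≤ L + ρ) :
    m * g * E * s * w ≤ L ^ 2 * g ^ 3 * (v₀ / 8 * w ^ 2) +
      2 * m ^ 2 * (L + ρ) / (L ^ 2 * v₀) * (E ^ 2 * s ^ 2) := by
  have h1 : 0 ≤ 2 / (L ^ 2 * g * v₀) * (L ^ 2 * g ^ 2 * v₀ / 4 * w - m * E * s) ^ 2 := by positivity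
  have h2 : 2 / (L ^ 2 * g * v₀) * (L ^ 2 * g ^ 2 * v₀ / 4 * w - m * E * s) ^ 2 =
      L ^ 2 * g ^ 3 * (v₀ / 8 * w ^ 2) - m * g * E * s * w +
        2 * m ^ 2 * g⁻¹ / (L ^ 2 * v₀) * (E ^ 2 * s ^ 2) := by
    field_simp; ring
  have h3 : 2 * m ^ 2 * g⁻¹ / (L ^ 2 * v₀) * (E ^ 2 * s ^ 2) ≤
      2 * m ^ 2 * (L + ρ) / (L ^ 2 * v₀) * (E ^ 2 * s ^ 2) := by gcongr
  linarith

/-- The constant in front of the source term of the Carleman estimate. -/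
def sourceConst (n : ℕ) (L ρ v₀ : ℝ) : ℝ :=
  (L + ρ) * ρ ^ 2 / L ^ 2 + 2 * n ^ 2 * (L + ρ) / (L ^ 2 * v₀)

/-- The two parts of the source are treated differently. The part `s₁` lives in a fixed ball, so it
can be absorbed quadratically. The support of `s₂` is not controlled, and absorbing it would cost
the unbounded factor `g⁻¹`; it is kept linearly, using only `g ≤ 1/L` and `g r ≤ 1`. -/
lemma absorb_source {n : ℕ} {g L ρ r E s₁ s₂ v₀ k T S N D v u G : ℝ} (hn : 3 ≤ n) (hg : 0 < g)
    (hL : 0 < L)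
    (hr : 0 < r) (hv₀ : 0 < v₀) (hk : 1 ≤ k) (hE : 0 < E) (hs₁ : 0 ≤ s₁) (hs₂ : 0 ≤ s₂)
    (hs : s₁ ≠ 0 → r ≤ ρ ∧ g⁻¹ ≤ L + ρ) (hgL : g ≤ 1 / L) (hgr : g * r ≤ 1) (hS : |S| ≤ s₁ + s₂)
    (hN : N = D + ((n : ℝ) - 1) / 2 * v) (hv : v = E * u) (hG : 0 ≤ G) (hT : 0 ≤ T)
    (hD : |D| ≤ E * (r * G + k * r * T * |u|)) :
    2 * g * E * |S| * |N| ≤ L ^ 2 * g ^ 3 * (D ^ 2 / r ^ 2 + k ^ 2 / 8 * v₀ * v ^ 2) +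
      (sourceConst n L ρ v₀ * (E ^ 2 * s₁ ^ 2) +
        2 * E ^ 2 * s₂ * (G + (k * T + n / L) * |u|)) := by
  have hn' : (3 : ℝ) ≤ n := by exact_mod_cast hn
  have hNle : |N| ≤ |D| + n / 2 * |v| := by
    rw [hN]
    refine (abs_add_le _ _).trans ?_
    rw [abs_mul, abs_of_nonneg (by linarith : 0 ≤ ((n : ℝ) - 1) / 2)]
    have := abs_nonneg v
    gcongr
    linarith
  have h0 : 2 * g * E * |S| * |N| ≤ 2 * g * E * (s₁ + s₂) * (|D| + n / 2 * |v|) := by gcongr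
  have h1 : 2 * g * E * s₁ * (|D| + n / 2 * |v|) ≤
      L ^ 2 * g ^ 3 * (D ^ 2 / r ^ 2 + k ^ 2 / 8 * v₀ * v ^ 2) +
        sourceConst n L ρ v₀ * (E ^ 2 * s₁ ^ 2) := by
    by_cases h : s₁ = 0
    · rw [h];
      have : 0 ≤ L ^ 2 * g ^ 3 * (D ^ 2 / r ^ 2 + k ^ 2 / 8 * v₀ * v ^ 2) := by positivity
      simpa using this
    · obtain ⟨hρ, hgρ⟩ := hs h
      have a1 := two_mul_le_of_source (y := |D| / r) (E := E) (s := s₁) hg hL hr.le hρ hgρ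
      have a2 := mul_le_of_source (w := |v|) (E := E) (s := s₁) (m := n) hg hL hv₀ hgρ
      rw [show r * (|D| / r) = |D| by field_simp, div_pow, sq_abs] at a1
      rw [sq_abs] at a2
      have a3 : L ^ 2 * g ^ 3 * (v₀ / 8 * v ^ 2) ≤ L ^ 2 * g ^ 3 * (k ^ 2 / 8 * v₀ * v ^ 2) := by
        have : 1 ≤ k ^ 2 := one_le_pow₀ hk
        have : v₀ / 8 * v ^ 2 * 1 ≤ v₀ / 8 * v ^ 2 * k ^ 2 := by gcongr
        have : v₀ / 8 * v ^ 2 ≤ k ^ 2 / 8 * v₀ * v ^ 2 := by linarith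
        gcongr
      rw [sourceConst]
      linarith
  have h2 : 2 * g * E * s₂ * (|D| + n / 2 * |v|) ≤ 2 * E ^ 2 * s₂ * (G + (k * T + n / L) * |u|) := by
    have b1 : g * |D| ≤ E * (G + k * T * |u|) := by
      have : 0 ≤ G + k * T * |u| := by positivity
      calc g * |D| ≤ g * (E * (r * G + k * r * T * |u|)) := by gcongr
        _ = (g * r) * (E * (G + k * T * |u|)) := by ring
        _ ≤ 1 * (E * (G + k * T * |u|)) := by gcongr
        _ = _ := one_mul _
    have b2 : g * (n / 2 * |v|) ≤ E * (n / L * |u|) := by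
      rw [hv, abs_mul, abs_of_pos hE]
      calc g * (n / 2 * (E * |u|)) ≤ 1 / L * (n / 1 * (E * |u|)) := by gcongr; norm_num
        _ = _ := by field_simp
    calc 2 * g * E * s₂ * (|D| + n / 2 * |v|) = 2 * E * s₂ * (g * |D| + g * (n / 2 * |v|)) := by ring
      _ ≤ 2 * E * s₂ * (E * (G + k * T * |u|) + E * (n / L * |u|)) := by gcongr
      _ = _ := by ring
  have h3 : 2 * g * E * (s₁ + s₂) * (|D| + n / 2 * |v|) =
    2 * g * E * s₁ * (|D| + n / 2 * |v|) + 2 * g * E * s₂ * (|D| + n / 2 * |v|) := by ring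
  linarith

variable {n : ℕ} {M : ℝ → ℝ} {R₀ v₀ v₁ R₁ L T k δ ρ ρ' : ℝ} {φ φ₁ φ₂ : ℝ → ℝ}
  {u v V s₁ s₂ : Eucl n → ℝ} {x : Eucl n} {i : Fin n}

lemma gw_le (hL : 0 < L) (x : Eucl n) : gw L x ≤ 1 / L := by
  rw [gw, one_div]
  gcongr
  exact Real.le_sqrt_of_sq_le (by nlinarith [sq_nonneg ‖x‖])

lemma gw_mul_norm_le (hL : 0 < L) (x : Eucl n) : gw L x * ‖x‖ ≤ 1 := by
  have h : ‖x‖ ≤ √(L ^ 2 + ‖x‖ ^ 2) := Real.le_sqrt_of_sq_le (by nlinarith [sq_nonneg L])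
  rw [gw, inv_mul_le_iff₀ (Real.sqrt_pos.2 (by positivity)), mul_one]
  exact h

lemma inv_gw_le (hL : 0 < L) (x : Eucl n) : (gw L x)⁻¹ ≤ L + ‖x‖ := by
  rw [gw, inv_inv]
  refine Real.sqrt_le_iff.2 ⟨by positivity, ?_⟩
  nlinarith [norm_nonneg x]

/-- Carleman estimate for real valued test functions; `s₁` is the source in a fixed ball and
`s₂` an error term. -/
theorem carleman_real (hn : 3 ≤ n) (hL : 0 < L) (hM : Monotone M) (hδ : 0 < δ)
    (hv₀ : 0 < v₀) (hk : 1 ≤ k) (hT : 0 ≤ T) (W : CarlemanWeight M R₀ v₀ v₁ R₁ L T k δ φ φ₁ φ₂)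
    (hV : RayPotential M R₀ v₀ v₁ V) (hu : ContDiff ℝ 2 u) (huρ : ∀ x, ρ < ‖x‖ → u x = 0)
    (hs₁ : LocBdd s₁) (hs₂ : LocBdd s₂) (hs₁0 : ∀ x, 0 ≤ s₁ x) (hs₂0 : ∀ x, 0 ≤ s₂ x)
    (hs₁ρ : ∀ x, ρ' < ‖x‖ → s₁ x = 0)
    (hs : ∀ x, |lap u x + k ^ 2 * V x * u x| ≤ s₁ x + s₂ x) :
    ∫ x, L ^ 2 * gw L x ^ 3 * (k ^ 2 / 8 * v₀ * weighted k φ u x ^ 2) ≤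
      ∫ x, (sourceConst n L ρ' v₀ * (Real.exp (k * φ ‖x‖) ^ 2 * s₁ x ^ 2) +
        2 * Real.exp (k * φ ‖x‖) ^ 2 * s₂ x * (√(gradSq u x) + (k * T + n / L) * |u x|)) := by
  obtain ⟨hAi, hBi, hle⟩ := integral_carleman_le hn hL hM hδ hv₀ W hV hu huρ
  have cφ := W.continuous
  have hp := locBdd_pd_weighted W hu
  have hvb := LocBdd.of_continuous (continuous_weighted W hu.continuous)
  have hvρ : ∀ x, ρ < ‖x‖ → weighted k φ u x = 0 := fun x hx => by rw [weighted, huρ x hx, mul_zero]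
  have hgb := locBdd_gw (n := n) hL
  have hE : LocBdd fun x : Eucl n => Real.exp (k * φ ‖x‖) := .of_continuous (by fun_prop)
  have hub := LocBdd.of_continuous hu.continuous
  have hpu : ∀ i, Continuous (pd i u) := fun i => (hu.pd (m := 1) (by norm_num) i).continuous
  have hGc : Continuous (gradSq u) := continuous_finsetSum _ fun i _ => (hpu i).pow 2
  have hG : LocBdd fun x => √(gradSq u x) := .of_continuous hGc.sqrt
  have hG0 : ∀ x, ρ < ‖x‖ → gradSq u x = 0 := fun x hx =>
    Finset.sum_eq_zero fun j _ => by rw [pd_eq_zero_of_outside huρ hx]; simp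
  set A₁ : Eucl n → ℝ := fun x => L ^ 2 * gw L x ^ 3 * (k ^ 2 / 8 * v₀ * weighted k φ u x ^ 2) with hA₁
  -- The left side is halved in its zero order term: `A₂`, with the whole radial derivative, absorbs
  -- the source, and `A₁` survives.
  set A₂ : Eucl n → ℝ := fun x => L ^ 2 * gw L x ^ 3 *
    (eulerD (weighted k φ u) x ^ 2 / ‖x‖ ^ 2 + k ^ 2 / 8 * v₀ * weighted k φ u x ^ 2) with hA₂
  set B₁ : Eucl n → ℝ := fun x => sourceConst n L ρ' v₀ * (Real.exp (k * φ ‖x‖) ^ 2 * s₁ x ^ 2) +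
    2 * Real.exp (k * φ ‖x‖) ^ 2 * s₂ x * (√(gradSq u x) + (k * T + n / L) * |u x|) with hB₁
  have hA₁i : Integrable A₁ := (((LocBdd.const _).mul (hgb.pow 3)).mul
    ((LocBdd.const _).mul (hvb.pow 2))).integrable fun x hx => by rw [hvρ x hx]; ring
  have hA₂i : Integrable A₂ := (((LocBdd.const _).mul (hgb.pow 3)).mul
    ((LocBdd.eulerD_div hp).add ((LocBdd.const _).mul (hvb.pow 2)))).integrable fun x hx => by
      rw [hvρ x hx, eulerD_eq_zero_of_outside hvρ hx]; simp
  have hB₁i : Integrable B₁ := (((LocBdd.const _).mul ((hE.pow 2).mul (hs₁.pow 2))).add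
    ((((LocBdd.const 2).mul (hE.pow 2)).mul hs₂).mul (hG.add ((LocBdd.const _).mul hub.abs)))).integrable
      (ρ := max ρ ρ') fun x hx => by
        simp only [hB₁]
        rw [hs₁ρ x ((le_max_right _ _).trans_lt hx), huρ x ((le_max_left _ _).trans_lt hx),
          hG0 x ((le_max_left _ _).trans_lt hx)]
        simp
  have hpt : ∀ᵐ x : Eucl n, 2 * gw L x * Real.exp (k * φ ‖x‖) * |lap u x + k ^ 2 * V x * u x| *
      |radN (weighted k φ u) x| ≤ A₂ x + B₁ x := by
    have : NeZero n := ⟨by omega⟩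
    have h0 : ∀ᵐ x : Eucl n, x ≠ 0 := by
      simp [ae_iff]
    filter_upwards [h0] with x hx
    have hr : 0 < ‖x‖ := norm_pos_iff.2 hx
    refine absorb_source hn (gw_pos hL x) hL hr hv₀ hk (Real.exp_pos _) (hs₁0 x) (hs₂0 x)
      (fun h => ?_) (gw_le hL x) (gw_mul_norm_le hL x) (hs x) rfl rfl (Real.sqrt_nonneg _) hT ?_
    · have : ‖x‖ ≤ ρ' := by
        by_contra h'
        exact h (hs₁ρ x (not_le.1 h'))
      exact ⟨this, (inv_gw_le hL x).trans (by linarith)⟩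
    · rw [eulerD_weighted W (hu.differentiable (by simp) x) hx, abs_mul, abs_of_pos (Real.exp_pos _)]
      gcongr
      refine (abs_add_le _ _).trans (add_le_add ?_ ?_)
      · rw [← Real.sqrt_sq_eq_abs]
        refine (Real.sqrt_le_sqrt (eulerD_sq_le u x)).trans ?_
        rw [Real.sqrt_mul (by positivity), Real.sqrt_sq hr.le]
      · rw [abs_mul, abs_mul, abs_of_nonneg (by positivity), abs_of_nonneg (W.nonneg₁ _ hr.le)]
        gcongr
        exact W.le₁ _ hr.le
  have h2 := integral_mono_ae hBi (hA₂i.add hB₁i) hpt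
  have h3 : ∫ x, (A₂ + B₁) x = (∫ x, A₂ x) + ∫ x, B₁ x := integral_add hA₂i hB₁i
  have h4 : ∫ x, L ^ 2 * gw L x ^ 3 * (eulerD (weighted k φ u) x ^ 2 / ‖x‖ ^ 2 +
      k ^ 2 / 4 * v₀ * weighted k φ u x ^ 2) = (∫ x, A₁ x) + ∫ x, A₂ x := by
    rw [← integral_add hA₁i hA₂i]
    congr 1; funext x; simp only [hA₁, hA₂]; ring
  rw [h4] at hle
  rw [h3] at h2
  linarith

end CarlemanAbsorb

/-! ### The Helmholtz equation with absorption: energy and Carleman estimates -/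

section Helmholtz

variable {n : ℕ} {M : ℝ → ℝ} {R₀ v₀ v₁ R₁ L T k δ ρ ρ' ε η φ₀ Φ : ℝ} {φ φ₁ φ₂ : ℝ → ℝ}
  {a b u₁ u₂ f₁ f₂ V : Eucl n → ℝ} {x : Eucl n} {i : Fin n} {Ω : Set (Eucl n)}

lemma locBdd_pd (ha : ContDiff ℝ 2 a) (i : Fin n) : LocBdd (pd i a) :=
  .of_continuous (ha.pd (m := 1) (by norm_num) i).continuous

/-- Green's first identity for test functions. -/
lemma integral_lap_mul (ha : ContDiff ℝ 2 a) (hb : ContDiff ℝ 2 b) (haρ : ∀ x, ρ < ‖x‖ → a x = 0) :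
    ∫ x, lap a x * b x = -∫ x, ∑ i, pd i a x * pd i b x := by
  have hp : ∀ i, ContDiff ℝ 1 (pd i a) := fun i => ha.pd (by norm_num) i
  have h1 : ∀ i, ∫ x, pd i (fun y => pd i a y * b y) x = 0 := fun i => by
    refine integral_pd_eq_zero ((hp i).mul (hb.of_le (by norm_num))) ?_ i
    exact HasCompactSupport.intro (isCompact_closedBall 0 ρ) fun x hx => by
      rw [pd_eq_zero_of_outside haρ (by simpa using hx), zero_mul]
  have h2 : ∀ i, Integrable fun x => pd i (pd i a) x * b x := fun i =>
    ((LocBdd.of_continuous ((hp i).pd (m := 0) (by norm_num) i).continuous).mul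
      (.of_continuous hb.continuous)).integrable (ρ := ρ) fun x hx => by
        rw [pd_eq_zero_of_outside (fun y hy => pd_eq_zero_of_outside haρ hy) hx, zero_mul]
  have h3 : ∀ i, Integrable fun x => pd i a x * pd i b x := fun i =>
    ((locBdd_pd ha i).mul (locBdd_pd hb i)).integrable (ρ := ρ) fun x hx => by
        rw [pd_eq_zero_of_outside haρ hx, zero_mul]
  have h4 : ∀ i, ∫ x, pd i (pd i a) x * b x = -∫ x, pd i a x * pd i b x := fun i => by
    have h5 := h1 i
    have h6 : ∀ x, pd i (fun y => pd i a y * b y) x = pd i a x * pd i b x + pd i (pd i a) x * b x :=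
      fun x => pd_mul ((hp i).differentiable (by simp) x) (hb.differentiable (by simp) x)
    simp_rw [h6] at h5
    rw [integral_add (h3 i) (h2 i)] at h5
    linarith
  unfold lap
  simp_rw [Finset.sum_mul]
  rw [integral_finsetSum _ fun i _ => h2 i, integral_finsetSum _ fun i _ => h3 i,
    ← Finset.sum_neg_distrib]
  exact Finset.sum_congr rfl fun i _ => h4 i

lemma abs_pair_le (p q s t : ℝ) : |p * s + q * t| ≤ √(p ^ 2 + q ^ 2) * √(s ^ 2 + t ^ 2) := by
  rw [← Real.sqrt_mul (by positivity)]
  refine Real.abs_le_sqrt ?_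
  nlinarith [sq_nonneg (p * t - q * s)]

/-- `u = u₁ + i u₂` is a test function and `f = f₁ + i f₂` satisfies
`-Δ u - (k² + i ε) V u = V f`. -/
structure HelmholtzPair (V : Eucl n → ℝ) (k ε ρ : ℝ) (u₁ u₂ f₁ f₂ : Eucl n → ℝ) : Prop where
  contDiff₁ : ContDiff ℝ 2 u₁
  contDiff₂ : ContDiff ℝ 2 u₂
  supp₁ : ∀ x, ρ < ‖x‖ → u₁ x = 0
  supp₂ : ∀ x, ρ < ‖x‖ → u₂ x = 0
  locBdd₁ : LocBdd f₁
  locBdd₂ : LocBdd f₂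
  suppf₁ : ∀ x, ρ < ‖x‖ → f₁ x = 0
  suppf₂ : ∀ x, ρ < ‖x‖ → f₂ x = 0
  eq₁ : ∀ x, lap u₁ x = -V x * f₁ x - k ^ 2 * V x * u₁ x + ε * V x * u₂ x
  eq₂ : ∀ x, lap u₂ x = -V x * f₂ x - k ^ 2 * V x * u₂ x - ε * V x * u₁ x

lemma LocBdd.sqrt {a b : Eucl n → ℝ} (ha : LocBdd a) (hb : LocBdd b) :
    LocBdd fun x => √(a x ^ 2 + b x ^ 2) := by
  refine (ha.abs.add hb.abs).of_abs_le ((ha.1.pow_const 2).add (hb.1.pow_const 2)).sqrt fun x => ?_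
  rw [abs_of_nonneg (Real.sqrt_nonneg _)]
  refine le_trans ?_ (le_abs_self _)
  exact Real.sqrt_le_iff.2 ⟨by positivity, by
    nlinarith [sq_abs (a x), sq_abs (b x), abs_nonneg (a x), abs_nonneg (b x),
      mul_nonneg (abs_nonneg (a x)) (abs_nonneg (b x))]⟩

lemma LocBdd.indicator (ha : LocBdd a) (hΩ : MeasurableSet Ω) : LocBdd (Ω.indicator a) :=
  ha.of_abs_le (ha.1.indicator hΩ) fun x => by
    by_cases hx : x ∈ Ω
    · rw [indicator_of_mem hx]
    · rw [indicator_of_notMem hx, abs_zero]; exact abs_nonneg _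

/-- Energy estimates for the Helmholtz equation with absorption. -/
lemma HelmholtzPair.energy (h : HelmholtzPair V k ε ρ u₁ u₂ f₁ f₂)
    (hV : RayPotential M R₀ v₀ v₁ V) (hv₀ : 0 < v₀) (hε : 0 ≤ ε) :
    ε * v₀ * (∫ x, (u₁ x ^ 2 + u₂ x ^ 2)) ≤
        v₁ * ∫ x, √(f₁ x ^ 2 + f₂ x ^ 2) * √(u₁ x ^ 2 + u₂ x ^ 2) ∧
      ∫ x, (gradSq u₁ x + gradSq u₂ x) ≤
        v₁ * (∫ x, √(f₁ x ^ 2 + f₂ x ^ 2) * √(u₁ x ^ 2 + u₂ x ^ 2)) +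
          k ^ 2 * v₁ * ∫ x, (u₁ x ^ 2 + u₂ x ^ 2) := by
  have b₁ := LocBdd.of_continuous h.contDiff₁.continuous
  have b₂ := LocBdd.of_continuous h.contDiff₂.continuous
  have l₁ := LocBdd.of_continuous (continuous_lap h.contDiff₁)
  have l₂ := LocBdd.of_continuous (continuous_lap h.contDiff₂)
  have hi : ∀ {a b : Eucl n → ℝ}, LocBdd a → LocBdd b → (∀ x, ρ < ‖x‖ → b x = 0) →
      Integrable fun x => a x * b x := fun ha hb hs =>
    (ha.mul hb).integrable fun x hx => by rw [hs x hx, mul_zero]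
  have hFU : Integrable fun x => √(f₁ x ^ 2 + f₂ x ^ 2) * √(u₁ x ^ 2 + u₂ x ^ 2) :=
    hi (h.locBdd₁.sqrt h.locBdd₂) (b₁.sqrt b₂) fun x hx => by
      rw [h.supp₁ x hx, h.supp₂ x hx]; simp
  have hN : Integrable fun x => u₁ x ^ 2 + u₂ x ^ 2 :=
    ((b₁.pow 2).add (b₂.pow 2)).integrable fun x hx => by
      rw [h.supp₁ x hx, h.supp₂ x hx]; simp
  have hG : ∀ {u : Eucl n → ℝ}, ContDiff ℝ 2 u → (∀ x, ρ < ‖x‖ → u x = 0) →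
      Integrable (gradSq u) := fun hu hs =>
    (LocBdd.gradSq (locBdd_pd hu)).integrable fun x hx =>
      Finset.sum_eq_zero fun j _ => by rw [pd_eq_zero_of_outside hs hx]; simp
  have hV0 : ∀ x, 0 ≤ V x := fun x => hv₀.le.trans (hV.lower x)
  constructor
  -- The imaginary part of the pairing of `Δu` with `u`: the gradient terms cancel and the
  -- absorption `εV|u|²` is left against the source.
  · have e1 : ∫ x, (lap u₁ x * u₂ x - lap u₂ x * u₁ x) = 0 := by
      rw [integral_sub (hi l₁ b₂ h.supp₂) (hi l₂ b₁ h.supp₁),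
        integral_lap_mul h.contDiff₁ h.contDiff₂ h.supp₁,
        integral_lap_mul h.contDiff₂ h.contDiff₁ h.supp₂]
      simp_rw [mul_comm (pd _ u₁ _)]
      ring
    have e2 : ∫ x, (ε * v₀ * (u₁ x ^ 2 + u₂ x ^ 2) -
        v₁ * (√(f₁ x ^ 2 + f₂ x ^ 2) * √(u₁ x ^ 2 + u₂ x ^ 2))) ≤
        ∫ x, (lap u₁ x * u₂ x - lap u₂ x * u₁ x) := by
      refine integral_mono ((hN.const_mul _).sub (hFU.const_mul _))
        ((hi l₁ b₂ h.supp₂).sub (hi l₂ b₁ h.supp₁)) fun x => ?_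
      simp only [h.eq₁ x, h.eq₂ x]
      have h1 := (le_abs_self _).trans (abs_pair_le (f₁ x) (f₂ x) (u₂ x) (-u₁ x))
      have h2 := mul_le_mul_of_nonneg_left h1 (hV0 x)
      have h3 := mul_le_mul_of_nonneg_right (hV.upper x)
        (by positivity : 0 ≤ √(f₁ x ^ 2 + f₂ x ^ 2) * √(u₂ x ^ 2 + (-u₁ x) ^ 2))
      have h4 := mul_le_mul_of_nonneg_right (hV.lower x)
        (by positivity : 0 ≤ ε * (u₁ x ^ 2 + u₂ x ^ 2))
      have h5 : √(u₂ x ^ 2 + (-u₁ x) ^ 2) = √(u₁ x ^ 2 + u₂ x ^ 2) := by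
        congr 1; ring
      rw [h5] at h2 h3
      linarith
    rw [e1, integral_sub (hN.const_mul _) (hFU.const_mul _), integral_const_mul,
      integral_const_mul] at e2
    linarith
  -- The real part of the same pairing, which controls the gradient.
  · have e1 : ∫ x, (lap u₁ x * u₁ x + lap u₂ x * u₂ x) = -∫ x, (gradSq u₁ x + gradSq u₂ x) := by
      rw [integral_add (hi l₁ b₁ h.supp₁) (hi l₂ b₂ h.supp₂),
        integral_lap_mul h.contDiff₁ h.contDiff₁ h.supp₁,
        integral_lap_mul h.contDiff₂ h.contDiff₂ h.supp₂,
        integral_add (hG h.contDiff₁ h.supp₁) (hG h.contDiff₂ h.supp₂)]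
      simp only [gradSq, pow_two]
      ring
    have e2 : ∫ x, -(lap u₁ x * u₁ x + lap u₂ x * u₂ x) ≤
        ∫ x, (v₁ * (√(f₁ x ^ 2 + f₂ x ^ 2) * √(u₁ x ^ 2 + u₂ x ^ 2)) +
          k ^ 2 * v₁ * (u₁ x ^ 2 + u₂ x ^ 2)) := by
      refine integral_mono ((hi l₁ b₁ h.supp₁).add (hi l₂ b₂ h.supp₂)).neg
        ((hFU.const_mul _).add (hN.const_mul _)) fun x => ?_
      simp only [h.eq₁ x, h.eq₂ x]
      have h1 := (le_abs_self _).trans (abs_pair_le (f₁ x) (f₂ x) (u₁ x) (u₂ x))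
      have h2 := mul_le_mul_of_nonneg_left h1 (hV0 x)
      have h3 := mul_le_mul_of_nonneg_right (hV.upper x)
        (by positivity : 0 ≤ √(f₁ x ^ 2 + f₂ x ^ 2) * √(u₁ x ^ 2 + u₂ x ^ 2))
      have h4 := mul_le_mul_of_nonneg_right (hV.upper x)
        (by positivity : 0 ≤ k ^ 2 * (u₁ x ^ 2 + u₂ x ^ 2))
      linarith
    rw [integral_neg, e1, integral_add (hFU.const_mul _) (hN.const_mul _), integral_const_mul,
      integral_const_mul] at e2
    linarith

/-- The Carleman estimate for the real and imaginary parts together. -/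
lemma HelmholtzPair.carleman (h : HelmholtzPair V k ε ρ u₁ u₂ f₁ f₂)
    (hn : 3 ≤ n) (hL : 0 < L) (hM : Monotone M) (hδ : 0 < δ)
    (hv₀ : 0 < v₀) (hk : 1 ≤ k) (hT : 0 ≤ T) (W : CarlemanWeight M R₀ v₀ v₁ R₁ L T k δ φ φ₁ φ₂)
    (hV : RayPotential M R₀ v₀ v₁ V) (hε : 0 ≤ ε) (hΩ : MeasurableSet Ω)
    (hρ' : 0 ≤ ρ') (hΩρ : ∀ x ∈ Ω, ‖x‖ ≤ ρ') (hΩφ : ∀ x ∈ Ω, φ₀ ≤ φ ‖x‖) (hΦ : ∀ r, 0 ≤ r → φ r ≤ Φ) :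
    L ^ 2 * v₀ / (8 * (L + ρ') ^ 3) * Real.exp (k * φ₀) ^ 2 * k ^ 2 *
        ∫ x, Ω.indicator (fun x => u₁ x ^ 2 + u₂ x ^ 2) x ≤
      2 * sourceConst n L ρ' v₀ * v₁ ^ 2 * Real.exp (k * Φ) ^ 2 *
        (∫ x, Ω.indicator (fun x => f₁ x ^ 2 + f₂ x ^ 2) x) +
      4 * v₁ * Real.exp (k * Φ) ^ 2 * ∫ x, (Ωᶜ.indicator (fun x => √(f₁ x ^ 2 + f₂ x ^ 2)) x +
        ε * √(u₁ x ^ 2 + u₂ x ^ 2)) * (√(gradSq u₁ x + gradSq u₂ x) +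
          (k * T + n / L) * √(u₁ x ^ 2 + u₂ x ^ 2)) := by
  have hn' : (0 : ℝ) ≤ n := Nat.cast_nonneg n
  have hv₁ : 0 < v₁ := hv₀.trans_le ((hV.lower 0).trans (hV.upper 0))
  have b₁ := LocBdd.of_continuous h.contDiff₁.continuous
  have b₂ := LocBdd.of_continuous h.contDiff₂.continuous
  have hF := h.locBdd₁.sqrt h.locBdd₂
  have hU := b₁.sqrt b₂
  have hsC : 0 ≤ sourceConst n L ρ' v₀ := by unfold sourceConst; positivity
  set F : Eucl n → ℝ := fun x => √(f₁ x ^ 2 + f₂ x ^ 2) with hFdef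
  set U : Eucl n → ℝ := fun x => √(u₁ x ^ 2 + u₂ x ^ 2) with hUdef
  have hF0 : ∀ x, 0 ≤ F x := fun x => Real.sqrt_nonneg _
  have hU0 : ∀ x, 0 ≤ U x := fun x => Real.sqrt_nonneg _
  -- Everything except the `k²` term on the right of the equation is a source. The part of `f` on
  -- `Ω` is the main source; the part of `f` off `Ω` and the absorption term `εVu` are errors.
  set s₁ : Eucl n → ℝ := fun x => v₁ * Ω.indicator F x with hs₁
  set s₂ : Eucl n → ℝ := fun x => v₁ * (Ωᶜ.indicator F x + ε * U x) with hs₂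
  have hs₁b : LocBdd s₁ := (LocBdd.const _).mul (hF.indicator hΩ)
  have hs₂b : LocBdd s₂ :=
    (LocBdd.const _).mul ((hF.indicator hΩ.compl).add ((LocBdd.const _).mul hU))
  have hs₁0 : ∀ x, 0 ≤ s₁ x := fun x => mul_nonneg hv₁.le (indicator_nonneg (fun y _ => hF0 y) x)
  have hs₂0 : ∀ x, 0 ≤ s₂ x := fun x => mul_nonneg hv₁.le
    (add_nonneg (indicator_nonneg (fun y _ => hF0 y) x) (mul_nonneg hε (hU0 x)))
  have hs₁ρ : ∀ x, ρ' < ‖x‖ → s₁ x = 0 := fun x hx => by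
    simp only [hs₁]
    rw [indicator_of_notMem fun hx' => (hΩρ x hx').not_gt hx, mul_zero]
  have hsum : ∀ x, s₁ x + s₂ x = v₁ * (F x + ε * U x) := fun x => by
    have := congrFun (indicator_self_add_compl Ω F) x
    simp only [Pi.add_apply] at this
    simp only [hs₁, hs₂, ← this]; ring
  have hV0 : ∀ x, 0 ≤ V x := fun x => hv₀.le.trans (hV.lower x)
  have hcomb : ∀ p q r s t : ℝ, 0 ≤ t → t ≤ v₁ → |-t * p + ε * t * q| ≤
      v₁ * (√(p ^ 2 + r ^ 2) + ε * √(s ^ 2 + q ^ 2)) := by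
    intro p q r s t ht htv
    have h1 : |p| ≤ √(p ^ 2 + r ^ 2) := Real.abs_le_sqrt (by nlinarith)
    have h2 : |q| ≤ √(s ^ 2 + q ^ 2) := Real.abs_le_sqrt (by nlinarith)
    calc |-t * p + ε * t * q| = t * |-p + ε * q| := by
          rw [← abs_of_nonneg ht, ← abs_mul, abs_of_nonneg ht]; ring_nf
      _ ≤ t * (|p| + ε * |q|) := by
          gcongr
          refine (abs_add_le _ _).trans ?_
          rw [abs_neg, abs_mul, abs_of_nonneg hε]
      _ ≤ v₁ * (√(p ^ 2 + r ^ 2) + ε * √(s ^ 2 + q ^ 2)) := by gcongr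
  have c₁ := carleman_real hn hL hM hδ hv₀ hk hT W hV h.contDiff₁ h.supp₁ hs₁b hs₂b hs₁0 hs₂0 hs₁ρ
    fun x => by
      rw [hsum, h.eq₁ x]
      refine le_of_eq_of_le (congrArg _ ?_) (hcomb (f₁ x) (u₂ x) (f₂ x) (u₁ x) (V x) (hV0 x) (hV.upper x))
      ring
  have c₂ := carleman_real hn hL hM hδ hv₀ hk hT W hV h.contDiff₂ h.supp₂ hs₁b hs₂b hs₁0 hs₂0 hs₁ρ
    fun x => by
      rw [hsum, h.eq₂ x]
      have := hcomb (f₂ x) (-u₁ x) (f₁ x) (u₂ x) (V x) (hV0 x) (hV.upper x)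
      rw [neg_sq, add_comm (f₂ x ^ 2), add_comm (u₂ x ^ 2)] at this
      refine le_of_eq_of_le (congrArg _ ?_) this
      ring
  have cφ := W.continuous
  have hE : LocBdd fun x : Eucl n => Real.exp (k * φ ‖x‖) := .of_continuous (by fun_prop)
  have hgb := locBdd_gw (n := n) hL
  have hG : ∀ {u : Eucl n → ℝ}, ContDiff ℝ 2 u → Continuous (gradSq u) := fun hu =>
    continuous_finsetSum _ fun i _ => ((hu.pd (m := 1) (by norm_num) i).continuous).pow 2
  have hG0 : ∀ (u : Eucl n → ℝ), (∀ x, ρ < ‖x‖ → u x = 0) → ∀ x, ρ < ‖x‖ → gradSq u x = 0 :=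
    fun u hs x hx => Finset.sum_eq_zero fun j _ => by rw [pd_eq_zero_of_outside hs hx]; simp
  have hG0' : ∀ (u : Eucl n → ℝ) x, 0 ≤ gradSq u x := fun u x => Finset.sum_nonneg fun j _ => sq_nonneg _
  have iA : ∀ {u : Eucl n → ℝ}, ContDiff ℝ 2 u → (∀ x, ρ < ‖x‖ → u x = 0) →
      Integrable fun x => L ^ 2 * gw L x ^ 3 * (k ^ 2 / 8 * v₀ * weighted k φ u x ^ 2) :=
    fun hu hs => (((LocBdd.const _).mul (hgb.pow 3)).mul ((LocBdd.const _).mul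
      ((LocBdd.of_continuous (continuous_weighted W hu.continuous)).pow 2))).integrable
        fun x hx => by rw [weighted, hs x hx]; ring
  have iB : ∀ {u : Eucl n → ℝ}, ContDiff ℝ 2 u → (∀ x, ρ < ‖x‖ → u x = 0) →
      Integrable fun x => sourceConst n L ρ' v₀ * (Real.exp (k * φ ‖x‖) ^ 2 * s₁ x ^ 2) +
        2 * Real.exp (k * φ ‖x‖) ^ 2 * s₂ x * (√(gradSq u x) + (k * T + n / L) * |u x|) :=
    fun hu hs => (((LocBdd.const _).mul ((hE.pow 2).mul (hs₁b.pow 2))).add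
      ((((LocBdd.const 2).mul (hE.pow 2)).mul hs₂b).mul ((LocBdd.of_continuous (hG hu).sqrt).add
        ((LocBdd.const _).mul (LocBdd.of_continuous hu.continuous).abs)))).integrable
        (ρ := max ρ ρ') fun x hx => by
          rw [hs₁ρ x ((le_max_right _ _).trans_lt hx), hs x ((le_max_left _ _).trans_lt hx),
            hG0 _ hs x ((le_max_left _ _).trans_lt hx)]
          simp
  have iΩF : Integrable (Ω.indicator fun x => f₁ x ^ 2 + f₂ x ^ 2) :=
    (((h.locBdd₁.pow 2).add (h.locBdd₂.pow 2)).indicator hΩ).integrable (ρ := ρ') fun x hx =>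
      indicator_of_notMem (fun hx' => (hΩρ x hx').not_gt hx) _
  have iΩU : Integrable (Ω.indicator fun x => u₁ x ^ 2 + u₂ x ^ 2) :=
    (((b₁.pow 2).add (b₂.pow 2)).indicator hΩ).integrable (ρ := ρ') fun x hx =>
      indicator_of_notMem (fun hx' => (hΩρ x hx').not_gt hx) _
  set R : Eucl n → ℝ := fun x => (Ωᶜ.indicator F x + ε * U x) * (√(gradSq u₁ x + gradSq u₂ x) +
          (k * T + n / L) * U x) with hR
  have iR : Integrable R := ((((hF.indicator hΩ.compl).add ((LocBdd.const _).mul hU))).mul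
    ((LocBdd.of_continuous ((hG h.contDiff₁).add (hG h.contDiff₂)).sqrt).add
      ((LocBdd.const _).mul hU))).integrable (ρ := ρ) fun x hx => by
        have hUx : U x = 0 := by simp only [hUdef]; rw [h.supp₁ x hx, h.supp₂ x hx]; simp
        have hgx : √(gradSq u₁ x + gradSq u₂ x) = 0 := by
          rw [hG0 _ h.supp₁ x hx, hG0 _ h.supp₂ x hx]; simp
        simp only [hR]
        rw [hUx, hgx]; simp
  -- On `Ω` the weight is at least `exp(kφ₀)` and `g ≥ 1/(L + ρ')`. For the upper bound below the
  -- weight is replaced by its supremum `exp(kΦ)`.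
  have low : ∫ x, L ^ 2 * v₀ / (8 * (L + ρ') ^ 3) * Real.exp (k * φ₀) ^ 2 * k ^ 2 *
      Ω.indicator (fun x => u₁ x ^ 2 + u₂ x ^ 2) x ≤
      ∫ x, (L ^ 2 * gw L x ^ 3 * (k ^ 2 / 8 * v₀ * weighted k φ u₁ x ^ 2) +
        L ^ 2 * gw L x ^ 3 * (k ^ 2 / 8 * v₀ * weighted k φ u₂ x ^ 2)) := by
    refine integral_mono (iΩU.const_mul _) ((iA h.contDiff₁ h.supp₁).add (iA h.contDiff₂ h.supp₂))
      fun x => ?_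
    have hg := gw_pos hL x
    simp only
    by_cases hx : x ∈ Ω
    · rw [indicator_of_mem hx]
      have hg3 : ((L + ρ') ^ 3)⁻¹ ≤ gw L x ^ 3 := by
        rw [← inv_pow]
        have := inv_gw_le hL x
        have := hΩρ x hx
        gcongr
        rw [inv_le_comm₀ (by linarith) hg]
        linarith
      have hEx : Real.exp (k * φ₀) ≤ Real.exp (k * φ ‖x‖) := by
        have := hΩφ x hx
        gcongr
      simp only [weighted]
      calc L ^ 2 * v₀ / (8 * (L + ρ') ^ 3) * Real.exp (k * φ₀) ^ 2 * k ^ 2 * (u₁ x ^ 2 + u₂ x ^ 2)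
          = L ^ 2 * ((L + ρ') ^ 3)⁻¹ * (k ^ 2 / 8 * v₀ * (Real.exp (k * φ₀) ^ 2 * (u₁ x ^ 2 + u₂ x ^ 2))) := by
            field_simp
        _ ≤ L ^ 2 * gw L x ^ 3 * (k ^ 2 / 8 * v₀ * (Real.exp (k * φ ‖x‖) ^ 2 * (u₁ x ^ 2 + u₂ x ^ 2))) := by
            gcongr
        _ = _ := by ring
    · rw [indicator_of_notMem hx, mul_zero]
      positivity
  have upp : ∫ x, ((sourceConst n L ρ' v₀ * (Real.exp (k * φ ‖x‖) ^ 2 * s₁ x ^ 2) +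
        2 * Real.exp (k * φ ‖x‖) ^ 2 * s₂ x * (√(gradSq u₁ x) + (k * T + n / L) * |u₁ x|)) +
      (sourceConst n L ρ' v₀ * (Real.exp (k * φ ‖x‖) ^ 2 * s₁ x ^ 2) +
        2 * Real.exp (k * φ ‖x‖) ^ 2 * s₂ x * (√(gradSq u₂ x) + (k * T + n / L) * |u₂ x|))) ≤
      ∫ x, (2 * sourceConst n L ρ' v₀ * v₁ ^ 2 * Real.exp (k * Φ) ^ 2 *
        Ω.indicator (fun x => f₁ x ^ 2 + f₂ x ^ 2) x + 4 * v₁ * Real.exp (k * Φ) ^ 2 * R x) := by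
    refine integral_mono ((iB h.contDiff₁ h.supp₁).add (iB h.contDiff₂ h.supp₂))
      ((iΩF.const_mul _).add (iR.const_mul _)) fun x => ?_
    have hEx : Real.exp (k * φ ‖x‖) ≤ Real.exp (k * Φ) := by
      have := hΦ ‖x‖ (norm_nonneg _)
      gcongr
    have hs1sq : s₁ x ^ 2 = v₁ ^ 2 * Ω.indicator (fun x => f₁ x ^ 2 + f₂ x ^ 2) x := by
      simp only [hs₁, mul_pow]
      congr 1
      by_cases hx : x ∈ Ω
      · rw [indicator_of_mem hx, indicator_of_mem hx]
        exact Real.sq_sqrt (by positivity)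
      · rw [indicator_of_notMem hx, indicator_of_notMem hx]; simp
    have hg1 : √(gradSq u₁ x) ≤ √(gradSq u₁ x + gradSq u₂ x) :=
      Real.sqrt_le_sqrt (by linarith [hG0' u₂ x])
    have hg2 : √(gradSq u₂ x) ≤ √(gradSq u₁ x + gradSq u₂ x) :=
      Real.sqrt_le_sqrt (by linarith [hG0' u₁ x])
    have hu1 : |u₁ x| ≤ U x := Real.abs_le_sqrt (by nlinarith)
    have hu2 : |u₂ x| ≤ U x := Real.abs_le_sqrt (by nlinarith)
    have hind : 0 ≤ Ω.indicator (fun x => f₁ x ^ 2 + f₂ x ^ 2) x :=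
      indicator_nonneg (fun y _ => by positivity) x
    have hs2 := hs₂0 x
    have hU0x := hU0 x
    have hm : 0 ≤ k * T + n / L := by positivity
    simp only
    rw [hs1sq]
    calc _ = 2 * sourceConst n L ρ' v₀ * v₁ ^ 2 * Real.exp (k * φ ‖x‖) ^ 2 *
            Ω.indicator (fun x => f₁ x ^ 2 + f₂ x ^ 2) x + 2 * Real.exp (k * φ ‖x‖) ^ 2 * s₂ x *
            ((√(gradSq u₁ x) + (k * T + n / L) * |u₁ x|) +
              (√(gradSq u₂ x) + (k * T + n / L) * |u₂ x|)) := by ring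
      _ ≤ 2 * sourceConst n L ρ' v₀ * v₁ ^ 2 * Real.exp (k * Φ) ^ 2 *
            Ω.indicator (fun x => f₁ x ^ 2 + f₂ x ^ 2) x + 2 * Real.exp (k * Φ) ^ 2 * s₂ x *
            ((√(gradSq u₁ x + gradSq u₂ x) + (k * T + n / L) * U x) +
              (√(gradSq u₁ x + gradSq u₂ x) + (k * T + n / L) * U x)) := by gcongr
      _ = _ := by simp only [hR, hs₂]; ring
  rw [integral_const_mul, integral_add (iA h.contDiff₁ h.supp₁) (iA h.contDiff₂ h.supp₂)] at low
  rw [integral_add (iB h.contDiff₁ h.supp₁) (iB h.contDiff₂ h.supp₂),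
    integral_add (iΩF.const_mul _) (iR.const_mul _), integral_const_mul, integral_const_mul] at upp
  linarith

end Helmholtz

/-! ### Removing the absorption terms -/

section HelmholtzEstimate

/-- The factor in front of the absorption terms. -/
def absorbConst (n : ℕ) (L T v₀ v₁ : ℝ) : ℝ := (1 + v₁ + T + n / L) * (v₁ / v₀) + 4 * v₁

lemma mul_le_add_sq {a b α : ℝ} (hα : 0 < α) : a * b ≤ α * b ^ 2 + a ^ 2 / (4 * α) := by
  have h : 0 ≤ α * (b - a / (2 * α)) ^ 2 := by positivity
  have e : α * (b - a / (2 * α)) ^ 2 = α * b ^ 2 - a * b + a ^ 2 / (4 * α) := by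
    field_simp; ring
  linarith

/-- Young's inequality with weights suited to later use: products with `F` get the small parameter
`η`, while in `εUH` the gradient `H` is counted like `kU`. -/
lemma cross_term_le {F U H ε k m η : ℝ} (hk : 0 < k) (hε : 0 ≤ ε) (hη : 0 < η) :
    (F + ε * U) * (H + m * U) ≤ η * H ^ 2 + η * U ^ 2 + (1 + m ^ 2) / (4 * η) * F ^ 2 +
      (ε * k + ε * m) * U ^ 2 + ε / k * H ^ 2 := by
  have h1 := mul_le_add_sq (a := F) (b := H) hη
  have h2 := mul_le_add_sq (a := m * F) (b := U) hη
  have h3 : U * H ≤ k * U ^ 2 + H ^ 2 / k := by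
    have := mul_le_add_sq (a := H) (b := U) hk
    have h4 : H ^ 2 / (4 * k) ≤ H ^ 2 / k := by
      gcongr; linarith
    linarith
  have h4 := mul_le_mul_of_nonneg_left h3 hε
  have e : (1 + m ^ 2) / (4 * η) * F ^ 2 = F ^ 2 / (4 * η) + (m * F) ^ 2 / (4 * η) := by
    field_simp
  have e2 : ε * (k * U ^ 2 + H ^ 2 / k) = ε * k * U ^ 2 + ε / k * H ^ 2 := by
    field_simp
  rw [e]
  linarith

/-- Both terms carrying `ε` reduce to `I = ∫|f||u|`: the first energy estimate bounds `εN₂`, and the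
second together with `ε ≤ 4k` bounds `(ε/k)H₂`. The constant is uniform down to `ε = 0`. -/
lemma absorption_bound {n : ℕ} {L T v₀ v₁ k ε η N₂ H₂ F₂ I X : ℝ} (hL : 0 < L) (hT : 0 ≤ T)
    (hv₀ : 0 < v₀) (hv₁ : 0 < v₁) (hk : 1 ≤ k) (hε : 0 ≤ ε) (hεk : ε ≤ 4 * k)
    (hI : 0 ≤ I) (h1 : ε * v₀ * N₂ ≤ v₁ * I) (h2 : H₂ ≤ v₁ * I + k ^ 2 * v₁ * N₂)
    (hX : X ≤ η * H₂ + η * N₂ + (1 + (k * T + n / L) ^ 2) / (4 * η) * F₂ +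
      (ε * k + ε * (k * T + n / L)) * N₂ + ε / k * H₂) :
    X ≤ η * H₂ + η * N₂ + (1 + (k * T + n / L) ^ 2) / (4 * η) * F₂ +
      absorbConst n L T v₀ v₁ * k * I := by
  have hk0 : 0 < k := by linarith
  have e1 : ε * N₂ ≤ v₁ / v₀ * I := by
    rw [div_mul_eq_mul_div, le_div_iff₀ hv₀]; linarith
  have hm : k + (k * T + n / L) ≤ k * (1 + T + n / L) := by
    have : (n : ℝ) / L * 1 ≤ n / L * k := by gcongr
    linarith
  have e2 : (ε * k + ε * (k * T + n / L)) * N₂ ≤ k * (1 + T + n / L) * (v₁ / v₀ * I) := by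
    calc (ε * k + ε * (k * T + n / L)) * N₂ = (k + (k * T + n / L)) * (ε * N₂) := by ring
      _ ≤ (k + (k * T + n / L)) * (v₁ / v₀ * I) := by gcongr
      _ ≤ _ := by gcongr
  have e3 : ε / k * H₂ ≤ 4 * v₁ * k * I + k * v₁ * (v₁ / v₀ * I) := by
    have h4 : ε / k ≤ 4 := by rw [div_le_iff₀ hk0]; exact hεk
    calc ε / k * H₂ ≤ ε / k * (v₁ * I + k ^ 2 * v₁ * N₂) := by gcongr
      _ = ε / k * (v₁ * I) + k * v₁ * (ε * N₂) := by field_simp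
      _ ≤ 4 * (v₁ * I) + k * v₁ * (v₁ / v₀ * I) := by gcongr
      _ ≤ 4 * (v₁ * I) * k + k * v₁ * (v₁ / v₀ * I) := by
          have : 0 ≤ 4 * (v₁ * I) := by positivity
          nlinarith
      _ = _ := by ring
  have e4 : absorbConst n L T v₀ v₁ * k * I = k * (1 + T + n / L) * (v₁ / v₀ * I) +
      (4 * v₁ * k * I + k * v₁ * (v₁ / v₀ * I)) := by rw [absorbConst]; ring
  linarith

/-- The constant multiplying the vanishing error. -/
def errorConst (n : ℕ) (L T v₀ v₁ k : ℝ) : ℝ :=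
  v₁ + k ^ 2 * v₁ + 2 + (k * T + n / L) ^ 2 + absorbConst n L T v₀ v₁ * k

/-- The term `kI` is split on `Ω` by Young's inequality. Half of the left side absorbs the part with
`|u|²`; the price is the factor `E⁴/E₀²` on the source, which is `E²` when the weight is constant on
`Ω`. -/
lemma combine_bound {n : ℕ} {L T v₀ v₁ k η N₂ H₂ F₂ F₁ Ft I X UW c C₁ E₀ E : ℝ} (hL : 0 < L)
    (hT : 0 ≤ T) (hv₀ : 0 < v₀) (hv₁ : 0 < v₁) (hk : 1 ≤ k) (hη : 0 < η) (hN : 0 ≤ N₂)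
    (hF₂ : 0 ≤ F₂) (hFt : 0 ≤ Ft) (hc : 0 < c) (hE₀ : 0 < E₀) (hE : 0 < E)
    (h2 : H₂ ≤ v₁ * I + k ^ 2 * v₁ * N₂) (hI : I ≤ Ft + N₂)
    (hI2 : ∀ α, 0 < α → I ≤ α * UW + F₁ / (4 * α) + η * N₂ + F₂ / (4 * η))
    (hX : X ≤ η * H₂ + η * N₂ + (1 + (k * T + n / L) ^ 2) / (4 * η) * F₂ +
      absorbConst n L T v₀ v₁ * k * I)
    (h : c * E₀ ^ 2 * k ^ 2 * UW ≤ 2 * C₁ * v₁ ^ 2 * E ^ 2 * F₁ + 4 * v₁ * E ^ 2 * X) :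
    c / 2 * E₀ ^ 2 * k ^ 2 * UW ≤ (2 * C₁ * v₁ ^ 2 * E ^ 2 +
      8 * v₁ ^ 2 * absorbConst n L T v₀ v₁ ^ 2 / c * (E ^ 4 / E₀ ^ 2)) * F₁ +
      4 * v₁ * E ^ 2 * errorConst n L T v₀ v₁ k * (η * (Ft + N₂) + F₂ / η) := by
  have hA : 0 < absorbConst n L T v₀ v₁ := by unfold absorbConst; positivity
  have hk0 : 0 < k := by linarith
  rw [errorConst]
  set A := absorbConst n L T v₀ v₁
  set m := k * T + n / L
  -- Chosen so that `4v₁E²·Akα = (c/2)E₀²k²`, exactly half of the left side.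
  set α := c * E₀ ^ 2 * k / (8 * v₁ * E ^ 2 * A) with hα
  have hI3 := hI2 α (by positivity)
  have e1 : η * H₂ ≤ η * ((v₁ + k ^ 2 * v₁) * (Ft + N₂)) := by
    gcongr
    have : 0 ≤ k ^ 2 * v₁ * Ft := by positivity
    have := mul_le_mul_of_nonneg_left hI hv₁.le
    linarith
  have e2 : η * N₂ ≤ η * (Ft + N₂) := by gcongr; linarith
  have e3 : (1 + m ^ 2) / (4 * η) * F₂ ≤ (1 + m ^ 2) * (F₂ / η) := by
    have : (1 + m ^ 2) / (4 * η) * F₂ = (1 + m ^ 2) * (F₂ / η) / 4 := by field_simp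
    have : 0 ≤ (1 + m ^ 2) * (F₂ / η) := by positivity
    linarith
  have e4 : F₂ / (4 * η) ≤ F₂ / η := by gcongr; linarith
  have p1 : 0 ≤ F₂ / η := by positivity
  have p2 : 0 ≤ η * (Ft + N₂) := by positivity
  set y := F₂ / η
  set z := η * (Ft + N₂)
  have e5 : A * k * I ≤ A * k * (α * UW + F₁ / (4 * α) + z + y) := by gcongr; linarith
  have e6 : X ≤ (v₁ + k ^ 2 * v₁ + 2 + m ^ 2 + A * k) * (z + y) + A * k * (α * UW) +
      A * k * (F₁ / (4 * α)) := by
    have q1 : 0 ≤ (v₁ + k ^ 2 * v₁) * y := by positivity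
    have q2 : 0 ≤ (1 + m ^ 2) * z := by positivity
    have q3 : η * ((v₁ + k ^ 2 * v₁) * (Ft + N₂)) = (v₁ + k ^ 2 * v₁) * z := by
      simp only [z]; ring
    linarith
  have e7 := mul_le_mul_of_nonneg_left e6 (by positivity : 0 ≤ 4 * v₁ * E ^ 2)
  have e8 : 4 * v₁ * E ^ 2 * (A * k * (α * UW)) = c / 2 * E₀ ^ 2 * k ^ 2 * UW := by
    rw [hα]; field_simp; ring
  have e9 : 4 * v₁ * E ^ 2 * (A * k * (F₁ / (4 * α))) =
      8 * v₁ ^ 2 * A ^ 2 / c * (E ^ 4 / E₀ ^ 2) * F₁ := by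
    rw [hα]; field_simp
  linarith

variable {n : ℕ} {M : ℝ → ℝ} {R₀ v₀ v₁ R₁ L T k δ ρ ρ' ε η φ₀ Φ : ℝ} {φ φ₁ φ₂ : ℝ → ℝ}
  {u₁ u₂ f₁ f₂ V : Eucl n → ℝ} {x : Eucl n} {i : Fin n} {Ω : Set (Eucl n)}

/-- The weighted resolvent estimate on test functions. The last term is an error that tends to
`0` when `f` concentrates on `Ω`. -/
theorem HelmholtzPair.estimate (h : HelmholtzPair V k ε ρ u₁ u₂ f₁ f₂)
    (hn : 3 ≤ n) (hL : 0 < L) (hM : Monotone M) (hδ : 0 < δ)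
    (hv₀ : 0 < v₀) (hk : 1 ≤ k) (hT : 0 ≤ T) (W : CarlemanWeight M R₀ v₀ v₁ R₁ L T k δ φ φ₁ φ₂)
    (hV : RayPotential M R₀ v₀ v₁ V) (hε : 0 ≤ ε) (hεk : ε ≤ 4 * k) (hΩ : MeasurableSet Ω)
    (hρ' : 0 ≤ ρ') (hΩρ : ∀ x ∈ Ω, ‖x‖ ≤ ρ') (hΩφ : ∀ x ∈ Ω, φ₀ ≤ φ ‖x‖) (hΦ : ∀ r, 0 ≤ r → φ r ≤ Φ)
    (hη : 0 < η) :
    L ^ 2 * v₀ / (8 * (L + ρ') ^ 3) / 2 * Real.exp (k * φ₀) ^ 2 * k ^ 2 *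
        (∫ x, Ω.indicator (fun x => u₁ x ^ 2 + u₂ x ^ 2) x) ≤
      (2 * sourceConst n L ρ' v₀ * v₁ ^ 2 * Real.exp (k * Φ) ^ 2 +
        8 * v₁ ^ 2 * absorbConst n L T v₀ v₁ ^ 2 / (L ^ 2 * v₀ / (8 * (L + ρ') ^ 3)) *
          (Real.exp (k * Φ) ^ 4 / Real.exp (k * φ₀) ^ 2)) *
        (∫ x, Ω.indicator (fun x => f₁ x ^ 2 + f₂ x ^ 2) x) +
      4 * v₁ * Real.exp (k * Φ) ^ 2 * errorConst n L T v₀ v₁ k *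
        (η * ((∫ x, (f₁ x ^ 2 + f₂ x ^ 2)) + ∫ x, (u₁ x ^ 2 + u₂ x ^ 2)) +
          (∫ x, Ωᶜ.indicator (fun x => f₁ x ^ 2 + f₂ x ^ 2) x) / η) := by
  have hv₁ : 0 < v₁ := hv₀.trans_le ((hV.lower 0).trans (hV.upper 0))
  have hcar := h.carleman hn hL hM hδ hv₀ hk hT W hV hε hΩ hρ' hΩρ hΩφ hΦ
  obtain ⟨hen1, hen2⟩ := h.energy hV hv₀ hε
  have b₁ := LocBdd.of_continuous h.contDiff₁.continuous
  have b₂ := LocBdd.of_continuous h.contDiff₂.continuous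
  have hG : ∀ {u : Eucl n → ℝ}, ContDiff ℝ 2 u → LocBdd (gradSq u) := fun hu =>
    LocBdd.gradSq (locBdd_pd hu)
  have hG0 : ∀ (u : Eucl n → ℝ), (∀ x, ρ < ‖x‖ → u x = 0) → ∀ x, ρ < ‖x‖ → gradSq u x = 0 :=
    fun u hs x hx => Finset.sum_eq_zero fun j _ => by rw [pd_eq_zero_of_outside hs hx]; simp
  have hG0' : ∀ (u : Eucl n → ℝ) x, 0 ≤ gradSq u x := fun u x => Finset.sum_nonneg fun j _ => sq_nonneg _
  have hfb := (h.locBdd₁.pow 2).add (h.locBdd₂.pow 2)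
  have hub := (b₁.pow 2).add (b₂.pow 2)
  have hf0 : ∀ x, ρ < ‖x‖ → f₁ x ^ 2 + f₂ x ^ 2 = 0 := fun x hx => by
    rw [h.suppf₁ x hx, h.suppf₂ x hx]; ring
  have hu0 : ∀ x, ρ < ‖x‖ → u₁ x ^ 2 + u₂ x ^ 2 = 0 := fun x hx => by
    rw [h.supp₁ x hx, h.supp₂ x hx]; ring
  have iF := hfb.integrable hf0
  have iU := hub.integrable hu0
  have iFΩ := iF.indicator hΩ
  have iFΩc := iF.indicator hΩ.compl
  have iUΩ := iU.indicator hΩ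
  have iH : Integrable fun x => gradSq u₁ x + gradSq u₂ x :=
    ((hG h.contDiff₁).add (hG h.contDiff₂)).integrable fun x hx => by
      rw [hG0 _ h.supp₁ x hx, hG0 _ h.supp₂ x hx, add_zero]
  set F : Eucl n → ℝ := fun x => √(f₁ x ^ 2 + f₂ x ^ 2) with hFdef
  set U : Eucl n → ℝ := fun x => √(u₁ x ^ 2 + u₂ x ^ 2) with hUdef
  have hF2 : ∀ x, F x ^ 2 = f₁ x ^ 2 + f₂ x ^ 2 := fun x => Real.sq_sqrt (by positivity)
  have hU2 : ∀ x, U x ^ 2 = u₁ x ^ 2 + u₂ x ^ 2 := fun x => Real.sq_sqrt (by positivity)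
  have hF := h.locBdd₁.sqrt h.locBdd₂
  have hU := b₁.sqrt b₂
  have hUz : ∀ x, ρ < ‖x‖ → U x = 0 := fun x hx => by simp only [hUdef]; rw [hu0 x hx, Real.sqrt_zero]
  have iFU : Integrable fun x => F x * U x := (hF.mul hU).integrable fun x hx => by
    change F x * U x = 0
    rw [hUz x hx, mul_zero]
  have hcF : ∀ x, Ωᶜ.indicator F x ^ 2 = Ωᶜ.indicator (fun x => f₁ x ^ 2 + f₂ x ^ 2) x := fun x => by
    by_cases hx : x ∈ Ωᶜ
    · rw [indicator_of_mem hx, indicator_of_mem hx, hF2]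
    · rw [indicator_of_notMem hx, indicator_of_notMem hx]; simp
  have iX : Integrable fun x => (Ωᶜ.indicator F x + ε * U x) * (√(gradSq u₁ x + gradSq u₂ x) +
      (k * T + n / L) * U x) := by
    have hGs : LocBdd fun x => √(gradSq u₁ x + gradSq u₂ x) := by
      have hc : ∀ {u : Eucl n → ℝ}, ContDiff ℝ 2 u → Continuous (gradSq u) := fun hu =>
        continuous_finsetSum _ fun i _ => ((hu.pd (m := 1) (by norm_num) i).continuous).pow 2
      exact .of_continuous ((hc h.contDiff₁).add (hc h.contDiff₂)).sqrt
    refine (((hF.indicator hΩ.compl).add ((LocBdd.const _).mul hU)).mul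
      (hGs.add ((LocBdd.const _).mul hU))).integrable (ρ := ρ) fun x hx => ?_
    rw [hUz x hx, hG0 _ h.supp₁ x hx, hG0 _ h.supp₂ x hx]
    simp
  have hX : ∫ x, (Ωᶜ.indicator F x + ε * U x) * (√(gradSq u₁ x + gradSq u₂ x) +
      (k * T + n / L) * U x) ≤
      η * (∫ x, (gradSq u₁ x + gradSq u₂ x)) + η * (∫ x, (u₁ x ^ 2 + u₂ x ^ 2)) +
        (1 + (k * T + n / L) ^ 2) / (4 * η) *
          (∫ x, Ωᶜ.indicator (fun x => f₁ x ^ 2 + f₂ x ^ 2) x) +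
        (ε * k + ε * (k * T + n / L)) * (∫ x, (u₁ x ^ 2 + u₂ x ^ 2)) +
        ε / k * ∫ x, (gradSq u₁ x + gradSq u₂ x) := by
    have i1 := iH.const_mul η
    have i2 := iU.const_mul η
    have i3 := iFΩc.const_mul ((1 + (k * T + n / L) ^ 2) / (4 * η))
    have i4 := iU.const_mul (ε * k + ε * (k * T + n / L))
    have i5 := iH.const_mul (ε / k)
    rw [← integral_const_mul, ← integral_const_mul, ← integral_const_mul, ← integral_const_mul,
      ← integral_const_mul, ← integral_add i1 i2, ← integral_add (i1.fun_add i2) i3,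
      ← integral_add ((i1.fun_add i2).fun_add i3) i4,
      ← integral_add (((i1.fun_add i2).fun_add i3).fun_add i4) i5]
    refine integral_mono iX ((((i1.fun_add i2).fun_add i3).fun_add i4).fun_add i5) fun x => ?_
    have := cross_term_le (F := Ωᶜ.indicator F x) (U := U x) (H := √(gradSq u₁ x + gradSq u₂ x))
      (m := k * T + n / L) (by linarith : 0 < k) hε hη
    rwa [hcF, hU2, Real.sq_sqrt (add_nonneg (hG0' _ _) (hG0' _ _))] at this
  have hI : ∫ x, F x * U x ≤ (∫ x, (f₁ x ^ 2 + f₂ x ^ 2)) + ∫ x, (u₁ x ^ 2 + u₂ x ^ 2) := by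
    rw [← integral_add iF iU]
    refine integral_mono iFU (iF.add iU) fun x => ?_
    simp only
    rw [← hF2, ← hU2]
    nlinarith [sq_nonneg (F x - U x), sq_nonneg (F x), sq_nonneg (U x)]
  -- Young's inequality with parameter `α` on `Ω` and `η` off `Ω`.
  have hI2 : ∀ α, 0 < α → ∫ x, F x * U x ≤
      α * (∫ x, Ω.indicator (fun x => u₁ x ^ 2 + u₂ x ^ 2) x) +
        (∫ x, Ω.indicator (fun x => f₁ x ^ 2 + f₂ x ^ 2) x) / (4 * α) +
        η * (∫ x, (u₁ x ^ 2 + u₂ x ^ 2)) +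
        (∫ x, Ωᶜ.indicator (fun x => f₁ x ^ 2 + f₂ x ^ 2) x) / (4 * η) := by
    intro α hα
    have i1 := iUΩ.const_mul α
    have i2 := iFΩ.div_const (4 * α)
    have i3 := iU.const_mul η
    have i4 := iFΩc.div_const (4 * η)
    rw [← integral_const_mul, ← integral_const_mul, ← integral_div, ← integral_div,
      ← integral_add i1 i2, ← integral_add (i1.fun_add i2) i3,
      ← integral_add ((i1.fun_add i2).fun_add i3) i4]
    refine integral_mono iFU (((i1.fun_add i2).fun_add i3).fun_add i4) fun x => ?_
    simp only
    by_cases hx : x ∈ Ω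
    · have hx' : x ∉ Ωᶜ := fun h => h hx
      rw [indicator_of_mem hx, indicator_of_mem hx, indicator_of_notMem hx', ← hF2, ← hU2, zero_div]
      have := mul_le_add_sq (a := F x) (b := U x) hα
      have : 0 ≤ η * U x ^ 2 := by positivity
      linarith
    · have hx' : x ∈ Ωᶜ := hx
      rw [indicator_of_notMem hx, indicator_of_notMem hx, indicator_of_mem hx', ← hF2, ← hU2, zero_div,
        mul_zero]
      have := mul_le_add_sq (a := F x) (b := U x) hη
      linarith
  have hI0 : 0 ≤ ∫ x, F x * U x := integral_nonneg fun x =>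
    mul_nonneg (Real.sqrt_nonneg _) (Real.sqrt_nonneg _)
  have hN0 : 0 ≤ ∫ x, (u₁ x ^ 2 + u₂ x ^ 2) := integral_nonneg fun x => by positivity
  refine combine_bound hL hT hv₀ hv₁ hk hη hN0
    (integral_nonneg fun x => indicator_nonneg (fun y _ => by positivity) x)
    (integral_nonneg fun x => by positivity) (by positivity) (Real.exp_pos _) (Real.exp_pos _)
    hen2 hI hI2 (absorption_bound hL hT hv₀ hv₁ hk hε hεk hI0 hen1 hen2 hX) hcar

end HelmholtzEstimate

/-! ### The hypothesis on the radial derivative in terms of test functions -/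

section RadialDerivative

variable {n : ℕ}

/-- Integrating a nonnegative function against a signed measure that lies below a measure. -/
lemma integral_le_of_signedLE {ν : SignedMeasure (Eucl n)} {m : Measure (Eucl n)} (h : SignedLE ν m)
    {f : Eucl n → ℝ} (hf : Measurable f) (hf0 : ∀ x, 0 ≤ f x) {C : ℝ} (hC : ∀ x, f x ≤ C)
    {I : ℝ} (hI : ∫⁻ x, ENNReal.ofReal (f x) ∂m ≤ ENNReal.ofReal I) (hI0 : 0 ≤ I) :
    ∫ᵛ x, f x ∂<•ν ≤ I := by
  obtain ⟨P, hP, hP0, hP1, hpos, -⟩ := ν.toJordanDecomposition_spec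
  set j := ν.toJordanDecomposition with hj
  have hb : ∀ x, ‖f x‖ ≤ C := fun x => by rw [Real.norm_of_nonneg (hf0 x)]; exact hC x
  have hi : ∀ (p : Measure (Eucl n)) [IsFiniteMeasure p], Integrable f p := fun p _ =>
    Integrable.of_bound hf.aestronglyMeasurable C (Filter.Eventually.of_forall hb)
  have e1 : ∫ᵛ x, f x ∂<•ν = ∫ x, f x ∂j.posPart - ∫ x, f x ∂j.negPart := by
    conv_lhs => rw [← ν.toSignedMeasure_toJordanDecomposition]
    rw [JordanDecomposition.toSignedMeasure, VectorMeasure.integral_sub_vectorMeasure,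
      VectorMeasure.integral_toSignedMeasure, VectorMeasure.integral_toSignedMeasure]
    · rw [VectorMeasure.Integrable, Measure.variation_toSignedMeasure]; exact hi _
    · rw [VectorMeasure.Integrable, Measure.variation_toSignedMeasure]; exact hi _
  -- On a Hahn set `P` the positive part is `ν` itself, so `ν⁺(A) = ν(P ∩ A) ≤ m(A)`.
  have hle : j.posPart ≤ m := by
    refine Measure.le_iff.2 fun A hA => ?_
    rw [hpos, SignedMeasure.toMeasureOfZeroLE_apply _ hP0 hP hA]
    have h1 := h (P ∩ A) (hP.inter hA)
    refine le_trans ?_ (h1.trans (measure_mono inter_subset_right))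
    rw [ENNReal.ofReal, Real.toNNReal_of_nonneg (VectorMeasure.nonneg_of_zero_le_restrict ν
      (VectorMeasure.zero_le_restrict_subset ν hP inter_subset_left hP0))]
  have h2 : 0 ≤ ∫ x, f x ∂j.negPart := integral_nonneg hf0
  have h3 : ∫ x, f x ∂j.posPart ≤ I := by
    rw [integral_eq_lintegral_of_nonneg_ae (Filter.Eventually.of_forall hf0) hf.aestronglyMeasurable]
    refine ENNReal.toReal_le_of_le_ofReal hI0 ((lintegral_mono' hle le_rfl).trans hI)
  linarith

/-- Insert `g(r) = -∫_r^∞ g'` and exchange the integrals. -/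
lemma integral_eq_neg_integral_measureReal_Iio (m : Measure ℝ) [IsFiniteMeasure m] {g : ℝ → ℝ}
    (hg : ContDiff ℝ 1 g) (hgs : HasCompactSupport g) :
    ∫ r, g r ∂m = -∫ r, m.real (Iio r) * deriv g r := by
  have hd : Integrable (deriv g) :=
    (hg.continuous_deriv le_rfl).integrable_of_hasCompactSupport hgs.deriv
  set S : Set (ℝ × ℝ) := {p | p.1 < p.2} with hS
  have hSm : MeasurableSet S := measurableSet_lt measurable_fst measurable_snd
  have hprod : Integrable (S.indicator fun p : ℝ × ℝ => deriv g p.2) (m.prod volume) := by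
    refine Integrable.indicator ?_ hSm
    simpa using (integrable_const (1 : ℝ)).mul_prod (μ := m) hd
  have e1 : ∀ r, g r = -∫ s, S.indicator (fun p : ℝ × ℝ => deriv g p.2) (r, s) := fun r => by
    have h1 := hgs.integral_Ioi_deriv_eq hg r
    have h2 : ∀ s, S.indicator (fun p : ℝ × ℝ => deriv g p.2) (r, s) =
        (Ioi r).indicator (deriv g) s := fun s => rfl
    simp_rw [h2]
    rw [integral_indicator measurableSet_Ioi, h1, neg_neg]
  calc ∫ r, g r ∂m = ∫ r, (-∫ s, S.indicator (fun p : ℝ × ℝ => deriv g p.2) (r, s)) ∂m :=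
        integral_congr_ae (Filter.Eventually.of_forall e1)
    _ = -∫ s, (∫ r, S.indicator (fun p : ℝ × ℝ => deriv g p.2) (r, s) ∂m) := by
        rw [integral_neg, integral_integral_swap
          (f := fun r s => S.indicator (fun p : ℝ × ℝ => deriv g p.2) (r, s)) hprod]
    _ = _ := by
        congr 1
        refine integral_congr_ae (Filter.Eventually.of_forall fun s => ?_)
        have h2 : ∀ r, S.indicator (fun p : ℝ × ℝ => deriv g p.2) (r, s) =
          (Iio s).indicator (fun _ => deriv g s) r := fun r => rfl
        simp_rw [h2]
        rw [integral_indicator measurableSet_Iio]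
        simp

/-- Nonnegative smooth functions supported in a compact subset of `ℝⁿ ∖ {0}`. -/
structure PuncturedTest (φ : Eucl n → ℝ) : Prop where
  contDiff : ContDiff ℝ ∞ φ
  nonneg : ∀ x, 0 ≤ φ x
  inner : ∃ r, 0 < r ∧ ∀ x, ‖x‖ < r → φ x = 0
  outer : ∃ ρ, ∀ x, ρ < ‖x‖ → φ x = 0

/-- The mass that `μ` gives to `(0, r)`. -/
def massBelow (μ : Measure ℝ) (r : ℝ) : ℝ := (μ.restrict (Ioi 0)).real (Iio r)

lemma massBelow_mono (μ : Measure ℝ) [IsFiniteMeasure μ] : Monotone (massBelow μ) :=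
  fun _ _ h => measureReal_mono (Iio_subset_Iio h)

lemma massBelow_nonneg (μ : Measure ℝ) (r : ℝ) : 0 ≤ massBelow μ r := measureReal_nonneg

lemma massBelow_le (μ : Measure ℝ) [IsFiniteMeasure μ] (r : ℝ) : massBelow μ r ≤ μ.real univ := by
  unfold massBelow
  refine (measureReal_mono (subset_univ _)).trans ?_
  rw [measureReal_restrict_apply MeasurableSet.univ]
  exact measureReal_mono (subset_univ _)

variable {φ : Eucl n → ℝ} {μ : Measure ℝ}

/-- The divergence of `φ(x) x`. -/
def divEuler (φ : Eucl n → ℝ) (x : Eucl n) : ℝ := n * φ x + fderiv ℝ φ x x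

lemma continuous_divEuler (hφ : ContDiff ℝ ∞ φ) : Continuous (divEuler φ) := by
  have h1 := hφ.continuous
  have h2 : Continuous fun x => fderiv ℝ φ x x :=
    (hφ.continuous_fderiv (by simp)).clm_apply continuous_id
  unfold divEuler
  fun_prop

lemma divEuler_eq_zero {ρ : ℝ} (h : ∀ x, ρ < ‖x‖ → φ x = 0) {x : Eucl n} (hx : ρ < ‖x‖) :
    divEuler φ x = 0 := by
  have : φ =ᶠ[nhds x] fun _ => 0 := by
    filter_upwards [(continuous_norm.continuousAt (x := x)).eventually (lt_mem_nhds hx)] with y hy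
    exact h y hy
  rw [divEuler, h x hx, this.fderiv_eq]
  simp

lemma PuncturedTest.locBdd (h : PuncturedTest φ) : LocBdd φ := .of_continuous h.contDiff.continuous

lemma PuncturedTest.hasDerivAt_ray (h : PuncturedTest φ) (hn : 1 ≤ n) (θ : Eucl n) (r : ℝ) :
    HasDerivAt (fun r : ℝ => r ^ n * φ (r • θ)) (r ^ (n - 1) * divEuler φ (r • θ)) r := by
  have h1 : HasDerivAt (fun s : ℝ => φ (s • θ)) (fderiv ℝ φ (r • θ) θ) r := by
    have h2 : HasDerivAt (fun s : ℝ => s • θ) θ r := by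
      simpa using (hasDerivAt_id r).smul_const θ
    exact (h.contDiff.differentiable (by simp) _).hasFDerivAt.comp_hasDerivAt r h2
  refine ((hasDerivAt_pow n r).fun_mul h1).congr_deriv ?_
  have hpow : r ^ n = r ^ (n - 1) * r := by rw [← pow_succ]; congr 1; omega
  rw [divEuler, map_smul, smul_eq_mul, hpow]
  ring

/-- In polar coordinates the integrand becomes `rⁿ φ(rθ)`, whose derivative is `r^(n-1)` times
`divEuler φ`. Integration by parts against `μ` on each ray replaces `μ` by its distribution
function. -/
lemma PuncturedTest.lintegral_radialMeasure_le (h : PuncturedTest φ) (hn : 1 ≤ n)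
    [IsFiniteMeasure μ] :
    0 ≤ -∫ x, massBelow μ ‖x‖ * divEuler φ x ∧
    ∫⁻ x, ENNReal.ofReal (‖x‖ * φ x) ∂(radialMeasure n μ) =
      ENNReal.ofReal (-∫ x, massBelow μ ‖x‖ * divEuler φ x) := by
  have : NeZero n := ⟨by omega⟩
  obtain ⟨ρ, hρ⟩ := h.outer
  have hc := h.contDiff.continuous
  have hM : Measurable (massBelow μ) := (massBelow_mono μ).measurable
  set m := μ.restrict (Ioi 0) with hm
  set σ := (volume : Measure (Eucl n)).toSphere with hσ
  set G : Metric.sphere (0 : Eucl n) 1 × ℝ → ℝ := fun p => p.2 ^ n * φ (p.2 • (p.1 : Eucl n)) with hG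
  have hGc : Continuous G := by fun_prop
  have hnr : ∀ (θ : Metric.sphere (0 : Eucl n) 1) (r : ℝ), ‖r • (θ : Eucl n)‖ = |r| := fun θ r => by
    rw [norm_smul]; simp
  obtain ⟨C, hC⟩ := h.locBdd.exists_bound hρ
  have hGb : ∀ p, ‖G p‖ ≤ |ρ| ^ n * C := by
    intro p
    rw [hG, Real.norm_eq_abs, abs_mul, abs_pow]
    have hC0 : 0 ≤ C := (abs_nonneg _).trans (hC 0)
    by_cases hp : |p.2| ≤ |ρ|
    · have := hC (p.2 • (p.1 : Eucl n))
      gcongr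
    · rw [hρ _ (by rw [hnr]; exact (le_abs_self _).trans_lt (not_le.1 hp)), abs_zero, mul_zero]
      positivity
  have hGi : Integrable G (σ.prod m) :=
    Integrable.of_bound hGc.aestronglyMeasurable _ (Filter.Eventually.of_forall hGb)
  have hm0 : ∀ᵐ p ∂(σ.prod m), 0 < p.2 :=
    (Measure.quasiMeasurePreserving_snd (μ := σ) (ν := m)).ae
      (ae_restrict_mem measurableSet_Ioi : ∀ᵐ r ∂m, r ∈ Ioi (0 : ℝ))
  have hG0 : 0 ≤ᵐ[σ.prod m] G := by
    filter_upwards [hm0] with p hp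
    exact mul_nonneg (pow_nonneg hp.le _) (h.nonneg _)
  have e1 : ∫⁻ x, ENNReal.ofReal (‖x‖ * φ x) ∂(radialMeasure n μ) =
      ENNReal.ofReal (∫ p, G p ∂(σ.prod m)) := by
    rw [ofReal_integral_eq_lintegral_ofReal hGi hG0, radialMeasure, lintegral_map,
      prod_withDensity_right (by fun_prop), lintegral_withDensity_eq_lintegral_mul]
    · refine lintegral_congr_ae ?_
      filter_upwards [hm0] with p hp
      rw [Pi.mul_apply, ← ENNReal.ofReal_mul (pow_nonneg hp.le _), hnr, abs_of_pos hp, ← mul_assoc,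
        ← pow_succ, Nat.sub_add_cancel hn]
    · fun_prop
    · have : Continuous fun p : Metric.sphere (0 : Eucl n) 1 × ℝ =>
        ‖p.2 • (p.1 : Eucl n)‖ * φ (p.2 • (p.1 : Eucl n)) := by fun_prop
      exact this.measurable.ennreal_ofReal
    · exact (continuous_norm.mul hc).measurable.ennreal_ofReal
    · exact (by fun_prop : Continuous fun p : Metric.sphere (0 : Eucl n) 1 × ℝ =>
        p.2 • (p.1 : Eucl n)).measurable
  have hdb : LocBdd fun x => massBelow μ ‖x‖ * divEuler φ x := by
    refine LocBdd.mul (.of_bounded (C := μ.real univ) (hM.comp measurable_norm) fun x => ?_)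
      (.of_continuous (continuous_divEuler h.contDiff))
    rw [abs_of_nonneg (massBelow_nonneg _ _)]
    exact massBelow_le _ _
  have e2 : ∫ p, G p ∂(σ.prod m) = -∫ x, massBelow μ ‖x‖ * divEuler φ x := by
    rw [integral_prod _ hGi, integral_polar (hdb.integrable fun x hx => by
      rw [divEuler_eq_zero hρ hx, mul_zero]), ← integral_neg]
    refine integral_congr_ae (Filter.Eventually.of_forall fun θ => ?_)
    have hd : ∀ r, deriv (fun r : ℝ => r ^ n * φ (r • (θ : Eucl n))) r =
      r ^ (n - 1) * divEuler φ (r • (θ : Eucl n)) := fun r => (h.hasDerivAt_ray hn θ r).deriv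
    have hcd : ContDiff ℝ 1 fun r : ℝ => r ^ n * φ (r • (θ : Eucl n)) :=
      (contDiff_id.pow n).mul ((h.contDiff.of_le (by simp)).comp (by fun_prop))
    have hsup : HasCompactSupport fun r : ℝ => r ^ n * φ (r • (θ : Eucl n)) :=
      HasCompactSupport.intro (isCompact_Icc (a := -|ρ|) (b := |ρ|)) fun r hr => by
        rw [hρ, mul_zero]
        rw [hnr]
        by_contra h'
        exact hr (abs_le.1 ((not_lt.1 h').trans (le_abs_self ρ)))
    simp only [hG]
    rw [integral_eq_neg_integral_measureReal_Iio m hcd hsup]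
    congr 1
    simp_rw [hd]
    rw [← integral_indicator measurableSet_Ioi]
    refine integral_congr_ae (Filter.Eventually.of_forall fun r => ?_)
    by_cases hr : 0 < r
    · simp only
      rw [indicator_of_mem (by exact hr), hnr, abs_of_pos hr, massBelow]
      ring
    · simp only
      rw [indicator_of_notMem (by exact hr)]
      have : m.real (Iio r) = 0 := by
        rw [hm, measureReal_restrict_apply measurableSet_Iio]
        have : Iio r ∩ Ioi 0 = ∅ := by
          ext s; simp only [mem_inter_iff, mem_Iio, mem_Ioi, mem_empty_iff_false, iff_false]
          intro hs; linarith [hs.1, hs.2]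
        rw [this]; simp
      rw [this, zero_mul]
  rw [e1, e2]
  exact ⟨by rw [← e2]; exact integral_nonneg_of_ae hG0, rfl⟩

/-- The function `c - μ((0, |x|))` has nonpositive distributional radial derivative away from the
origin. -/
theorem PuncturedTest.integral_nonneg (h : PuncturedTest φ) (hn : 1 ≤ n) [IsFiniteMeasure μ]
    {c : Eucl n → ℝ} (hc : LocBdd c) {ν : SignedMeasure (Eucl n)} (hν : IsRadialDerivative c ν)
    (hνμ : SignedLE ν (radialMeasure n μ)) :
    0 ≤ ∫ x, (c x - massBelow μ ‖x‖) * divEuler φ x := by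
  obtain ⟨ρ, hρ⟩ := h.outer
  obtain ⟨r, hr, hφr⟩ := h.inner
  have hM : Measurable (massBelow μ) := (massBelow_mono μ).measurable
  have hz : ∀ x, ‖x‖ < r → φ =ᶠ[nhds x] fun _ => 0 := fun x hx => by
    filter_upwards [(continuous_norm.continuousAt (x := x)).eventually (gt_mem_nhds hx)] with y hy
    exact hφr y hy
  -- The hypothesis is tested with `|x| φ`, smooth because `φ` vanishes near the origin. The factor
  -- `|x|` turns the field `x/|x|` into the Euler field, whose flow consists of dilations.
  have hΦ : ContDiff ℝ ∞ fun x => ‖x‖ * φ x := by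
    rw [contDiff_iff_contDiffAt]
    intro x
    by_cases hx : x = 0
    · have : (fun x => ‖x‖ * φ x) =ᶠ[nhds x] fun _ => 0 := by
        filter_upwards [hz x (by rw [hx, norm_zero]; exact hr)] with y hy
        rw [hy, mul_zero]
      exact contDiffAt_const.congr_of_eventuallyEq this
    · exact (contDiffAt_norm ℝ hx).mul h.contDiff.contDiffAt
  have hΦs : HasCompactSupport fun x => ‖x‖ * φ x :=
    HasCompactSupport.intro (isCompact_closedBall 0 ρ) fun x hx => by
      rw [hρ x (by simpa using hx), mul_zero]
  have h1 := hν _ hΦ hΦs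
  have h2 : ∀ x, fderiv ℝ (fun x => ‖x‖ * φ x) x (‖x‖⁻¹ • x) + ((n : ℝ) - 1) / ‖x‖ * (‖x‖ * φ x) =
      divEuler φ x := by
    intro x
    by_cases hx : x = 0
    · have h0 := hφr 0 (by simpa using hr)
      simp [hx, divEuler, h0]
    · have hx0 : ‖x‖ ≠ 0 := norm_ne_zero_iff.2 hx
      have hdn : DifferentiableAt ℝ (fun y : Eucl n => ‖y‖) x := differentiableAt_norm' hx
      have hn1 : fderiv ℝ (fun y : Eucl n => ‖y‖) x x = ‖x‖ := by
        rw [fderiv_self_eq_sum]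
        simp_rw [pd_norm hx]
        have : ∀ i, x i * (x i / ‖x‖) = x i ^ 2 / ‖x‖ := fun i => by ring
        simp_rw [this]
        rw [← Finset.sum_div, sum_sq_coord]
        field_simp
      rw [fderiv_fun_mul hdn (h.contDiff.differentiable (by simp) x), divEuler]
      simp only [map_smul, add_apply, smul_apply, smul_eq_mul, hn1]
      field_simp
      ring
  simp_rw [h2] at h1
  obtain ⟨h3, h4⟩ := h.lintegral_radialMeasure_le hn (μ := μ)
  obtain ⟨C, hC⟩ := (LocBdd.of_continuous hΦ.continuous).exists_bound
    (ρ := ρ) fun x hx => by rw [hρ x hx, mul_zero]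
  have h5 := integral_le_of_signedLE hνμ hΦ.continuous.measurable
    (fun x => mul_nonneg (norm_nonneg x) (h.nonneg x)) (fun x => (le_abs_self _).trans (hC x)) h4.le h3
  rw [h1] at h5
  have hdv := LocBdd.of_continuous (continuous_divEuler h.contDiff)
  have hMb : LocBdd fun x : Eucl n => massBelow μ ‖x‖ :=
    .of_bounded (C := μ.real univ) (hM.comp measurable_norm) fun x => by
      rw [abs_of_nonneg (massBelow_nonneg _ _)]
      exact massBelow_le _ _
  simp_rw [sub_mul]
  rw [integral_sub ((hc.mul hdv).integrable fun x hx => by rw [divEuler_eq_zero hρ hx, mul_zero])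
    ((hMb.mul hdv).integrable fun x hx => by rw [divEuler_eq_zero hρ hx, mul_zero])]
  linarith

end RadialDerivative

/-! ### Monotonicity under dilations -/

section Dilation

variable {n : ℕ} {φ w : Eucl n → ℝ} {s : ℝ}

/-- The `L¹`-normalised dilation of `φ` by the factor `e^t`. -/
def dilate (t : ℝ) (φ : Eucl n → ℝ) (y : Eucl n) : ℝ := Real.exp (-t) ^ n * φ (Real.exp (-t) • y)

lemma PuncturedTest.dilate (h : PuncturedTest φ) (t : ℝ) : PuncturedTest (dilate t φ) where
  contDiff := contDiff_const.mul (h.contDiff.comp (contDiff_const_smul _))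
  nonneg x := mul_nonneg (by positivity) (h.nonneg _)
  inner := by
    obtain ⟨r, hr, h0⟩ := h.inner
    refine ⟨Real.exp t * r, by positivity, fun x hx => ?_⟩
    rw [_root_.dilate, h0, mul_zero]
    rw [norm_smul, Real.norm_of_nonneg (Real.exp_pos _).le, Real.exp_neg,
      inv_mul_lt_iff₀ (Real.exp_pos _)]
    exact hx
  outer := by
    obtain ⟨ρ, h0⟩ := h.outer
    refine ⟨Real.exp t * ρ, fun x hx => ?_⟩
    rw [_root_.dilate, h0, mul_zero]
    rw [norm_smul, Real.norm_of_nonneg (Real.exp_pos _).le, Real.exp_neg,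
      lt_inv_mul_iff₀ (Real.exp_pos _)]
    exact hx

lemma divEuler_dilate (hφ : ContDiff ℝ ∞ φ) (t : ℝ) (y : Eucl n) :
    divEuler (dilate t φ) y = Real.exp (-t) ^ n * divEuler φ (Real.exp (-t) • y) := by
  have hd : HasFDerivAt (fun y => φ (Real.exp (-t) • y))
      ((fderiv ℝ φ (Real.exp (-t) • y)).comp (Real.exp (-t) • ContinuousLinearMap.id ℝ (Eucl n))) y :=
    (hφ.differentiable (by simp) _).hasFDerivAt.comp (f := fun y : Eucl n => Real.exp (-t) • y) y
      ((hasFDerivAt_id y).fun_const_smul _)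
  have hd2 : fderiv ℝ (dilate t φ) y = _ := (hd.const_mul (Real.exp (-t) ^ n)).fderiv
  rw [divEuler, divEuler, hd2, dilate]
  simp only [smul_apply, ContinuousLinearMap.comp_apply, ContinuousLinearMap.id_apply, smul_eq_mul]
  ring

/-- With `divEuler_dilate` this is the transport equation `∂_t φ_t = -div(φ_t x)` for the dilated
functions. -/
lemma hasDerivAt_dilate (hn : 1 ≤ n) (hφ : ContDiff ℝ ∞ φ) (y : Eucl n) (t : ℝ) :
    HasDerivAt (fun t => dilate t φ y) (-(Real.exp (-t) ^ n * divEuler φ (Real.exp (-t) • y))) t := by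
  have he : HasDerivAt (fun t : ℝ => Real.exp (-t)) (-Real.exp (-t)) t := by
    simpa using (hasDerivAt_neg t).exp
  have h1 : HasDerivAt (fun t : ℝ => φ (Real.exp (-t) • y))
      (fderiv ℝ φ (Real.exp (-t) • y) (-Real.exp (-t) • y)) t :=
    (hφ.differentiable (by simp) _).hasFDerivAt.comp_hasDerivAt t (he.smul_const y)
  refine ((he.fun_pow n).fun_mul h1).congr_deriv ?_
  have hpow : Real.exp (-t) ^ n = Real.exp (-t) ^ (n - 1) * Real.exp (-t) := by
    rw [← pow_succ]; congr 1; omega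
  rw [divEuler, map_smul, map_smul, smul_eq_mul, smul_eq_mul, hpow]
  ring

/-- If the radial derivative of `w` is nonpositive then `w` decreases weakly under dilations. -/
lemma integral_comp_smul_le (hn : 1 ≤ n) {C : ℝ} (hw : Measurable w) (hwC : ∀ x, |w x| ≤ C)
    (hdiv : ∀ φ, PuncturedTest φ → 0 ≤ ∫ x, w x * divEuler φ x) (hs : 0 ≤ s)
    (h : PuncturedTest φ) : ∫ x, w (Real.exp s • x) * φ x ≤ ∫ x, w x * φ x := by
  obtain ⟨ρ, hρ⟩ := h.outer
  have hwb : LocBdd w := .of_bounded hw hwC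
  have hi : ∀ t, Integrable fun x => w x * dilate t φ x := fun t => by
    obtain ⟨ρ', hρ'⟩ := (h.dilate t).outer
    exact (hwb.mul (h.dilate t).locBdd).integrable fun x hx => by rw [hρ' x hx, mul_zero]
  have hdc := continuous_divEuler h.contDiff
  set H : Eucl n × ℝ → ℝ := fun p => w p.1 * (Real.exp (-p.2) ^ n * divEuler φ (Real.exp (-p.2) • p.1))
    with hH
  have hC0 : 0 ≤ C := (abs_nonneg _).trans (hwC 0)
  obtain ⟨C', hC'⟩ := (LocBdd.of_continuous hdc).exists_bound fun x hx => divEuler_eq_zero hρ hx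
  have hHi : Integrable H (volume.prod (volume.restrict (Ioc 0 s))) := by
    have h1 : Integrable (fun p : Eucl n × ℝ =>
        (Metric.closedBall (0 : Eucl n) (Real.exp s * ρ)).indicator (fun _ => C * C') p.1 * 1)
        (volume.prod (volume.restrict (Ioc 0 s))) := by
      refine Integrable.mul_prod ?_ (integrable_const (1 : ℝ))
      exact (integrable_indicator_iff measurableSet_closedBall).2
        (integrableOn_const measure_closedBall_lt_top.ne)
    refine h1.mono' ?_ ?_
    · refine ((hw.comp measurable_fst).mul ?_).aestronglyMeasurable
      exact (by fun_prop : Continuous fun p : Eucl n × ℝ =>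
        Real.exp (-p.2) ^ n * divEuler φ (Real.exp (-p.2) • p.1)).measurable
    · have h0 : ∀ᵐ p ∂((volume : Measure (Eucl n)).prod (volume.restrict (Ioc 0 s))), p.2 ∈ Ioc 0 s :=
        Measure.quasiMeasurePreserving_snd.ae (ae_restrict_mem measurableSet_Ioc)
      filter_upwards [h0] with p hp
      rw [mul_one]
      by_cases hx : p.1 ∈ Metric.closedBall (0 : Eucl n) (Real.exp s * ρ)
      · rw [indicator_of_mem hx, hH, Real.norm_eq_abs, abs_mul, abs_mul]
        have h2 : |Real.exp (-p.2) ^ n| ≤ 1 := by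
          rw [abs_of_nonneg (by positivity)]
          exact pow_le_one₀ (Real.exp_pos _).le (Real.exp_le_one_iff.2 (by linarith [hp.1]))
        calc |w p.1| * (|Real.exp (-p.2) ^ n| * |divEuler φ (Real.exp (-p.2) • p.1)|)
            ≤ C * (1 * C') := by
              have := hwC p.1
              have := hC' (Real.exp (-p.2) • p.1)
              gcongr
          _ = C * C' := by ring
      · rw [indicator_of_notMem hx, hH]
        simp only
        have hx' : Real.exp s * ρ < ‖p.1‖ := by simpa using hx
        have h3 : ρ < ‖Real.exp (-p.2) • p.1‖ := by
          rw [norm_smul, Real.norm_of_nonneg (Real.exp_pos _).le, Real.exp_neg,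
            lt_inv_mul_iff₀ (Real.exp_pos _)]
          by_cases hρ0 : 0 ≤ ρ
          · refine lt_of_le_of_lt ?_ hx'
            have := hp.2
            gcongr
          · have : 0 ≤ ‖p.1‖ := norm_nonneg _
            have h4 : Real.exp p.2 * ρ < 0 := mul_neg_of_pos_of_neg (Real.exp_pos _) (not_le.1 hρ0)
            linarith
        rw [divEuler_eq_zero hρ h3]; simp
  -- By the transport equation this integral is minus the time integral of `∫ w div(φ_t x)`, and
  -- each of these is nonnegative because dilates of punctured test functions are again such.
  have e1 : ∫ y, w y * (dilate s φ y - dilate 0 φ y) ≤ 0 := by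
    have h1 : ∀ y, w y * (dilate s φ y - dilate 0 φ y) = -∫ t in Ioc 0 s, H (y, t) := fun y => by
      have h2 := intervalIntegral.integral_eq_sub_of_hasDerivAt (a := 0) (b := s)
        (fun t _ => hasDerivAt_dilate hn h.contDiff y t)
        ((by fun_prop : Continuous fun t => -(Real.exp (-t) ^ n *
          divEuler φ (Real.exp (-t) • y))).intervalIntegrable 0 s)
      rw [← h2, intervalIntegral.integral_neg, intervalIntegral.integral_of_le hs, mul_neg,
        ← integral_const_mul]
    simp_rw [h1]
    rw [integral_neg, integral_integral_swap (f := fun y t => H (y, t)) hHi, neg_nonpos]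
    refine integral_nonneg fun t => ?_
    have h3 := hdiv _ (h.dilate t)
    simp_rw [divEuler_dilate h.contDiff] at h3
    exact h3
  simp_rw [mul_sub] at e1
  rw [integral_sub (hi s) (hi 0)] at e1
  have e2 : ∫ y, w y * dilate 0 φ y = ∫ y, w y * φ y := by simp [dilate]
  have e3 : ∫ x, w (Real.exp s • x) * φ x = ∫ y, w y * dilate s φ y := by
    have h1 := Measure.integral_comp_smul (volume : Measure (Eucl n))
      (fun y => w y * φ (Real.exp (-s) • y)) (Real.exp s)
    simp only [smul_smul, ← Real.exp_add, neg_add_cancel, Real.exp_zero, one_smul,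
      finrank_euclideanSpace, Fintype.card_fin] at h1
    rw [h1, abs_of_pos (by positivity), smul_eq_mul, ← integral_const_mul]
    congr 1; funext y
    rw [dilate, Real.exp_neg, inv_pow]
    ring
  linarith

/-- Test with normalised bumps centred at `x ≠ 0`. Once their radius is below `|x|/2` they avoid the
origin, and the integrals tend to `w x` at almost every `x`. -/
lemma ae_nonneg_of_integral_mul_nonneg {C : ℝ} (hw : Measurable w) (hwC : ∀ x, |w x| ≤ C)
    [NeZero n] (h : ∀ φ, PuncturedTest φ → 0 ≤ ∫ x, w x * φ x) : ∀ᵐ x, 0 ≤ w x := by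
  have hloc : LocallyIntegrable w volume :=
    (memLp_top_of_bound hw.aestronglyMeasurable C
      (Filter.Eventually.of_forall hwC)).locallyIntegrable le_top
  have hpos : ∀ i : ℕ, (0 : ℝ) < 1 / ((i : ℝ) + 1) := fun i => by positivity
  let b : ℕ → ContDiffBump (0 : Eucl n) := fun i =>
    ⟨1 / ((i : ℝ) + 1), 2 * (1 / ((i : ℝ) + 1)), hpos i, by linarith [hpos i]⟩
  have hb0 : Filter.Tendsto (fun i => (b i).rOut) Filter.atTop (nhds 0) := by
    simpa [b] using (tendsto_one_div_add_atTop_nhds_zero_nat (𝕜 := ℝ)).const_mul 2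
  have key := ContDiffBump.ae_convolution_tendsto_right_of_locallyIntegrable (φ := b) (K := 2)
    hb0 (Filter.Eventually.of_forall fun i => le_rfl) hloc
  have hne : ∀ᵐ x : Eucl n, x ≠ 0 := by simp [ae_iff]
  filter_upwards [key, hne] with x hx hx0
  refine ge_of_tendsto hx ?_
  have hr : 0 < ‖x‖ / 2 := by have := norm_pos_iff.2 hx0; positivity
  filter_upwards [hb0.eventually (gt_mem_nhds hr)] with i hi
  have hzero : ∀ y, (b i).rOut ≤ ‖x - y‖ → (b i).normed volume (x - y) = 0 := fun y hy => by
    have h1 : x - y ∉ Function.support ((b i).normed volume) := by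
      rw [ContDiffBump.support_normed_eq]
      simpa using hy
    simpa using h1
  have hp : PuncturedTest fun y => (b i).normed volume (x - y) := by
    refine ⟨(b i).contDiff_normed.comp (contDiff_const.sub contDiff_id), fun y =>
      (b i).nonneg_normed _, ⟨‖x‖ / 2, hr, fun y hy => hzero y ?_⟩, ⟨2 * ‖x‖, fun y hy => hzero y ?_⟩⟩
    · have := norm_sub_norm_le x y
      linarith
    · have := norm_sub_norm_le y x
      rw [norm_sub_rev] at this
      linarith
  have h2 := h _ hp
  rw [convolution_eq_swap]
  simpa [mul_comm] using h2

end Dilation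

/-! ### From almost everywhere to every ray -/

section RayAverage

variable {n : ℕ} {w : Eucl n → ℝ} {C ε : ℝ} {x : Eucl n}

/-- The average of `w` over the ball around `x` with radius `ε |x|`. -/
def coneAverage (ε : ℝ) (w : Eucl n → ℝ) (x : Eucl n) : ℝ :=
  ⨍ y in Metric.closedBall x (ε * ‖x‖), w y

lemma coneAverage_mem {a b : ℝ} (hε : 0 < ε) (hw : Measurable w) (hwC : ∀ x, |w x| ≤ C)
    (hx : x ≠ 0) (h : ∀ᵐ y, y ∈ Metric.closedBall x (ε * ‖x‖) → w y ∈ Icc a b) :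
    coneAverage ε w x ∈ Icc a b := by
  have hr : 0 < ε * ‖x‖ := mul_pos hε (norm_pos_iff.2 hx)
  refine (convex_Icc a b).set_average_mem isClosed_Icc
    (Metric.measure_closedBall_pos _ _ hr).ne' measure_closedBall_lt_top.ne ?_
    (Measure.integrableOn_of_bounded (M := C) measure_closedBall_lt_top.ne hw.aestronglyMeasurable
      (Filter.Eventually.of_forall hwC))
  exact (ae_restrict_iff' measurableSet_closedBall).2 h

lemma abs_coneAverage_le (hε : 0 < ε) (hw : Measurable w) (hwC : ∀ x, |w x| ≤ C) (hx : x ≠ 0) :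
    |coneAverage ε w x| ≤ C :=
  abs_le.2 (coneAverage_mem hε hw hwC hx
    (Filter.Eventually.of_forall fun y _ => abs_le.1 (hwC y)))

-- The radius of the averaging ball is proportional to `|x|`, so a dilation maps the ball at `x`
-- onto the ball at `t • x`. An almost everywhere inequality thus becomes one at every point.
open scoped Pointwise in
lemma coneAverage_smul_le [NeZero n] (hw : Measurable w) (hwC : ∀ x, |w x| ≤ C)
    {t : ℝ} (ht : 0 < t) (h : ∀ᵐ y, w (t • y) ≤ w y) (x : Eucl n) :
    coneAverage ε w (t • x) ≤ coneAverage ε w x := by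
  have e1 : Metric.closedBall (t • x) (ε * ‖t • x‖) = t • Metric.closedBall x (ε * ‖x‖) := by
    rw [_root_.smul_closedBall' ht.ne', norm_smul, Real.norm_of_nonneg ht.le]
    congr 1; ring
  have e2 : coneAverage ε w (t • x) = ⨍ y in Metric.closedBall x (ε * ‖x‖), w (t • y) := by
    rw [coneAverage, e1, setAverage_eq, setAverage_eq, Measure.setIntegral_comp_smul_of_pos _ _ _ ht,
      measureReal_def, Measure.addHaar_smul, abs_of_pos (by positivity), ENNReal.toReal_mul,
      ENNReal.toReal_ofReal (by positivity), measureReal_def, smul_eq_mul, smul_eq_mul, smul_eq_mul,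
      mul_inv]
    ring
  rw [e2, coneAverage, setAverage_eq, setAverage_eq]
  have hi : ∀ {v : Eucl n → ℝ}, Measurable v → (∀ x, |v x| ≤ C) →
      IntegrableOn v (Metric.closedBall x (ε * ‖x‖)) := fun hv hvC =>
    Measure.integrableOn_of_bounded (M := C) measure_closedBall_lt_top.ne hv.aestronglyMeasurable
      (Filter.Eventually.of_forall hvC)
  refine smul_le_smul_of_nonneg_left ?_ (inv_nonneg.2 measureReal_nonneg)
  exact integral_mono_ae (hi (hw.comp (measurable_const_smul t)) fun x => hwC _) (hi hw hwC)
    (ae_restrict_of_ae h)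

lemma measurable_coneAverage (hw : Measurable w) : Measurable (coneAverage ε w) := by
  set S : Set (Eucl n × Eucl n) := {p | dist p.2 p.1 ≤ ε * ‖p.1‖} with hS
  have hSm : MeasurableSet S := measurableSet_le (by fun_prop) (by fun_prop)
  have h1 : Measurable fun x : Eucl n => ∫ y, S.indicator (fun p => w p.2) (x, y) :=
    (StronglyMeasurable.integral_prod_right (f := fun x y => S.indicator (fun p => w p.2) (x, y))
      ((hw.comp measurable_snd).indicator hSm).stronglyMeasurable).measurable
  have h2 : Measurable fun x : Eucl n => ∫ y, S.indicator (fun _ => (1 : ℝ)) (x, y) :=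
    (StronglyMeasurable.integral_prod_right (f := fun x y => S.indicator (fun _ => (1 : ℝ)) (x, y))
      (measurable_const.indicator hSm).stronglyMeasurable).measurable
  have e : coneAverage ε w = fun x => (∫ y, S.indicator (fun _ => (1 : ℝ)) (x, y))⁻¹ *
      ∫ y, S.indicator (fun p => w p.2) (x, y) := by
    funext x
    have i1 : ∀ y, S.indicator (fun p => w p.2) (x, y) =
      (Metric.closedBall x (ε * ‖x‖)).indicator w y := fun y => rfl
    have i2 : ∀ y, S.indicator (fun _ => (1 : ℝ)) (x, y) =
      (Metric.closedBall x (ε * ‖x‖)).indicator (fun _ => 1) y := fun y => rfl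
    simp_rw [i1, i2]
    rw [integral_indicator measurableSet_closedBall, integral_indicator measurableSet_closedBall,
      coneAverage, setAverage_eq, smul_eq_mul]
    simp
  rw [e]
  exact h2.inv.mul h1

/-- A bounded function that decreases almost everywhere under each dilation agrees almost
everywhere with one that decreases along every ray. -/
def rayRepr (w : Eucl n → ℝ) (x : Eucl n) : ℝ :=
  Filter.limsup (fun j : ℕ => coneAverage (1 / ((j : ℝ) + 1)) w x) Filter.atTop

lemma measurable_rayRepr (hw : Measurable w) : Measurable (rayRepr w) :=
  Measurable.limsup fun _ => measurable_coneAverage hw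

/-- The null set in the hypothesis may depend on `t`, but averages do not see it. The upper limit is
used because it makes sense at every point and respects inequalities, whereas the limit is only
known to exist almost everywhere. -/
lemma rayRepr_smul_le [NeZero n] (hw : Measurable w) (hwC : ∀ x, |w x| ≤ C) {t : ℝ} (ht : 0 < t)
    (h : ∀ᵐ y, w (t • y) ≤ w y) (hx : x ≠ 0) : rayRepr w (t • x) ≤ rayRepr w x := by
  have hpos : ∀ j : ℕ, (0 : ℝ) < 1 / ((j : ℝ) + 1) := fun j => by positivity
  refine Filter.limsup_le_limsup
    (Filter.Eventually.of_forall fun j => coneAverage_smul_le hw hwC ht h x) ?_ ?_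
  · exact Filter.isCoboundedUnder_le_of_le _ (x := -C) fun j =>
      (abs_le.1 (abs_coneAverage_le (hpos j) hw hwC (smul_ne_zero ht.ne' hx))).1
  · exact Filter.isBoundedUnder_of ⟨C, fun j => (abs_le.1 (abs_coneAverage_le (hpos j) hw hwC hx)).2⟩

lemma rayRepr_ge (hw : Measurable w) (hwC : ∀ x, |w x| ≤ C) (hx : x ≠ 0) {a : ℝ}
    (h : ∀ᶠ y in nhds x, a ≤ w y) : a ≤ rayRepr w x := by
  have hpos : ∀ j : ℕ, (0 : ℝ) < 1 / ((j : ℝ) + 1) := fun j => by positivity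
  obtain ⟨r, hr, hra⟩ := Metric.eventually_nhds_iff.1 h
  have hlim : Filter.Tendsto (fun j : ℕ => 1 / ((j : ℝ) + 1) * ‖x‖) Filter.atTop (nhds 0) := by
    simpa using (tendsto_one_div_add_atTop_nhds_zero_nat (𝕜 := ℝ)).mul_const ‖x‖
  refine Filter.le_limsup_of_frequently_le (Filter.Eventually.frequently ?_)
    (Filter.isBoundedUnder_of ⟨C, fun j => (abs_le.1 (abs_coneAverage_le (hpos j) hw hwC hx)).2⟩)
  filter_upwards [hlim.eventually (gt_mem_nhds hr)] with j hj
  refine (coneAverage_mem (a := a) (b := C) (hpos j) hw hwC hx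
    (Filter.Eventually.of_forall fun y hy => ⟨hra ?_, (abs_le.1 (hwC y)).2⟩)).1
  exact (Metric.mem_closedBall.1 hy).trans_lt hj

lemma rayRepr_ae_eq [NeZero n] (hw : Measurable w) (hwC : ∀ x, |w x| ≤ C) :
    ∀ᵐ x, rayRepr w x = w x := by
  have hloc : LocallyIntegrable w volume :=
    (memLp_top_of_bound hw.aestronglyMeasurable C
      (Filter.Eventually.of_forall hwC)).locallyIntegrable le_top
  have hne : ∀ᵐ x : Eucl n, x ≠ 0 := by simp [ae_iff]
  filter_upwards [IsUnifLocDoublingMeasure.ae_tendsto_average (μ := (volume : Measure (Eucl n)))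
    hloc 1, hne] with x hx hx0
  have hr := norm_pos_iff.2 hx0
  have hlim : Filter.Tendsto (fun j : ℕ => 1 / ((j : ℝ) + 1) * ‖x‖) Filter.atTop (nhds 0) := by
    simpa using (tendsto_one_div_add_atTop_nhds_zero_nat (𝕜 := ℝ)).mul_const ‖x‖
  refine (hx (fun _ => x) (fun j : ℕ => 1 / ((j : ℝ) + 1) * ‖x‖) ?_ ?_).limsup_eq
  · exact tendsto_nhdsWithin_iff.2 ⟨hlim, Filter.Eventually.of_forall fun j => by
      have : 0 < 1 / ((j : ℝ) + 1) * ‖x‖ := by positivity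
      exact this⟩
  · exact Filter.Eventually.of_forall fun j => Metric.mem_closedBall_self (by positivity)

end RayAverage

/-! ### A good representative of the slowness -/

section Representative

variable {n : ℕ}

lemma ae_smul_le_of_divEuler (hn : 2 ≤ n) {w : Eucl n → ℝ} {A : ℝ} (hwm : Measurable w)
    (hwA : ∀ x, |w x| ≤ A) (hdiv : ∀ φ, PuncturedTest φ → 0 ≤ ∫ x, w x * divEuler φ x) {t : ℝ}
    (ht : 1 ≤ t) : ∀ᵐ x, w (t • x) ≤ w x := by
  have : NeZero n := ⟨by omega⟩
  have hdecr : ∀ s, 0 ≤ s → ∀ᵐ x, w (Real.exp s • x) ≤ w x := by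
    intro s hs
    have hws : Measurable fun x => w (Real.exp s • x) := hwm.comp (measurable_const_smul _)
    have h1 := ae_nonneg_of_integral_mul_nonneg (w := fun x => w x - w (Real.exp s • x)) (C := 2 * A)
      (hwm.sub hws) (fun x => by
        have := abs_sub (w x) (w (Real.exp s • x))
        linarith [hwA x, hwA (Real.exp s • x)]) fun φ hφ => by
        obtain ⟨ρ, hρ⟩ := hφ.outer
        have h2 := integral_comp_smul_le (by omega) hwm hwA
          hdiv hs hφ
        have i1 : Integrable fun x => w x * φ x :=
          ((LocBdd.of_bounded hwm hwA).mul hφ.locBdd).integrable fun x hx => by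
            rw [hρ x hx, mul_zero]
        have i2 : Integrable fun x => w (Real.exp s • x) * φ x :=
          ((LocBdd.of_bounded hws fun x => hwA _).mul hφ.locBdd).integrable fun x hx => by
            rw [hρ x hx, mul_zero]
        simp_rw [sub_mul]
        rw [integral_sub i1 i2]
        linarith
    filter_upwards [h1] with x hx
    linarith
  have := hdecr (Real.log t) (Real.log_nonneg ht)
  rwa [Real.exp_log (by linarith)] at this

lemma clamp_sub_clamp_le {c₀ C a b d : ℝ} (hd : 0 ≤ d) (hab : a - b ≤ d) :
    max c₀ (min C a) - max c₀ (min C b) ≤ d := by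
  have h1 : min C a ≤ min C b + d := by
    rw [← min_add_add_right]
    exact min_le_min (by linarith) (by linarith)
  have h2 : max c₀ (min C a) ≤ max c₀ (min C b) + d := by
    rw [← max_add_add_right]
    exact max_le_max (by linarith) h1
  linarith

/-- A bounded measurable speed can be modified on a null set so that its increase along rays is
controlled everywhere by the measure `μ`. -/
lemma exists_speed_repr (hn : 2 ≤ n) {μ : Measure ℝ} [IsFiniteMeasure μ] {c : Eucl n → ℝ}
    {c₀ c₁ C R : ℝ} (hc : Measurable c) (hc₀ : 0 < c₀) (hcm : ∀ x, c x ∈ Icc c₀ C) (hR : 0 < R)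
    (hcR : ∀ x, R ≤ ‖x‖ → c x = c₁) {ν : SignedMeasure (Eucl n)} (hν : IsRadialDerivative c ν)
    (hνμ : SignedLE ν (radialMeasure n μ)) :
    ∃ b : Eucl n → ℝ, Measurable b ∧ (∀ x, b x ∈ Icc c₀ C) ∧ (∀ x, R + 1 ≤ ‖x‖ → b x = c₁) ∧
      (∀ᵐ x, b x = c x) ∧ ∀ x, ∀ t : ℝ, 1 ≤ t → b (t • x) - b x ≤
        massBelow μ (min (t * ‖x‖) (R + 1)) - massBelow μ (min ‖x‖ (R + 1)) := by
  have : NeZero n := ⟨by omega⟩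
  have hMm := massBelow_mono μ
  set A : ℝ := C + μ.real univ with hA
  set w : Eucl n → ℝ := fun x => c x - massBelow μ ‖x‖ with hw
  have hwm : Measurable w := hc.sub (hMm.measurable.comp measurable_norm)
  have hC : 0 < C := hc₀.trans_le ((hcm 0).1.trans (hcm 0).2)
  have hwA : ∀ x, |w x| ≤ A := fun x => by
    have h1 := massBelow_le μ ‖x‖
    have h2 := massBelow_nonneg μ ‖x‖
    rw [hw, abs_le]
    constructor <;> simp only <;> linarith [(hcm x).1, (hcm x).2]
  have hcb : LocBdd c := .of_bounded (C := C) hc fun x => by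
    rw [abs_of_nonneg (hc₀.le.trans (hcm x).1)]; exact (hcm x).2
  have hdecr' : ∀ t : ℝ, 1 ≤ t → ∀ᵐ x, w (t • x) ≤ w x := fun t ht =>
    ae_smul_le_of_divEuler hn hwm hwA
      (fun ψ hψ => hψ.integral_nonneg (by omega) hcb hν hνμ) ht
  set r := rayRepr w with hr
  have hray : ∀ x, x ≠ 0 → ∀ t : ℝ, 1 ≤ t → r (t • x) ≤ r x := fun x hx t ht =>
    rayRepr_smul_le hwm hwA (by linarith) (hdecr' t ht) hx
  have hcR' : c₁ ∈ Icc c₀ C := by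
    have h1 : ‖EuclideanSpace.single (⟨0, by omega⟩ : Fin n) R‖ = R := by
      simp [abs_of_pos hR]
    rw [← hcR _ h1.ge]; exact hcm _
  -- inside the ball, the value at infinity is controlled
  have hbdry : ∀ x, x ≠ 0 → ‖x‖ < R + 1 → c₁ - massBelow μ (R + 1) ≤ r x := by
    have hann : ∀ y : Eucl n, R < ‖y‖ → ‖y‖ < R + 1 → c₁ - massBelow μ (R + 1) ≤ r y := by
      intro y hy1 hy2
      have hy0 : y ≠ 0 := norm_pos_iff.1 (hR.trans hy1)
      refine rayRepr_ge hwm hwA hy0 ?_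
      have hcn := continuous_norm.continuousAt (x := y)
      filter_upwards [hcn.eventually (lt_mem_nhds hy1), hcn.eventually (gt_mem_nhds hy2)] with z hz1 hz2
      rw [hw]
      simp only
      rw [hcR z hz1.le]
      linarith [hMm hz2.le]
    intro x hx hx1
    by_cases hxR : R < ‖x‖
    · exact hann x hxR hx1
    · have hx0 := norm_pos_iff.2 hx
      have ht : 1 ≤ (R + 1 / 2) / ‖x‖ := by rw [one_le_div hx0]; linarith
      have hn : ‖((R + 1 / 2) / ‖x‖) • x‖ = R + 1 / 2 := by
        rw [norm_smul, Real.norm_of_nonneg (by positivity)]; field_simp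
      exact (hann _ (by rw [hn]; linarith) (by rw [hn]; linarith)).trans (hray x hx _ ht)
  -- Clamping to `[c₀, C]` restores the bounds everywhere. Being monotone and 1-Lipschitz, it does
  -- not spoil the one-sided bound on increments.
  set p : Eucl n → ℝ := fun x => max c₀ (min C (r x + massBelow μ ‖x‖)) with hp
  -- The value `c₁` is imposed beyond `R + 1`. The jump at this sphere respects the bound on
  -- increments by `hbdry`, and `μ` is frozen there by the minimum with `R + 1`.
  refine ⟨fun x => if ‖x‖ < R + 1 then p x else c₁, ?_, ?_, ?_, ?_, ?_⟩
  · refine Measurable.ite (measurableSet_lt measurable_norm measurable_const) ?_ measurable_const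
    exact measurable_const.max (measurable_const.min
      ((measurable_rayRepr hwm).add (hMm.measurable.comp measurable_norm)))
  · intro x
    simp only
    split_ifs
    · exact ⟨le_max_left _ _, max_le ((hcm 0).1.trans (hcm 0).2) (min_le_left _ _)⟩
    · exact hcR'
  · intro x hx
    simp only [not_lt.2 hx, if_false]
  · filter_upwards [rayRepr_ae_eq hwm hwA] with x hx
    split_ifs with h
    · have e : r x + massBelow μ ‖x‖ = c x := by rw [hr, hx, hw]; simp
      simp only [hp, e]
      rw [min_eq_right (hcm x).2, max_eq_right (hcm x).1]
    · exact (hcR x (by linarith [not_lt.1 h])).symm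
  · intro x t ht
    have hle : ‖x‖ ≤ t * ‖x‖ := le_mul_of_one_le_left (norm_nonneg x) ht
    have hnt : ‖t • x‖ = t * ‖x‖ := by rw [norm_smul, Real.norm_of_nonneg (by linarith)]
    by_cases hx0 : x = 0
    · simp [hx0]
    simp only [hnt]
    by_cases h1 : t * ‖x‖ < R + 1
    · have h2 : ‖x‖ < R + 1 := hle.trans_lt h1
      rw [if_pos h1, if_pos h2, min_eq_left h1.le, min_eq_left h2.le]
      refine clamp_sub_clamp_le (by linarith [hMm hle]) ?_
      rw [hnt]
      linarith [hray x hx0 t ht]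
    · rw [if_neg h1, min_eq_right (not_lt.1 h1)]
      by_cases h2 : ‖x‖ < R + 1
      · rw [if_pos h2, min_eq_left h2.le]
        have h3 := clamp_sub_clamp_le (c₀ := c₀) (C := C) (a := c₁) (b := r x + massBelow μ ‖x‖)
          (d := massBelow μ (R + 1) - massBelow μ ‖x‖) (by linarith [hMm h2.le]) (by linarith [hbdry x hx0 h2])
        rwa [min_eq_right hcR'.2, max_eq_right hcR'.1] at h3
      · rw [if_neg h2, min_eq_right (not_lt.1 h2)]
        simp

/-- On `[c₀, ∞)` the map `s ↦ s⁻²` is decreasing with Lipschitz constant `2/c₀³`, so a bound on the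
increase of `c` becomes a bound on the decrease of `c⁻²`. -/
lemma inv_sq_sub_le {a b c₀ d : ℝ} (hc₀ : 0 < c₀) (ha : c₀ ≤ a) (hb : c₀ ≤ b) (hd : 0 ≤ d)
    (h : a - b ≤ d) : -(2 / c₀ ^ 3 * d) ≤ (a ^ 2)⁻¹ - (b ^ 2)⁻¹ := by
  have ha0 : 0 < a := hc₀.trans_le ha
  have hb0 : 0 < b := hc₀.trans_le hb
  rcases le_total a b with hab | hab
  · have : (b ^ 2)⁻¹ ≤ (a ^ 2)⁻¹ := by gcongr
    have : 0 ≤ 2 / c₀ ^ 3 * d := by positivity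
    linarith
  · have h1 : (b ^ 2)⁻¹ - (a ^ 2)⁻¹ = (a - b) * ((a * b ^ 2)⁻¹ + (a ^ 2 * b)⁻¹) := by
      field_simp; ring
    have h2 : (a * b ^ 2)⁻¹ ≤ (c₀ ^ 3)⁻¹ := by
      gcongr
      calc c₀ ^ 3 = c₀ * c₀ ^ 2 := by ring
        _ ≤ a * b ^ 2 := by gcongr
    have h3 : (a ^ 2 * b)⁻¹ ≤ (c₀ ^ 3)⁻¹ := by
      gcongr
      calc c₀ ^ 3 = c₀ ^ 2 * c₀ := by ring
        _ ≤ a ^ 2 * b := by gcongr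
    have h4 : (b ^ 2)⁻¹ - (a ^ 2)⁻¹ ≤ d * ((c₀ ^ 3)⁻¹ + (c₀ ^ 3)⁻¹) := by
      rw [h1]
      have : 0 ≤ a - b := by linarith
      gcongr
    have h5 : d * ((c₀ ^ 3)⁻¹ + (c₀ ^ 3)⁻¹) = 2 / c₀ ^ 3 * d := by field_simp; ring
    linarith

/-- The squared slowness `c⁻²` has a representative whose decrease along rays is controlled by a
bounded monotone function. -/
theorem exists_rayPotential (hn : 2 ≤ n) {c : Eucl n → ℝ} (hc : MemLp c ∞ volume)
    (hc_pos : ∃ c₀ : ℝ, 0 < c₀ ∧ ∀ᵐ x : Eucl n, c₀ ≤ c x)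
    (hc_const : ∃ (c₁ : ℝ) (S : Set (Eucl n)), IsCompact S ∧ ∀ᵐ x : Eucl n, x ∉ S → c x = c₁)
    {ν : SignedMeasure (Eucl n)} (hν : IsRadialDerivative c ν)
    {μ : Measure ℝ} [IsFiniteMeasure μ] (hνμ : SignedLE ν (radialMeasure n μ)) :
    ∃ (M : ℝ → ℝ) (R₀ v₀ v₁ m : ℝ) (V : Eucl n → ℝ), 0 < R₀ ∧ 0 < v₀ ∧ Monotone M ∧ (∀ r, 0 ≤ M r) ∧
      (∀ r, M r ≤ m) ∧ (∀ r, R₀ ≤ r → M r = M R₀) ∧ RayPotential M R₀ v₀ v₁ V ∧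
      ∀ᵐ x, 0 < c x ∧ V x = (c x ^ 2)⁻¹ := by
  have : NeZero n := ⟨by omega⟩
  obtain ⟨c₀, hc₀, hcc₀⟩ := hc_pos
  obtain ⟨c₁, S, hS, hcS⟩ := hc_const
  obtain ⟨R', hR'⟩ := hS.isBounded.subset_closedBall (0 : Eucl n)
  set R := max R' 0 + 1 with hR
  have hR0 : 0 < R := by have := le_max_right R' 0; linarith
  have hSR : ∀ x, R ≤ ‖x‖ → x ∉ S := fun x hx hxS => by
    have h1 := hR' hxS
    rw [mem_closedBall_zero_iff] at h1
    have := le_max_left R' 0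
    linarith
  obtain ⟨C, hC⟩ : ∃ C : ℝ, ∀ᵐ x, |c x| ≤ C := by
    refine ⟨(eLpNorm c ∞ volume).toReal, ?_⟩
    have h1 := ae_le_eLpNormEssSup (f := c) (μ := (volume : Measure (Eucl n)))
    filter_upwards [h1] with x hx
    rw [eLpNorm_exponent_top, ← Real.norm_eq_abs, ← toReal_enorm]
    refine ENNReal.toReal_mono ?_ hx
    rw [← eLpNorm_exponent_top]
    exact hc.2.ne
  set g := hc.1.mk c with hg
  have hgc : ∀ᵐ x, c x = g x := hc.1.ae_eq_mk
  have hgm : Measurable g := hc.1.stronglyMeasurable_mk.measurable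
  -- The exterior of the ball has positive measure, and there `c = c₁` almost everywhere.
  have hc₁ : c₁ ∈ Icc c₀ C := by
    have h1 : ∀ᵐ x : Eucl n, R < ‖x‖ → c₁ ∈ Icc c₀ C := by
      filter_upwards [hcc₀, hcS, hC] with x h1 h2 h3 h4
      rw [← h2 (hSR x h4.le)]
      exact ⟨h1, (le_abs_self _).trans h3⟩
    have hopen : IsOpen {x : Eucl n | R < ‖x‖} := isOpen_lt continuous_const continuous_norm
    have hne : {x : Eucl n | R < ‖x‖}.Nonempty :=
      ⟨EuclideanSpace.single (⟨0, by omega⟩ : Fin n) (R + 1), by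
        simp [abs_of_pos (by linarith : 0 < R + 1)]⟩
    have hpos := hopen.measure_pos volume hne
    by_contra hcon
    refine hpos.ne' (measure_mono_null (fun x hx => ?_) h1)
    simpa [hcon] using hx
  set b₀ : Eucl n → ℝ := fun x => if ‖x‖ < R then max c₀ (min C (g x)) else c₁ with hb₀
  have hb₀m : Measurable b₀ := Measurable.ite (measurableSet_lt measurable_norm measurable_const)
    (measurable_const.max (measurable_const.min hgm)) measurable_const
  have hb₀c : ∀ᵐ x, b₀ x = c x := by
    filter_upwards [hgc, hcc₀, hcS, hC] with x h1 h2 h3 h4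
    simp only [hb₀]
    split_ifs with h
    · rw [← h1, min_eq_right ((le_abs_self _).trans h4), max_eq_right h2]
    · exact (h3 (hSR x (not_lt.1 h))).symm
  have hν' : IsRadialDerivative b₀ ν := by
    intro φ hφ hφs
    rw [hν φ hφ hφs]
    congr 1
    refine integral_congr_ae ?_
    filter_upwards [hb₀c] with x hx
    rw [hx]
  obtain ⟨b, hbm, hbI, hbR, hbc, hb⟩ := exists_speed_repr hn hb₀m hc₀ (C := C) (c₁ := c₁) (fun x => by
      simp only [hb₀]
      split_ifs
      · exact ⟨le_max_left _ _, max_le (hc₁.1.trans hc₁.2) (min_le_left _ _)⟩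
      · exact hc₁) hR0 (fun x hx => by simp only [hb₀, not_lt.2 hx, if_false]) hν' hνμ
  have hMm := massBelow_mono μ
  have hC0 : 0 < C := hc₀.trans_le (hc₁.1.trans hc₁.2)
  have hΛ : 0 < 2 / c₀ ^ 3 := by positivity
  refine ⟨fun r => 2 / c₀ ^ 3 * massBelow μ (min r (R + 1)), R + 1, (C ^ 2)⁻¹, (c₀ ^ 2)⁻¹,
    2 / c₀ ^ 3 * μ.real univ, fun x => (b x ^ 2)⁻¹, by linarith, by positivity, ?_, ?_, ?_, ?_, ?_, ?_⟩
  · exact fun r s hrs => mul_le_mul_of_nonneg_left (hMm (min_le_min_right _ hrs)) hΛ.le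
  · exact fun r => mul_nonneg hΛ.le (massBelow_nonneg _ _)
  · exact fun r => mul_le_mul_of_nonneg_left (massBelow_le _ _) hΛ.le
  · intro r hr
    simp only [min_eq_right hr, min_self]
  · refine ⟨(hbm.pow_const 2).inv, fun x => ?_, fun x => ?_, ⟨(c₁ ^ 2)⁻¹, fun x hx => by rw [hbR x hx]⟩,
      fun x t ht => ?_⟩
    · have := (hbI x).2
      have := hc₀.trans_le (hbI x).1
      gcongr
    · have := (hbI x).1
      gcongr
    · have hle : ‖x‖ ≤ t * ‖x‖ := le_mul_of_one_le_left (norm_nonneg x) ht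
      have h1 := inv_sq_sub_le hc₀ (hbI (t • x)).1 (hbI x).1
        (by linarith [hMm (min_le_min_right (R + 1) hle)]) (hb x t ht)
      linarith
  · filter_upwards [hbc, hb₀c, hcc₀] with x h1 h2 h3
    exact ⟨hc₀.trans_le h3, by rw [h1, h2]⟩

end Representative

/-! ### Multiplication operators on `L²` -/

section Multiplication

variable {n : ℕ} {a : Eucl n → ℝ} {A : ℝ}

lemma memLp_top_of_bounded (ha : Measurable a) (hA : ∀ x, |a x| ≤ A) :
    MemLp (fun x => (a x : ℂ)) ∞ (volume : Measure (Eucl n)) :=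
  memLp_top_of_bound (Complex.measurable_ofReal.comp ha).aestronglyMeasurable A
    (ae_of_all _ fun x => by simpa using hA x)

/-- Multiplication by a bounded measurable real function, as an operator on `L²`. -/
def mulReal (a : Eucl n → ℝ) (ha : Measurable a) (hA : ∀ x, |a x| ≤ A) : L2 n →L[ℂ] L2 n :=
  mulL2 ((memLp_top_of_bounded ha hA).toLp _)

lemma coeFn_mulL2 (b : Lp ℂ ∞ (volume : Measure (Eucl n))) (f : L2 n) :
    mulL2 b f =ᵐ[volume] fun x => b x * f x := by
  have := Lp.coeFn_lpSMul (r := 2) b f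
  filter_upwards [this] with x hx
  exact hx

lemma coeFn_mulReal (ha : Measurable a) (hA : ∀ x, |a x| ≤ A) (f : L2 n) :
    mulReal a ha hA f =ᵐ[volume] fun x => (a x : ℂ) * f x := by
  filter_upwards [coeFn_mulL2 ((memLp_top_of_bounded ha hA).toLp _) f,
    (memLp_top_of_bounded ha hA).coeFn_toLp] with x h1 h2
  rw [mulReal, h1, h2]

lemma norm_mulReal_le (ha : Measurable a) (hA : ∀ x, |a x| ≤ A) (f : L2 n) :
    ‖mulReal a ha hA f‖ ≤ A * ‖f‖ := by
  refine Lp.norm_le_mul_norm_of_ae_le_mul ?_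
  filter_upwards [coeFn_mulReal ha hA f] with x hx
  rw [hx, norm_mul, Complex.norm_real, Real.norm_eq_abs]
  exact mul_le_mul_of_nonneg_right (hA x) (norm_nonneg _)

lemma inner_mulReal (ha : Measurable a) (hA : ∀ x, |a x| ≤ A) (f g : L2 n) :
    inner ℂ (mulReal a ha hA f) g = inner ℂ f (mulReal a ha hA g) := by
  rw [MeasureTheory.L2.inner_def, MeasureTheory.L2.inner_def]
  refine integral_congr_ae ?_
  filter_upwards [coeFn_mulReal ha hA f, coeFn_mulReal ha hA g] with x h1 h2
  rw [h1, h2]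
  simp only [RCLike.inner_apply, map_mul, Complex.conj_ofReal]
  ring

lemma inner_mulReal_self (ha : Measurable a) (hA : ∀ x, |a x| ≤ A) (f : L2 n) :
    inner ℂ f (mulReal a ha hA f) = ((∫ x, a x * ‖f x‖ ^ 2 : ℝ) : ℂ) := by
  rw [MeasureTheory.L2.inner_def, ← integral_complex_ofReal]
  refine integral_congr_ae ?_
  filter_upwards [coeFn_mulReal ha hA f] with x h1
  rw [h1]
  simp only [RCLike.inner_apply, Complex.ofReal_mul, Complex.ofReal_pow, ← Complex.mul_conj']
  ring

lemma norm_sq_eq_integral (f : L2 n) : ‖f‖ ^ 2 = ∫ x, ‖f x‖ ^ 2 := by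
  have h := inner_mulReal_self (a := fun _ => 1) (A := 1) measurable_const (fun _ => by simp) f
  have h1 : mulReal (fun _ => (1 : ℝ)) (A := 1) measurable_const (fun _ => by simp) f = f := by
    refine Lp.ext ?_
    filter_upwards [coeFn_mulReal (a := fun _ => 1) (A := 1) measurable_const (fun _ => by simp) f]
      with x hx
    rw [hx]; simp
  rw [h1, inner_self_eq_norm_sq_to_K] at h
  simp only [one_mul] at h
  exact Complex.ofReal_injective (by rw [← h]; push_cast; rfl)

lemma integrable_mul_norm_sq (ha : Measurable a) (hA : ∀ x, |a x| ≤ A) (f : L2 n) :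
    Integrable fun x => a x * ‖f x‖ ^ 2 :=
  ((Lp.memLp f).integrable_norm_pow two_ne_zero).bdd_mul ha.aestronglyMeasurable
    (ae_of_all _ fun x => by simpa using hA x)

lemma le_integral_mul_norm_sq (ha : Measurable a) (hA : ∀ x, |a x| ≤ A) {v : ℝ} (hv : ∀ x, v ≤ a x)
    (f : L2 n) : v * ‖f‖ ^ 2 ≤ ∫ x, a x * ‖f x‖ ^ 2 := by
  rw [norm_sq_eq_integral, ← integral_const_mul]
  refine integral_mono (((Lp.memLp f).integrable_norm_pow two_ne_zero).const_mul v)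
    (integrable_mul_norm_sq ha hA f) fun x => ?_
  exact mul_le_mul_of_nonneg_right (hv x) (by positivity)

end Multiplication

/-! ### Bessel potentials and the domain `H²` -/

section Bessel

variable (n : ℕ)

/-- The symbol `(1 + |ξ|²)^{-1/2}`. -/
def besselSymbol (x : Eucl n) : ℝ := (1 + ‖x‖ ^ 2) ^ ((-1 : ℝ) / 2)

lemma measurable_besselSymbol : Measurable (besselSymbol n) := by
  unfold besselSymbol; fun_prop

lemma abs_besselSymbol_le (x : Eucl n) : |besselSymbol n x| ≤ 1 := by
  rw [besselSymbol, abs_of_nonneg (by positivity)]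
  exact Real.rpow_le_one_of_one_le_of_nonpos (by nlinarith [sq_nonneg ‖x‖]) (by norm_num)

open FourierTransform in
/-- The Bessel potential of order one, as an operator on `L²`. -/
def besselOp : L2 n →L[ℂ] L2 n :=
  ((Lp.fourierTransformₗᵢ (Eucl n) ℂ).symm.toContinuousLinearEquiv : L2 n →L[ℂ] L2 n) ∘L
    mulReal (besselSymbol n) (measurable_besselSymbol n) (abs_besselSymbol_le n) ∘L
    ((Lp.fourierTransformₗᵢ (Eucl n) ℂ).toContinuousLinearEquiv : L2 n →L[ℂ] L2 n)

variable {n}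

open FourierTransform in
lemma besselOp_apply (f : L2 n) : besselOp n f =
    𝓕⁻ (mulReal (besselSymbol n) (measurable_besselSymbol n) (abs_besselSymbol_le n) (𝓕 f)) := rfl

open FourierTransform in
lemma besselOp_toTemperedDistribution (f : L2 n) :
    (besselOp n f : 𝓢'(Eucl n, ℂ)) = TemperedDistribution.besselPotential (Eucl n) ℂ (-1) f := by
  rw [besselOp_apply, ← Lp.fourierInv_toTemperedDistribution_eq, TemperedDistribution.besselPotential,
    TemperedDistribution.fourierMultiplierCLM_apply, Lp.fourier_toTemperedDistribution_eq]
  have h : (fun x : Eucl n => (((1 + ‖x‖ ^ 2) ^ ((-1 : ℝ) / 2) : ℝ) : ℂ)).HasTemperateGrowth := by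
    fun_prop
  exact congrArg 𝓕⁻ (Lp.toTemperedDistribution_smul_eq (r := 2) h
    (memLp_top_of_bounded (measurable_besselSymbol n) (abs_besselSymbol_le n)) (𝓕 f))

open FourierTransform in
lemma inner_besselOp (f g : L2 n) : inner ℂ (besselOp n f) g = inner ℂ f (besselOp n g) := by
  rw [← Lp.inner_fourier_eq (besselOp n f), ← Lp.inner_fourier_eq f, besselOp_apply, besselOp_apply,
    fourier_fourierInv_eq, fourier_fourierInv_eq, inner_mulReal]

lemma toTemperedDistribution_injective :
    Function.Injective fun f : L2 n => (f : 𝓢'(Eucl n, ℂ)) :=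
  LinearMap.ker_eq_bot.1 (Lp.ker_toTemperedDistributionCLM_eq_bot (F := ℂ) (p := 2)
    (μ := (volume : Measure (Eucl n))))

/-- The Fourier transform is normalised with `exp(-2πi x·ξ)`, so the symbol of the Laplacian is
`-(2π)²|ξ|²`. Hence the factor `(2π)⁻²` in front of it. -/
lemma besselPotential_two (u : 𝓢'(Eucl n, ℂ)) :
    TemperedDistribution.besselPotential (Eucl n) ℂ 2 u =
      u - (((2 * Real.pi) ^ 2)⁻¹ : ℝ) • Δ u := by
  rw [TemperedDistribution.laplacian_eq_fourierMultiplierCLM, smul_smul,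
    TemperedDistribution.besselPotential]
  have h1 : (fun x : Eucl n => (((1 + ‖x‖ ^ 2) ^ ((2 : ℝ) / 2) : ℝ) : ℂ)) =
      fun x => ∑ i ∈ Finset.univ, (![fun _ => (1 : ℂ), fun x => ((‖x‖ ^ 2 : ℝ) : ℂ)] i :
        Eucl n → ℂ) x := by
    ext x; simp
  rw [h1, TemperedDistribution.fourierMultiplierCLM_sum]
  · have : (2 * Real.pi) ^ 2 ≠ 0 := by positivity
    rw [mul_neg, inv_mul_cancel₀ this]
    simp
  · intro i _
    fin_cases i
    · simp only [Fin.zero_eta, Matrix.cons_val_zero]; fun_prop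
    · simp only [Fin.mk_one, Matrix.cons_val_one, Matrix.cons_val_fin_one]; fun_prop

/-- `Δ u = w` with `u ∈ H²` can be expressed by Bessel potentials. -/
lemma hasLaplacianL2_iff {u w : L2 n} : HasLaplacianL2 u w ↔
    u = besselOp n (besselOp n (u - (((2 * Real.pi) ^ 2)⁻¹ : ℝ) • w)) := by
  set κ : ℝ := ((2 * Real.pi) ^ 2)⁻¹ with hκ
  have hκ0 : κ ≠ 0 := by positivity
  have hcoe : ((u - κ • w : L2 n) : 𝓢'(Eucl n, ℂ)) = (u : 𝓢'(Eucl n, ℂ)) - κ • (w : 𝓢'(Eucl n, ℂ)) := by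
    have := (Lp.toTemperedDistributionCLM ℂ (volume : Measure (Eucl n)) 2).map_sub u ((κ : ℂ) • w)
    rw [map_smul] at this
    exact this
  have hJ : ((besselOp n (besselOp n (u - κ • w)) : L2 n) : 𝓢'(Eucl n, ℂ)) =
      TemperedDistribution.besselPotential (Eucl n) ℂ (-2) ((u - κ • w : L2 n) : 𝓢'(Eucl n, ℂ)) := by
    rw [besselOp_toTemperedDistribution, besselOp_toTemperedDistribution,
      TemperedDistribution.besselPotential_besselPotential_apply]
    norm_num
  rw [← toTemperedDistribution_injective.eq_iff]
  beta_reduce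
  rw [hJ, eq_comm (a := (u : 𝓢'(Eucl n, ℂ))), TemperedDistribution.besselPotential_neg_apply_eq_iff,
    besselPotential_two, hcoe]
  constructor
  · rintro ⟨-, h⟩
    rw [h]
  · intro h
    have h2 : Δ (u : 𝓢'(Eucl n, ℂ)) = w := by
      have h3 := sub_right_injective h
      exact smul_right_injective _ hκ0 h3
    refine ⟨⟨u - κ • w, ?_⟩, h2⟩
    rw [besselPotential_two, h2, hcoe]

end Bessel

/-! ### Existence of the resolvent -/

section Resolvent

variable {n : ℕ} {V : Eucl n → ℝ} {v₀ v₁ : ℝ}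

/-- The constant `(2π)⁻²`. -/
def fourierScale : ℝ := ((2 * Real.pi) ^ 2)⁻¹

lemma fourierScale_pos : 0 < fourierScale := by unfold fourierScale; positivity

/-- The operator `(1 + |D|²)^{-1/2} (|D|² - (2π)⁻² z V) (1 + |D|²)^{-1/2}`. -/
def reducedOp (P : L2 n →L[ℂ] L2 n) (z : ℂ) : L2 n →L[ℂ] L2 n :=
  ContinuousLinearMap.id ℂ _ - besselOp n ∘L besselOp n -
    ((fourierScale : ℂ) * z) • (besselOp n ∘L P ∘L besselOp n)

lemma reducedOp_apply (P : L2 n →L[ℂ] L2 n) (z : ℂ) (h : L2 n) : reducedOp P z h =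
    h - besselOp n (besselOp n h) - ((fourierScale : ℂ) * z) • besselOp n (P (besselOp n h)) := rfl

lemma inner_reducedOp (hV : Measurable V) (hb : ∀ x, |V x| ≤ v₁) (z : ℂ) (h : L2 n) :
    inner ℂ h (reducedOp (mulReal V hV hb) z h) =
      ((‖h‖ ^ 2 - ‖besselOp n h‖ ^ 2 : ℝ) : ℂ) -
        z * ((fourierScale * ∫ x, V x * ‖besselOp n h x‖ ^ 2 : ℝ) : ℂ) := by
  rw [reducedOp_apply, inner_sub_right, inner_sub_right, inner_smul_right,
    ← inner_besselOp h (besselOp n h), ← inner_besselOp h (mulReal V hV hb (besselOp n h)), inner_mulReal_self, inner_self_eq_norm_sq_to_K, inner_self_eq_norm_sq_to_K]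
  push_cast
  simp only [Complex.coe_algebraMap]
  ring

/-- The imaginary part of `p - zq` is `-q Im z`, which bounds `q`; the real part then bounds `p`. -/
lemma sum_le_of_norm_sub_mul {p q : ℝ} {z : ℂ} (hz : 0 < z.im) (hq : 0 ≤ q) :
    p ≤ ‖(p : ℂ) - z * (q : ℂ)‖ * (1 + |z.re| / z.im) ∧ q ≤ ‖(p : ℂ) - z * (q : ℂ)‖ / z.im := by
  have h1 := Complex.abs_im_le_norm ((p : ℂ) - z * (q : ℂ))
  have h2 := Complex.re_le_norm ((p : ℂ) - z * (q : ℂ))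
  have e1 : ((p : ℂ) - z * (q : ℂ)).im = -(z.im * q) := by simp
  have e2 : ((p : ℂ) - z * (q : ℂ)).re = p - z.re * q := by simp
  rw [e1, abs_neg, abs_of_nonneg (by positivity)] at h1
  rw [e2] at h2
  have h3 : q ≤ ‖(p : ℂ) - z * (q : ℂ)‖ / z.im := by rw [le_div_iff₀ hz]; linarith
  refine ⟨?_, h3⟩
  have h4 : z.re * q ≤ |z.re| * (‖(p : ℂ) - z * (q : ℂ)‖ / z.im) :=
    (mul_le_mul_of_nonneg_right (le_abs_self _) hq).trans
      (mul_le_mul_of_nonneg_left h3 (abs_nonneg _))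
  have e3 : ‖(p : ℂ) - z * (q : ℂ)‖ * (1 + |z.re| / z.im) =
    ‖(p : ℂ) - z * (q : ℂ)‖ + |z.re| * (‖(p : ℂ) - z * (q : ℂ)‖ / z.im) := by ring
  rw [e3]
  linarith

/-- The quadratic form is coercive in modulus: it equals `p - zq` with `p = ‖h‖² - ‖Jh‖²` and `q ≥
(2π)⁻² v₀ ‖Jh‖²`, where `J` is the Bessel potential. Bounds on `p` and `q` together bound `‖h‖²`,
and invertibility follows as in the Lax–Milgram theorem. -/
lemma isUnit_reducedOp (hV : Measurable V) (hb : ∀ x, |V x| ≤ v₁) (hv₀ : 0 < v₀)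
    (hl : ∀ x, v₀ ≤ V x) {z : ℂ} (hz : 0 < z.im) : IsUnit (reducedOp (mulReal V hV hb) z) := by
  have hκ := fourierScale_pos
  set D : ℝ := 1 + |z.re| / z.im + (fourierScale * v₀ * z.im)⁻¹ with hD
  have hD0 : 0 < D := by positivity
  refine ContinuousLinearMap.isUnit_of_forall_le_norm_inner_map _ (c := Real.toNNReal D⁻¹)
    (Real.toNNReal_pos.2 (inv_pos.2 hD0)) fun h => ?_
  rw [← inner_conj_symm, RCLike.norm_conj, inner_reducedOp]
  set p := ‖h‖ ^ 2 - ‖besselOp n h‖ ^ 2 with hp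
  set q := fourierScale * ∫ x, V x * ‖besselOp n h x‖ ^ 2 with hq
  have hq1 : fourierScale * (v₀ * ‖besselOp n h‖ ^ 2) ≤ q :=
    mul_le_mul_of_nonneg_left (le_integral_mul_norm_sq hV hb hl _) hκ.le
  have hq0 : 0 ≤ q := le_trans (by positivity) hq1
  obtain ⟨h1, h2⟩ := sum_le_of_norm_sub_mul hz hq0
  set N := ‖(p : ℂ) - z * (q : ℂ)‖ with hN
  have h3 : ‖besselOp n h‖ ^ 2 ≤ N * (fourierScale * v₀ * z.im)⁻¹ := by
    rw [← div_eq_mul_inv, le_div_iff₀ (by positivity)]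
    rw [le_div_iff₀ hz] at h2
    nlinarith
  have h4 : ‖h‖ ^ 2 ≤ N * D := by
    have e : N * D = N * (1 + |z.re| / z.im) + N * (fourierScale * v₀ * z.im)⁻¹ := by rw [hD]; ring
    rw [e]; linarith
  have h5 : D⁻¹ * ‖h‖ ^ 2 ≤ N := by
    rw [inv_mul_le_iff₀ hD0]; linarith
  rw [Real.coe_toNNReal _ (inv_nonneg.2 hD0.le)]
  linarith

variable {c : Eucl n → ℝ}

/-- Multiplication of the equation by `V = c⁻²` solves it for the Laplacian and removes `c`. -/
lemma exists_laplacian_iff (hV : Measurable V) (hb : ∀ x, |V x| ≤ v₁)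
    (hcV : ∀ᵐ x, 0 < c x ∧ V x = (c x ^ 2)⁻¹) (z : ℂ) (f u : L2 n) :
    (∃ w : L2 n, HasLaplacianL2 u w ∧ ∀ᵐ x : Eucl n, -((c x : ℂ) ^ 2 * w x) - z * u x = f x) ↔
      HasLaplacianL2 u (-(mulReal V hV hb (f + z • u))) := by
  have hg := coeFn_mulReal hV hb (f + z • u)
  have hadd := Lp.coeFn_add f (z • u)
  have hsmul := Lp.coeFn_smul z u
  have hneg := Lp.coeFn_neg (mulReal V hV hb (f + z • u))
  constructor
  · rintro ⟨w, hw, he⟩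
    have : w = -(mulReal V hV hb (f + z • u)) := by
      refine Lp.ext ?_
      filter_upwards [hg, hadd, hsmul, hneg, hcV, he] with x h1 h2 h3 h4 h5 h6
      rw [h4, Pi.neg_apply, h1, h2, Pi.add_apply, h3, Pi.smul_apply, ← h6, h5.2]
      have : (c x : ℂ) ≠ 0 := by exact_mod_cast h5.1.ne'
      push_cast
      rw [smul_eq_mul]
      field_simp
      ring
    rwa [← this]
  · intro hw
    refine ⟨_, hw, ?_⟩
    filter_upwards [hg, hadd, hsmul, hneg, hcV] with x h1 h2 h3 h4 h5
    rw [h4, Pi.neg_apply, h1, h2, Pi.add_apply, h3, Pi.smul_apply, h5.2]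
    have : (c x : ℂ) ≠ 0 := by exact_mod_cast h5.1.ne'
    push_cast
    rw [smul_eq_mul]
    field_simp
    ring

/-- The resolvent exists off the real axis, and is bounded by the inverse of the imaginary part of
the spectral parameter. -/
theorem exists_isResolvent (hV : Measurable V) (hb : ∀ x, |V x| ≤ v₁) (hv₀ : 0 < v₀)
    (hl : ∀ x, v₀ ≤ V x) (hcV : ∀ᵐ x, 0 < c x ∧ V x = (c x ^ 2)⁻¹) {lam : ℂ}
    (hz : 0 < (lam ^ 2).im) :
    ∃ R : L2 n →L[ℂ] L2 n, IsResolvent c lam R ∧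
      ∀ f, (lam ^ 2).im * v₀ * ‖R f‖ ≤ v₁ * ‖f‖ := by
  set z := lam ^ 2 with hzdef
  set P := mulReal V hV hb with hP
  have hκ := fourierScale_pos
  obtain ⟨U, hU⟩ := isUnit_reducedOp hV hb hv₀ hl hz
  have hUB : ∀ h, (↑U⁻¹ : L2 n →L[ℂ] L2 n) (reducedOp P z h) = h := fun h => by
    have : ((↑U⁻¹ : L2 n →L[ℂ] L2 n) * ↑U) h = h := by rw [U.inv_mul]; rfl
    rwa [hU] at this
  have hBU : ∀ h, reducedOp P z ((↑U⁻¹ : L2 n →L[ℂ] L2 n) h) = h := fun h => by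
    have : ((U : L2 n →L[ℂ] L2 n) * ↑U⁻¹) h = h := by rw [U.mul_inv]; rfl
    rwa [hU] at this
  set J := besselOp n with hJ
  set κ : ℂ := (fourierScale : ℂ) with hκdef
  have hiff : ∀ f u : L2 n, HasLaplacianL2 u (-(P (f + z • u))) ↔
      u = J (J (u + κ • P f + (κ * z) • P u)) := fun f u => by
    rw [hasLaplacianL2_iff]
    have e : u - (((2 * Real.pi) ^ 2)⁻¹ : ℝ) • -(P (f + z • u)) = u + κ • P f + (κ * z) • P u := by
      change u - κ • -(P (f + z • u)) = _
      rw [map_add, map_smul, smul_neg, smul_add, smul_smul]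
      abel
    rw [e]
  -- By `hiff` the equation says `u = Jh` with `h = J(u + κPf + κzPu)`, that is, `reducedOp P z h =
  -- κJPf`.
  refine ⟨κ • (J ∘L (↑U⁻¹ : L2 n →L[ℂ] L2 n) ∘L J ∘L P), fun f u => ?_, fun f => ?_⟩
  · rw [exists_laplacian_iff hV hb hcV, hiff]
    have hRf : (κ • (J ∘L (↑U⁻¹ : L2 n →L[ℂ] L2 n) ∘L J ∘L P)) f =
      J ((↑U⁻¹ : L2 n →L[ℂ] L2 n) (κ • J (P f))) := by
      rw [map_smul, map_smul]; rfl
    rw [hRf]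
    constructor
    · intro hu
      set h := (↑U⁻¹ : L2 n →L[ℂ] L2 n) (κ • J (P f)) with hh
      have h1 : reducedOp P z h = κ • J (P f) := hBU _
      rw [reducedOp_apply, ← hJ, hu] at h1
      have h2 : h = J (u + κ • P f + (κ * z) • P u) := by
        rw [map_add, map_add, map_smul, map_smul, ← h1]
        abel
      rw [← h2, hu]
    · intro hu
      set h := J (u + κ • P f + (κ * z) • P u) with hh
      have h1 : reducedOp P z h = κ • J (P f) := by
        rw [reducedOp_apply, ← hJ, ← hu]
        nth_rw 1 [hh]
        rw [map_add, map_add, map_smul, map_smul]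
        abel
      rw [← h1, hUB, ← hu]
  · set h := (↑U⁻¹ : L2 n →L[ℂ] L2 n) (J (P f)) with hh
    have h1 : reducedOp P z h = J (P f) := hBU _
    have h2 := inner_reducedOp hV hb z h
    -- Now the form at `h` is also the pairing of `Jh` with `Pf`, and its imaginary part bounds
    -- `‖Jh‖`.
    rw [← hP, h1, ← inner_besselOp] at h2
    have hRf : (κ • (J ∘L (↑U⁻¹ : L2 n →L[ℂ] L2 n) ∘L J ∘L P)) f = κ • J h := rfl
    have hn : ‖κ • J h‖ = fourierScale * ‖J h‖ := by
      rw [norm_smul, hκdef, Complex.norm_real, Real.norm_of_nonneg hκ.le]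
    have h3 := congrArg Complex.im h2
    rw [Complex.sub_im, Complex.ofReal_im, Complex.im_mul_ofReal, zero_sub] at h3
    have h4 : z.im * (fourierScale * ∫ x, V x * ‖J h x‖ ^ 2) ≤ ‖J h‖ * (v₁ * ‖f‖) := by
      calc _ = -(inner ℂ (J h) (P f)).im := by rw [h3, neg_neg]
        _ ≤ ‖inner ℂ (J h) (P f)‖ := (neg_le_abs _).trans (Complex.abs_im_le_norm _)
        _ ≤ ‖J h‖ * ‖P f‖ := norm_inner_le_norm _ _
        _ ≤ _ := mul_le_mul_of_nonneg_left (norm_mulReal_le _ _ _) (norm_nonneg _)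
    have h5 := le_integral_mul_norm_sq hV hb hl (J h)
    rw [hRf, hn]
    rcases (norm_nonneg (J h)).eq_or_lt with h0 | h0
    · rw [← h0]
      have : 0 ≤ v₁ := hv₀.le.trans ((hl 0).trans ((le_abs_self _).trans (hb 0)))
      simp only [mul_zero]
      positivity
    · refine le_of_mul_le_mul_left ?_ h0
      refine le_trans ?_ h4
      calc _ = z.im * (fourierScale * (v₀ * ‖J h‖ ^ 2)) := by ring
        _ ≤ _ := by gcongr

end Resolvent

/-! ### Test functions are a core for the Laplacian -/

section Density

variable {n : ℕ}

open Filter Topology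

/-- An integrable weight that is bounded by `1`. -/
def decayWeight (x : Eucl n) : ℝ := (1 + ‖x‖) ^ (-((n : ℝ) + 1))

lemma decayWeight_nonneg (x : Eucl n) : 0 ≤ decayWeight x := by unfold decayWeight; positivity

lemma decayWeight_le_one (x : Eucl n) : decayWeight x ≤ 1 :=
  Real.rpow_le_one_of_one_le_of_nonpos (by linarith [norm_nonneg x]) (by
    have : (0 : ℝ) ≤ n := n.cast_nonneg
    linarith)

lemma integrable_decayWeight : Integrable (decayWeight : Eucl n → ℝ) :=
  integrable_one_add_norm (by simp)

/-- A Schwartz function, as an element of `L²`. -/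
def schwartzL2 (f : 𝓢(Eucl n, ℂ)) : L2 n := f.toLp 2 volume

lemma coeFn_schwartz (f : 𝓢(Eucl n, ℂ)) : schwartzL2 f =ᵐ[volume] f :=
  f.coeFn_toLp 2 volume

lemma norm_schwartzL2_sub_sq (g f : 𝓢(Eucl n, ℂ)) :
    ‖(schwartzL2 g) - (schwartzL2 f)‖ ^ 2 = ∫ x, ‖g x - f x‖ ^ 2 := by
  rw [norm_sq_eq_integral]
  have h1 := Lp.coeFn_sub (schwartzL2 g) (schwartzL2 f)
  refine integral_congr_ae ?_
  filter_upwards [h1, coeFn_schwartz g, coeFn_schwartz f] with x e1 e2 e3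
  rw [e1, Pi.sub_apply, e2, e3]

lemma tendsto_schwartzL2_of_dominated {g : ℕ → 𝓢(Eucl n, ℂ)} {f : 𝓢(Eucl n, ℂ)} {C : ℝ}
    (hb : ∀ m x, ‖g m x - f x‖ ≤ C * decayWeight x) (hp : ∀ x, ∀ᶠ m in atTop, g m x = f x) :
    Tendsto (fun m => schwartzL2 (g m)) atTop (𝓝 (schwartzL2 f)) := by
  rw [tendsto_iff_norm_sub_tendsto_zero]
  have hC : 0 ≤ C := by
    have h1 := (norm_nonneg _).trans (hb 0 0)
    have h2 : decayWeight (0 : Eucl n) = 1 := by simp [decayWeight]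
    rw [h2] at h1; linarith
  have h2 : Tendsto (fun m => ∫ x, ‖g m x - f x‖ ^ 2) atTop (𝓝 (∫ x : Eucl n, (0 : ℝ))) := by
    refine tendsto_integral_of_dominated_convergence (fun x => C ^ 2 * decayWeight x) (fun m => ?_)
      (integrable_decayWeight.const_mul _) (fun m => ae_of_all _ fun x => ?_)
      (ae_of_all _ fun x => ?_)
    · exact ((((g m).continuous.sub f.continuous).norm).pow 2).aestronglyMeasurable
    · rw [Real.norm_of_nonneg (by positivity)]
      calc ‖g m x - f x‖ ^ 2 ≤ (C * decayWeight x) ^ 2 := by gcongr; exact hb m x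
        _ = C ^ 2 * (decayWeight x * decayWeight x) := by ring
        _ ≤ C ^ 2 * (decayWeight x * 1) := by
          gcongr
          · exact decayWeight_nonneg x
          · exact decayWeight_le_one x
        _ = _ := by ring
    · refine tendsto_const_nhds.congr' ?_
      filter_upwards [hp x] with m hm
      rw [hm]; simp
  simp only [integral_zero] at h2
  simp_rw [← norm_schwartzL2_sub_sq] at h2
  have h3 := (Real.continuous_sqrt.tendsto 0).comp h2
  simpa [Function.comp_def, Real.sqrt_sq (norm_nonneg _)] using h3

lemma exists_decay_bound (f : 𝓢(Eucl n, ℂ)) :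
    ∃ C, 0 ≤ C ∧ ∀ j ≤ 2, ∀ x, ‖iteratedFDeriv ℝ j f x‖ ≤ C * decayWeight x := by
  refine ⟨2 ^ (n + 1) * (Finset.Iic (n + 1, 2)).sup (fun m => SchwartzMap.seminorm ℝ m.1 m.2) f,
    by positivity, fun j hj x => ?_⟩
  have h := SchwartzMap.one_add_le_sup_seminorm_apply (𝕜 := ℝ) (m := (n + 1, 2)) le_rfl hj f x
  have hx : 0 < 1 + ‖x‖ := by positivity
  have e : decayWeight x = ((1 + ‖x‖) ^ (n + 1))⁻¹ := by
    rw [decayWeight, Real.rpow_neg hx.le]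
    norm_cast
  rw [e, ← div_eq_mul_inv, le_div_iff₀ (by positivity)]
  linarith

lemma norm_laplacian_le (f : Eucl n → ℂ) (x : Eucl n) :
    ‖Δ f x‖ ≤ n * ‖iteratedFDeriv ℝ 2 f x‖ := by
  rw [InnerProductSpace.laplacian_eq_iteratedFDeriv_orthonormalBasis f (EuclideanSpace.basisFun (Fin n) ℝ)]
  refine (norm_sum_le _ _).trans ?_
  calc _ ≤ ∑ i : Fin n, ‖iteratedFDeriv ℝ 2 f x‖ := Finset.sum_le_sum fun i _ => by
        refine (ContinuousMultilinearMap.le_opNorm _ _).trans ?_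
        simp [Fin.prod_univ_two]
    _ = _ := by simp

variable {χ : Eucl n → ℝ}

lemma exists_scaled_cutoff_bound (h : ContDiff ℝ ∞ χ) (hs : HasCompactSupport χ) :
    ∃ B, 0 ≤ B ∧ ∀ j ≤ 2, ∀ a : ℝ, 0 ≤ a → a ≤ 1 → ∀ x,
      ‖iteratedFDeriv ℝ j (fun x => χ (a • x)) x‖ ≤ B := by
  have h1 : ∀ j : ℕ, ∃ B, ∀ x, ‖iteratedFDeriv ℝ j χ x‖ ≤ B := fun j =>
    (hs.iteratedFDeriv j).exists_bound_of_continuous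
      ((h.of_le (mod_cast le_top)).continuous_iteratedFDeriv')
  choose B hB using h1
  have hB0 : ∀ j, 0 ≤ B j := fun j => (norm_nonneg _).trans (hB j 0)
  refine ⟨B 0 + B 1 + B 2, by linarith [hB0 0, hB0 1, hB0 2], fun j hj a ha0 ha1 x => ?_⟩
  have h2 := (a • ContinuousLinearMap.id ℝ (Eucl n)).iteratedFDeriv_comp_right (i := j) (n := ∞) h x
    (mod_cast le_top)
  have h3 : (fun x => χ (a • x)) =
      χ ∘ ⇑(a • ContinuousLinearMap.id ℝ (Eucl n) : Eucl n →L[ℝ] Eucl n) := rfl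
  rw [h3, h2]
  refine (ContinuousMultilinearMap.norm_compContinuousLinearMap_le _ _).trans ?_
  have h4 : ∏ _i : Fin j, ‖a • ContinuousLinearMap.id ℝ (Eucl n)‖ ≤ 1 :=
    Finset.prod_le_one (fun _ _ => norm_nonneg _) fun _ _ => by
      rw [norm_smul, Real.norm_of_nonneg ha0]
      exact mul_le_one₀ ha1 (norm_nonneg _) ContinuousLinearMap.norm_id_le
  refine (mul_le_of_le_one_right (norm_nonneg _) h4).trans ((hB j _).trans ?_)
  interval_cases j <;> linarith [hB0 0, hB0 1, hB0 2]

lemma norm_iteratedFDeriv_cutoff_smul_le {f : 𝓢(Eucl n, ℂ)} {C B : ℝ} (hB0 : 0 ≤ B)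
    (hf : ∀ j ≤ 2, ∀ x, ‖iteratedFDeriv ℝ j f x‖ ≤ C * decayWeight x) {χ : Eucl n → ℝ}
    (h : ContDiff ℝ ∞ χ) (hB : ∀ j ≤ 2, ∀ x, ‖iteratedFDeriv ℝ j χ x‖ ≤ B) {j : ℕ} (hj : j ≤ 2)
    (x : Eucl n) :
    ‖iteratedFDeriv ℝ j (fun y => χ y • f y) x‖ ≤ 4 * (B * (C * decayWeight x)) := by
  refine (norm_iteratedFDeriv_smul_le (N := ∞) h f.smooth' x (mod_cast le_top)).trans ?_
  have hD : 0 ≤ C * decayWeight x := (norm_nonneg _).trans (hf 0 (by norm_num) x)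
  calc _ ≤ ∑ i ∈ Finset.range (j + 1), (j.choose i : ℝ) * (B * (C * decayWeight x)) := by
        refine Finset.sum_le_sum fun i hi => ?_
        rw [Finset.mem_range] at hi
        rw [mul_assoc]
        have h1 := hB i (by omega) x
        have h2 := hf (j - i) (by omega) x
        gcongr
        exact h2
    _ = (2 : ℝ) ^ j * (B * (C * decayWeight x)) := by
        rw [← Finset.sum_mul]
        congr 1
        exact_mod_cast Nat.sum_range_choose j
    _ ≤ _ := by
        have h1 : (2 : ℝ) ^ j ≤ 2 ^ 2 := pow_le_pow_right₀ (by norm_num) hj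
        have h2 : 0 ≤ B * (C * decayWeight x) := mul_nonneg hB0 hD
        nlinarith

/-- Pairs `(φ, Δ φ)` of test functions, as elements of `L² × L²`. -/
def testGraph (n : ℕ) : Set (L2 n × L2 n) :=
  {p | ∃ φ : 𝓢(Eucl n, ℂ), HasCompactSupport φ ∧ p = (schwartzL2 φ, schwartzL2 (Δ φ))}

/-- Multiply `f` by cutoffs at scale `m + 1`. Their derivatives are bounded uniformly in `m`, and
near each point the product eventually equals `f`, so dominated convergence applies to the functions
and to their Laplacians. -/
lemma schwartzL2_mem_closure_testGraph (f : 𝓢(Eucl n, ℂ)) :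
    ((schwartzL2 f, schwartzL2 (Δ f)) : L2 n × L2 n) ∈ closure (testGraph n) := by
  let χ : ContDiffBump (0 : Eucl n) := ⟨1, 2, by norm_num, by norm_num⟩
  obtain ⟨B, hB0, hB⟩ := exists_scaled_cutoff_bound χ.contDiff χ.hasCompactSupport
  obtain ⟨C, hC0, hC⟩ := exists_decay_bound f
  set a : ℕ → ℝ := fun m => ((m : ℝ) + 1)⁻¹ with ha
  have ha0 : ∀ m, 0 < a m := fun m => by rw [ha]; positivity
  have ha1 : ∀ m, a m ≤ 1 := fun m => inv_le_one_of_one_le₀ (by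
    have : (0 : ℝ) ≤ m := m.cast_nonneg
    linarith)
  have hχm : ∀ m, ContDiff ℝ ∞ fun x => χ (a m • x) := fun m =>
    χ.contDiff.comp (contDiff_const_smul _)
  have hχs : ∀ m, HasCompactSupport fun x => χ (a m • x) := fun m =>
    χ.hasCompactSupport.comp_smul (ha0 m).ne'
  have hsm : ∀ m, HasCompactSupport fun x => χ (a m • x) • f x := fun m => (hχs m).smul_right
  have hcd : ∀ m, ContDiff ℝ ∞ fun x => χ (a m • x) • f x := fun m => (hχm m).smul f.smooth'
  set g : ℕ → 𝓢(Eucl n, ℂ) := fun m => (hsm m).toSchwartzMap (hcd m) with hg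
  have hgf : ∀ m, (g m : Eucl n → ℂ) = fun x => χ (a m • x) • f x := fun m => rfl
  have hbd : ∀ j ≤ 2, ∀ m x, ‖iteratedFDeriv ℝ j (g m) x‖ ≤ 4 * (B * (C * decayWeight x)) :=
    fun j hj m x => by
      rw [hgf]
      exact norm_iteratedFDeriv_cutoff_smul_le hB0 hC (hχm m)
        (fun i hi x => hB i hi (a m) (ha0 m).le (ha1 m) x) hj x
  have hev : ∀ x, ∀ᶠ m in atTop, (g m : Eucl n → ℂ) =ᶠ[𝓝 x] f := fun x => by
    filter_upwards [eventually_ge_atTop ⌈‖x‖⌉₊] with m hm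
    have hm' : ‖x‖ < (m : ℝ) + 1 := (Nat.ceil_le.1 hm).trans_lt (by linarith)
    filter_upwards [continuous_norm.continuousAt.eventually (gt_mem_nhds hm')] with y hy
    rw [hgf]
    have h1 : χ (a m • y) = 1 := by
      refine χ.one_of_mem_closedBall ?_
      rw [mem_closedBall_zero_iff, norm_smul, Real.norm_of_nonneg (ha0 m).le]
      change ((m : ℝ) + 1)⁻¹ * ‖y‖ ≤ 1
      rw [inv_mul_le_iff₀ (by positivity), mul_one]
      exact hy.le
    simp only [h1, one_smul]
  have t1 : Tendsto (fun m => schwartzL2 (g m)) atTop (𝓝 (schwartzL2 f)) := by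
    refine tendsto_schwartzL2_of_dominated (C := 4 * (B * C) + C) (fun m x => ?_) fun x => ?_
    · have h1 := hbd 0 (by norm_num) m x
      have h2 := hC 0 (by norm_num) x
      rw [norm_iteratedFDeriv_zero] at h1 h2
      refine (norm_sub_le _ _).trans ?_
      linarith
    · filter_upwards [hev x] with m hm using hm.eq_of_nhds
  have t2 : Tendsto (fun m => schwartzL2 (Δ (g m))) atTop (𝓝 (schwartzL2 (Δ f) : L2 n)) := by
    refine tendsto_schwartzL2_of_dominated (C := n * (4 * (B * C)) + n * C) (fun m x => ?_) fun x => ?_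
    · have h1 := hbd 2 le_rfl m x
      have h2 := hC 2 le_rfl x
      rw [SchwartzMap.laplacian_apply, SchwartzMap.laplacian_apply]
      refine (norm_sub_le _ _).trans ?_
      have h3 := (norm_laplacian_le (g m) x).trans (mul_le_mul_of_nonneg_left h1 n.cast_nonneg)
      have h4 := (norm_laplacian_le f x).trans (mul_le_mul_of_nonneg_left h2 n.cast_nonneg)
      linarith
    · filter_upwards [hev x] with m hm
      rw [SchwartzMap.laplacian_apply, SchwartzMap.laplacian_apply]
      exact (InnerProductSpace.laplacian_congr_nhds hm).eq_of_nhds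
  exact mem_closure_of_tendsto (t1.prodMk_nhds t2) (Eventually.of_forall fun m => ⟨g m, hsm m, rfl⟩)

lemma schwartzL2_toTemperedDistribution (f : 𝓢(Eucl n, ℂ)) :
    (schwartzL2 f : 𝓢'(Eucl n, ℂ)) = SchwartzMap.toTemperedDistributionCLM (Eucl n) ℂ volume f :=
  Lp.toTemperedDistribution_toLp_eq f

lemma besselOp_schwartzL2 (f : 𝓢(Eucl n, ℂ)) : ∃ g : 𝓢(Eucl n, ℂ), besselOp n (schwartzL2 f) = schwartzL2 g := by
  refine ⟨SchwartzMap.fourierMultiplierCLM ℂ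
    (fun x => (((1 + ‖x‖ ^ 2) ^ ((-1 : ℝ) / 2) : ℝ) : ℂ)) f, ?_⟩
  refine toTemperedDistribution_injective ?_
  beta_reduce
  rw [besselOp_toTemperedDistribution, schwartzL2_toTemperedDistribution,
    schwartzL2_toTemperedDistribution, TemperedDistribution.besselPotential,
    TemperedDistribution.fourierMultiplierCLM_toTemperedDistributionCLM_eq (by fun_prop)]

lemma HasLaplacianL2.eq_schwartzL2 {s : 𝓢(Eucl n, ℂ)} {w : L2 n} (h : HasLaplacianL2 (schwartzL2 s) w) :
    w = schwartzL2 (Δ s) := by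
  refine toTemperedDistribution_injective ?_
  beta_reduce
  rw [← h.2, schwartzL2_toTemperedDistribution, schwartzL2_toTemperedDistribution,
    TemperedDistribution.laplacian_toTemperedDistributionCLM_eq]

lemma hasLaplacianL2_besselOp (g : L2 n) : HasLaplacianL2 (besselOp n (besselOp n g))
    ((((2 * Real.pi) ^ 2 : ℝ) : ℂ) • (besselOp n (besselOp n g) - g)) := by
  rw [hasLaplacianL2_iff]
  have h : (2 * Real.pi) ^ 2 ≠ 0 := by positivity
  have e : (((2 * Real.pi) ^ 2)⁻¹ : ℝ) • ((((2 * Real.pi) ^ 2 : ℝ) : ℂ) •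
      (besselOp n (besselOp n g) - g)) = besselOp n (besselOp n g) - g :=
    inv_smul_smul₀ h _
  rw [e, sub_sub_cancel]

/-- The pair depends continuously on `g`, so it suffices to take `g` Schwartz. Bessel potentials
preserve Schwartz functions, and the previous approximation applies. -/
lemma besselOp_mem_closure_testGraph (g : L2 n) : (besselOp n (besselOp n g),
    (((2 * Real.pi) ^ 2 : ℝ) : ℂ) • (besselOp n (besselOp n g) - g)) ∈ closure (testGraph n) := by
  have hc : Continuous fun g : L2 n => ((besselOp n (besselOp n g),
      (((2 * Real.pi) ^ 2 : ℝ) : ℂ) • (besselOp n (besselOp n g) - g)) : L2 n × L2 n) := by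
    have h1 : Continuous fun g : L2 n => besselOp n (besselOp n g) :=
      (besselOp n).continuous.comp (besselOp n).continuous
    have h2 : Continuous fun g : L2 n => besselOp n (besselOp n g) - g := h1.sub continuous_id
    have h3 : Continuous fun g : L2 n =>
        (((2 * Real.pi) ^ 2 : ℝ) : ℂ) • (besselOp n (besselOp n g) - g) :=
      (continuous_const_smul _).comp h2
    exact h1.prodMk h3
  have hd : Dense (Set.range fun f : 𝓢(Eucl n, ℂ) => (schwartzL2 f)) :=
    SchwartzMap.denseRange_toLpCLM (F := ℂ) (p := 2) (μ := (volume : Measure (Eucl n)))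
      ENNReal.ofNat_ne_top
  refine (isClosed_closure.preimage hc).closure_subset_iff.2 ?_ (hd g)
  rintro _ ⟨f, rfl⟩
  obtain ⟨f', hf'⟩ := besselOp_schwartzL2 f
  obtain ⟨s, hs⟩ := besselOp_schwartzL2 f'
  have h1 : besselOp n (besselOp n (schwartzL2 f)) = schwartzL2 s := by rw [hf', hs]
  have h2 := hasLaplacianL2_besselOp (schwartzL2 f)
  rw [h1] at h2
  have h3 := schwartzL2_mem_closure_testGraph s
  rw [← h2.eq_schwartzL2, ← h1] at h3
  exact h3

/-- Test functions are a core for the Laplacian. -/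
theorem HasLaplacianL2.mem_closure_testGraph {u w : L2 n} (h : HasLaplacianL2 u w) :
    (u, w) ∈ closure (testGraph n) := by
  rw [hasLaplacianL2_iff] at h
  have h0 : (2 * Real.pi) ^ 2 ≠ 0 := by positivity
  have h1 := besselOp_mem_closure_testGraph (u - (((2 * Real.pi) ^ 2)⁻¹ : ℝ) • w)
  rw [← h, sub_sub_cancel] at h1
  have e : (((2 * Real.pi) ^ 2 : ℝ) : ℂ) • ((((2 * Real.pi) ^ 2)⁻¹ : ℝ) • w) = w :=
    smul_inv_smul₀ h0 _
  rwa [e] at h1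

end Density

/-! ### Passing from test functions to the resolvent -/

section Limit

variable {n : ℕ} {V : Eucl n → ℝ} {v₀ v₁ : ℝ} {Ω : Set (Eucl n)}

lemma abs_indicator_one_le (Ω : Set (Eucl n)) (x : Eucl n) : |Ω.indicator (fun _ => (1 : ℝ)) x| ≤ 1 := by
  by_cases hx : x ∈ Ω <;> simp [hx]

/-- Restriction of `L²` functions to a measurable set, extended by zero. -/
def restrictL2 (Ω : Set (Eucl n)) (hΩ : MeasurableSet Ω) : L2 n →L[ℂ] L2 n :=
  mulReal (Ω.indicator fun _ => 1) (measurable_const.indicator hΩ) (abs_indicator_one_le Ω)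

lemma coeFn_restrictL2 (hΩ : MeasurableSet Ω) (f : L2 n) :
    restrictL2 Ω hΩ f =ᵐ[volume] Ω.indicator f := by
  have h := coeFn_mulReal (a := Ω.indicator fun _ => 1) (measurable_const.indicator hΩ)
    (abs_indicator_one_le Ω) f
  filter_upwards [h] with x hx
  rw [restrictL2, hx]
  by_cases hxΩ : x ∈ Ω <;> simp [hxΩ]

lemma norm_restrictL2_sq (hΩ : MeasurableSet Ω) {f : L2 n} {g₁ g₂ : Eucl n → ℝ}
    (h : ∀ᵐ x, ‖f x‖ ^ 2 = g₁ x ^ 2 + g₂ x ^ 2) :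
    ‖restrictL2 Ω hΩ f‖ ^ 2 = ∫ x, Ω.indicator (fun x => g₁ x ^ 2 + g₂ x ^ 2) x := by
  rw [norm_sq_eq_integral]
  refine integral_congr_ae ?_
  filter_upwards [h, coeFn_restrictL2 hΩ f] with x h1 h2
  rw [h2]
  by_cases hxΩ : x ∈ Ω <;> simp [hxΩ, h1]

lemma norm_sub_restrictL2_sq (hΩ : MeasurableSet Ω) {f : L2 n} {g₁ g₂ : Eucl n → ℝ}
    (h : ∀ᵐ x, ‖f x‖ ^ 2 = g₁ x ^ 2 + g₂ x ^ 2) :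
    ‖f - restrictL2 Ω hΩ f‖ ^ 2 = ∫ x, Ωᶜ.indicator (fun x => g₁ x ^ 2 + g₂ x ^ 2) x := by
  rw [norm_sq_eq_integral]
  refine integral_congr_ae ?_
  filter_upwards [h, coeFn_restrictL2 hΩ f, Lp.coeFn_sub f (restrictL2 Ω hΩ f)] with x h1 h2 h3
  rw [h3, Pi.sub_apply, h2]
  by_cases hxΩ : x ∈ Ω <;> simp [hxΩ, h1]

open LineDeriv in
lemma pd_re (φ : 𝓢(Eucl n, ℂ)) (j : Fin n) : pd j (fun x => (φ x).re) =
    fun x => ((∂_{EuclideanSpace.single j (1 : ℝ)} φ : 𝓢(Eucl n, ℂ)) x).re := by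
  ext x
  rw [SchwartzMap.lineDerivOp_apply_eq_fderiv, pd]
  have h := (Complex.reCLM.hasFDerivAt (x := φ x)).comp x (φ.hasFDerivAt x)
  have h' : HasFDerivAt (fun x => (φ x).re) (Complex.reCLM ∘L fderiv ℝ φ x) x := h
  rw [h'.fderiv]
  rfl

open LineDeriv in
lemma pd_im (φ : 𝓢(Eucl n, ℂ)) (j : Fin n) : pd j (fun x => (φ x).im) =
    fun x => ((∂_{EuclideanSpace.single j (1 : ℝ)} φ : 𝓢(Eucl n, ℂ)) x).im := by
  ext x
  rw [SchwartzMap.lineDerivOp_apply_eq_fderiv, pd]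
  have h := (Complex.imCLM.hasFDerivAt (x := φ x)).comp x (φ.hasFDerivAt x)
  have h' : HasFDerivAt (fun x => (φ x).im) (Complex.imCLM ∘L fderiv ℝ φ x) x := h
  rw [h'.fderiv]
  rfl

open LineDeriv in
lemma laplacian_apply_eq_sum (φ : 𝓢(Eucl n, ℂ)) (x : Eucl n) : Δ φ x =
    ∑ j : Fin n, (∂_{EuclideanSpace.single j (1 : ℝ)} (∂_{EuclideanSpace.single j (1 : ℝ)} φ) :
      𝓢(Eucl n, ℂ)) x := by
  rw [SchwartzMap.laplacian_eq_sum (EuclideanSpace.basisFun (Fin n) ℝ), sum_apply]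
  simp

lemma lap_re (φ : 𝓢(Eucl n, ℂ)) (x : Eucl n) : lap (fun x => (φ x).re) x = (Δ φ x).re := by
  rw [laplacian_apply_eq_sum, Complex.re_sum, lap]
  simp_rw [pd_re]

lemma lap_im (φ : 𝓢(Eucl n, ℂ)) (x : Eucl n) : lap (fun x => (φ x).im) x = (Δ φ x).im := by
  rw [laplacian_apply_eq_sum, Complex.im_sum, lap]
  simp_rw [pd_im]

/-- The source `-V⁻¹ Δ φ - z φ`. -/
def sourceFun (V : Eucl n → ℝ) (z : ℂ) (φ : 𝓢(Eucl n, ℂ)) (x : Eucl n) : ℂ :=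
  -(((V x)⁻¹ : ℝ) * Δ φ x) - z * φ x

lemma helmholtzPair_sourceFun (hV : Measurable V) (hv₀ : 0 < v₀) (hl : ∀ x, v₀ ≤ V x)
    {φ : 𝓢(Eucl n, ℂ)} (hφ : HasCompactSupport φ) {z : ℂ} {k ε : ℝ} (hk : z.re = k ^ 2)
    (hε : z.im = ε) :
    ∃ ρ, HelmholtzPair V k ε ρ (fun x => (φ x).re) (fun x => (φ x).im)
      (fun x => (sourceFun V z φ x).re) (fun x => (sourceFun V z φ x).im) := by
  obtain ⟨ρ, hρ⟩ := hφ.isCompact.isBounded.subset_closedBall (0 : Eucl n)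
  have hz : ∀ x, ρ < ‖x‖ → x ∉ tsupport φ := fun x hx hx' => by
    have := hρ hx'
    rw [mem_closedBall_zero_iff] at this
    linarith
  have h0 : ∀ x, ρ < ‖x‖ → φ x = 0 := fun x hx => image_eq_zero_of_notMem_tsupport (hz x hx)
  have hΔ : ∀ x, ρ < ‖x‖ → Δ φ x = 0 := fun x hx => by
    have h1 : (φ : Eucl n → ℂ) =ᶠ[nhds x] fun _ => 0 := notMem_tsupport_iff_eventuallyEq.1 (hz x hx)
    rw [SchwartzMap.laplacian_apply, (InnerProductSpace.laplacian_congr_nhds h1).eq_of_nhds]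
    simp
  have hs : ∀ x, ρ < ‖x‖ → sourceFun V z φ x = 0 := fun x hx => by
    rw [sourceFun, h0 x hx, hΔ x hx]; simp
  have hre : ∀ x, (sourceFun V z φ x).re =
      -((V x)⁻¹ * (Δ φ x).re) - (z.re * (φ x).re - z.im * (φ x).im) := fun x => by
    simp [sourceFun]
  have him : ∀ x, (sourceFun V z φ x).im =
      -((V x)⁻¹ * (Δ φ x).im) - (z.re * (φ x).im + z.im * (φ x).re) := fun x => by
    simp [sourceFun]
  have bV : LocBdd fun x => (V x)⁻¹ := .of_bounded (C := v₀⁻¹) hV.inv fun x => by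
    have := hl x
    rw [abs_of_nonneg (inv_nonneg.2 (hv₀.le.trans this))]
    gcongr
  have b₁ : LocBdd fun x => (φ x).re := .of_continuous (Complex.continuous_re.comp φ.continuous)
  have b₂ : LocBdd fun x => (φ x).im := .of_continuous (Complex.continuous_im.comp φ.continuous)
  have d₁ : LocBdd fun x => (Δ φ x).re := .of_continuous (Complex.continuous_re.comp (Δ φ).continuous)
  have d₂ : LocBdd fun x => (Δ φ x).im := .of_continuous (Complex.continuous_im.comp (Δ φ).continuous)
  have hVne : ∀ x, V x ≠ 0 := fun x => (hv₀.trans_le (hl x)).ne'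
  have hφ2 : ContDiff ℝ 2 φ := φ.smooth 2
  refine ⟨ρ, ⟨Complex.reCLM.contDiff.comp hφ2, Complex.imCLM.contDiff.comp hφ2,
    fun x hx => by rw [h0 x hx, Complex.zero_re], fun x hx => by rw [h0 x hx, Complex.zero_im],
    ?_, ?_, fun x hx => by rw [hs x hx, Complex.zero_re], fun x hx => by rw [hs x hx, Complex.zero_im],
    fun x => ?_, fun x => ?_⟩⟩
  · simp_rw [hre]
    exact (bV.mul d₁).neg.sub (((LocBdd.const _).mul b₁).sub ((LocBdd.const _).mul b₂))
  · simp_rw [him]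
    exact (bV.mul d₂).neg.sub (((LocBdd.const _).mul b₂).add ((LocBdd.const _).mul b₁))
  · have := hVne x
    rw [lap_re, hre, hk, hε]
    field_simp
    ring
  · have := hVne x
    rw [lap_im, him, hk, hε]
    field_simp
    ring

lemma abs_inv_le (hv₀ : 0 < v₀) (hl : ∀ x, v₀ ≤ V x) (x : Eucl n) : |(V x)⁻¹| ≤ v₀⁻¹ := by
  have := hl x
  rw [abs_of_nonneg (inv_nonneg.2 (hv₀.le.trans this))]
  gcongr

/-- The source `-V⁻¹ w - z u` of a pair `(u, w)`. -/
def sourceOp (hV : Measurable V) (hv₀ : 0 < v₀) (hl : ∀ x, v₀ ≤ V x) (z : ℂ) (p : L2 n × L2 n) :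
    L2 n :=
  -(mulReal (fun x => (V x)⁻¹) hV.inv (abs_inv_le hv₀ hl) p.2) - z • p.1

lemma continuous_sourceOp (hV : Measurable V) (hv₀ : 0 < v₀) (hl : ∀ x, v₀ ≤ V x) (z : ℂ) :
    Continuous (sourceOp hV hv₀ hl z) := by
  unfold sourceOp
  exact (((ContinuousLinearMap.continuous _).comp continuous_snd).neg).sub
    (continuous_fst.const_smul z)

lemma sourceOp_eq (hV : Measurable V) (hb : ∀ x, |V x| ≤ v₁) (hv₀ : 0 < v₀) (hl : ∀ x, v₀ ≤ V x)
    (z : ℂ) (f u : L2 n) : sourceOp hV hv₀ hl z (u, -(mulReal V hV hb (f + z • u))) = f := by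
  have h : mulReal (fun x => (V x)⁻¹) hV.inv (abs_inv_le hv₀ hl)
      (mulReal V hV hb (f + z • u)) = f + z • u := by
    refine Lp.ext ?_
    filter_upwards [coeFn_mulReal (a := fun x => (V x)⁻¹) hV.inv (abs_inv_le hv₀ hl) (mulReal V hV hb (f + z • u)),
      coeFn_mulReal hV hb (f + z • u)] with x h1 h2
    have : (V x : ℂ) ≠ 0 := by exact_mod_cast (hv₀.trans_le (hl x)).ne'
    rw [h1, h2]
    push_cast
    field_simp
  rw [sourceOp, map_neg, neg_neg, h, add_sub_cancel_right]

lemma coeFn_sourceOp (hV : Measurable V) (hv₀ : 0 < v₀) (hl : ∀ x, v₀ ≤ V x) (z : ℂ)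
    (φ : 𝓢(Eucl n, ℂ)) :
    sourceOp hV hv₀ hl z (schwartzL2 φ, schwartzL2 (Δ φ)) =ᵐ[volume] sourceFun V z φ := by
  set p : L2 n := schwartzL2 φ with hp
  set q : L2 n := schwartzL2 (Δ φ) with hq
  filter_upwards [coeFn_schwartz φ, coeFn_schwartz (Δ φ),
    coeFn_mulReal (a := fun x => (V x)⁻¹) hV.inv (abs_inv_le hv₀ hl) q, Lp.coeFn_smul z p,
    Lp.coeFn_neg (mulReal (fun x => (V x)⁻¹) hV.inv (abs_inv_le hv₀ hl) q),
    Lp.coeFn_sub (-(mulReal (fun x => (V x)⁻¹) hV.inv (abs_inv_le hv₀ hl) q)) (z • p)]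
    with x h1 h2 h3 h4 h5 h6
  rw [sourceOp, h6, Pi.sub_apply, h5, Pi.neg_apply, h3, h4, Pi.smul_apply, h1, h2, smul_eq_mul]
  rfl

/-- The weighted resolvent estimate, for sources that live in `Ω`. -/
theorem norm_restrictL2_le {M : ℝ → ℝ} {R₀ R₁ L T k δ ρ' φ₀ Φ : ℝ} {φ φ₁ φ₂ : ℝ → ℝ}
    (hn : 3 ≤ n) (hL : 0 < L) (hM : Monotone M) (hδ : 0 < δ)
    (hv₀ : 0 < v₀) (hk : 1 ≤ k) (hT : 0 ≤ T) (W : CarlemanWeight M R₀ v₀ v₁ R₁ L T k δ φ φ₁ φ₂)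
    (hV : RayPotential M R₀ v₀ v₁ V) {z : ℂ} (hz : z.re = k ^ 2) (hz0 : 0 ≤ z.im)
    (hzk : z.im ≤ 4 * k) (hΩ : MeasurableSet Ω)
    (hρ' : 0 ≤ ρ') (hΩρ : ∀ x ∈ Ω, ‖x‖ ≤ ρ') (hΩφ : ∀ x ∈ Ω, φ₀ ≤ φ ‖x‖) (hΦ : ∀ r, 0 ≤ r → φ r ≤ Φ)
    {f u : L2 n} (hf : restrictL2 Ω hΩ f = f)
    (hu : HasLaplacianL2 u (-(mulReal V hV.measurable (hV.abs_le hv₀) (f + z • u)))) :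
    L ^ 2 * v₀ / (8 * (L + ρ') ^ 3) / 2 * Real.exp (k * φ₀) ^ 2 * k ^ 2 * ‖restrictL2 Ω hΩ u‖ ^ 2 ≤
      (2 * sourceConst n L ρ' v₀ * v₁ ^ 2 * Real.exp (k * Φ) ^ 2 +
        8 * v₁ ^ 2 * absorbConst n L T v₀ v₁ ^ 2 / (L ^ 2 * v₀ / (8 * (L + ρ') ^ 3)) *
          (Real.exp (k * Φ) ^ 4 / Real.exp (k * φ₀) ^ 2)) * ‖f‖ ^ 2 := by
  set A := L ^ 2 * v₀ / (8 * (L + ρ') ^ 3) / 2 * Real.exp (k * φ₀) ^ 2 * k ^ 2 with hA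
  set B := 2 * sourceConst n L ρ' v₀ * v₁ ^ 2 * Real.exp (k * Φ) ^ 2 +
    8 * v₁ ^ 2 * absorbConst n L T v₀ v₁ ^ 2 / (L ^ 2 * v₀ / (8 * (L + ρ') ^ 3)) *
      (Real.exp (k * Φ) ^ 4 / Real.exp (k * φ₀) ^ 2) with hB
  set D := 4 * v₁ * Real.exp (k * Φ) ^ 2 * errorConst n L T v₀ v₁ k with hD
  have hgraph : ∀ η, 0 < η → ∀ p ∈ testGraph n, A * ‖restrictL2 Ω hΩ p.1‖ ^ 2 ≤
      B * ‖restrictL2 Ω hΩ (sourceOp hV.measurable hv₀ hV.lower z p)‖ ^ 2 +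
        D * (η * (‖sourceOp hV.measurable hv₀ hV.lower z p‖ ^ 2 + ‖p.1‖ ^ 2) +
          ‖sourceOp hV.measurable hv₀ hV.lower z p -
            restrictL2 Ω hΩ (sourceOp hV.measurable hv₀ hV.lower z p)‖ ^ 2 / η) := by
    rintro η hη _ ⟨ψ, hψ, rfl⟩
    obtain ⟨ρ, hp⟩ := helmholtzPair_sourceFun hV.measurable hv₀ hV.lower hψ hz rfl
    have hest := hp.estimate hn hL hM hδ hv₀ hk hT W hV hz0 hzk hΩ hρ' hΩρ hΩφ hΦ hη
    have e1 : ∀ᵐ x, ‖(schwartzL2 ψ) x‖ ^ 2 = (ψ x).re ^ 2 + (ψ x).im ^ 2 := by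
      filter_upwards [coeFn_schwartz ψ] with x hx
      rw [hx, Complex.sq_norm, Complex.normSq_apply]; ring
    have e2 : ∀ᵐ x, ‖sourceOp hV.measurable hv₀ hV.lower z (schwartzL2 ψ, schwartzL2 (Δ ψ)) x‖ ^ 2 =
        (sourceFun V z ψ x).re ^ 2 + (sourceFun V z ψ x).im ^ 2 := by
      filter_upwards [coeFn_sourceOp hV.measurable hv₀ hV.lower z ψ] with x hx
      rw [hx, Complex.sq_norm, Complex.normSq_apply]; ring
    rw [norm_restrictL2_sq hΩ e1, norm_restrictL2_sq hΩ e2, norm_sub_restrictL2_sq hΩ e2,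
      norm_sq_eq_integral, norm_sq_eq_integral, integral_congr_ae e1, integral_congr_ae e2]
    exact hest
  have hcS := continuous_sourceOp hV.measurable hv₀ hV.lower z
  have hcR := (restrictL2 Ω hΩ).continuous
  -- The inequality is closed in `(u, w)`, hence extends to the whole graph of the Laplacian.
  -- Approximating sources may leak out of `Ω`, but at the limit the source is `f`, which lives in
  -- `Ω`, and the term divided by `η` vanishes.
  have hclos : ∀ η, 0 < η → A * ‖restrictL2 Ω hΩ u‖ ^ 2 ≤ B * ‖f‖ ^ 2 + η * (D * (‖f‖ ^ 2 + ‖u‖ ^ 2)) := by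
    intro η hη
    have hcl : IsClosed {p : L2 n × L2 n | A * ‖restrictL2 Ω hΩ p.1‖ ^ 2 ≤
      B * ‖restrictL2 Ω hΩ (sourceOp hV.measurable hv₀ hV.lower z p)‖ ^ 2 +
        D * (η * (‖sourceOp hV.measurable hv₀ hV.lower z p‖ ^ 2 + ‖p.1‖ ^ 2) +
          ‖sourceOp hV.measurable hv₀ hV.lower z p -
            restrictL2 Ω hΩ (sourceOp hV.measurable hv₀ hV.lower z p)‖ ^ 2 / η)} := by
      refine isClosed_le ?_ ?_
      · exact continuous_const.mul ((hcR.comp continuous_fst).norm.pow 2)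
      · exact (continuous_const.mul ((hcR.comp hcS).norm.pow 2)).add
          (continuous_const.mul ((continuous_const.mul ((hcS.norm.pow 2).add
            (continuous_fst.norm.pow 2))).add (((hcS.sub (hcR.comp hcS)).norm.pow 2).div_const η)))
    have h := hcl.closure_subset_iff.2 (hgraph η hη) hu.mem_closure_testGraph
    rw [mem_ofPred_eq, sourceOp_eq, hf, sub_self, norm_zero] at h
    simp only at h
    have e : (0 : ℝ) ^ 2 / η = 0 := by simp
    rw [e] at h
    linarith
  -- Now `η` tends to zero. Adding `1` to `|X|` keeps the denominator positive.
  refine le_of_forall_pos_le_add fun e he => ?_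
  set X := D * (‖f‖ ^ 2 + ‖u‖ ^ 2) with hX
  refine (hclos (e / (|X| + 1)) (by positivity)).trans (add_le_add le_rfl ?_)
  calc e / (|X| + 1) * X ≤ e / (|X| + 1) * (|X| + 1) := by
        gcongr
        exact (le_abs_self X).trans (by linarith)
    _ = e := by field_simp

end Limit

/-! ### The two resolvent bounds near the real axis -/

section Assembly

variable {n : ℕ} {Ω : Set (Eucl n)}

lemma coeFn_cutoffOp {χ : Eucl n → ℂ} (hc : Continuous χ) (hs : HasCompactSupport χ) (f : L2 n) :
    cutoffOp χ hc hs f =ᵐ[volume] fun x => χ x * f x := by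
  filter_upwards [coeFn_mulL2 ((hc.memLp_top_of_hasCompactSupport hs volume).toLp χ) f,
    (hc.memLp_top_of_hasCompactSupport hs volume).coeFn_toLp] with x h1 h2
  rw [cutoffOp, h1, h2]

lemma norm_restrictL2_le_norm (hΩ : MeasurableSet Ω) (f : L2 n) : ‖restrictL2 Ω hΩ f‖ ≤ ‖f‖ :=
  (norm_mulReal_le _ _ _).trans_eq (one_mul _)

lemma exists_nonneg_radius {χ : Eucl n → ℂ} (hs : HasCompactSupport χ) :
    ∃ ρ, 0 ≤ ρ ∧ ∀ x ∈ tsupport χ, ‖x‖ ≤ ρ := by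
  obtain ⟨ρ, hρ⟩ := hs.isCompact.isBounded.subset_closedBall (0 : Eucl n)
  refine ⟨max ρ 0, le_max_right _ _, fun x hx => ?_⟩
  have := hρ hx
  rw [mem_closedBall_zero_iff] at this
  exact this.trans (le_max_left _ _)

/-- A bound between functions supported in `tsupport χ` gives a bound for the cut off operator. -/
lemma norm_cutoffOp_comp_le {χ : Eucl n → ℂ} (hc : Continuous χ) (hs : HasCompactSupport χ) {X N : ℝ}
    (hX : ∀ x, ‖χ x‖ ≤ X) (hN : 0 ≤ N) {R : L2 n →L[ℂ] L2 n}
    (hR : ∀ f, restrictL2 (tsupport χ) (isClosed_tsupport χ).measurableSet f = f →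
      ‖restrictL2 (tsupport χ) (isClosed_tsupport χ).measurableSet (R f)‖ ≤ N * ‖f‖) :
    ‖cutoffOp χ hc hs ∘L R ∘L cutoffOp χ hc hs‖ ≤ X ^ 2 * N := by
  have hX0 : 0 ≤ X := (norm_nonneg _).trans (hX 0)
  have hΩ := (isClosed_tsupport χ).measurableSet
  refine ContinuousLinearMap.opNorm_le_bound _ (by positivity) fun g => ?_
  have h1 : restrictL2 (tsupport χ) hΩ (cutoffOp χ hc hs g) = cutoffOp χ hc hs g := by
    refine Lp.ext ?_
    filter_upwards [coeFn_restrictL2 hΩ (cutoffOp χ hc hs g), coeFn_cutoffOp hc hs g] with x e1 e2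
    rw [e1]
    by_cases hx : x ∈ tsupport χ
    · rw [indicator_of_mem hx]
    · rw [indicator_of_notMem hx, e2, image_eq_zero_of_notMem_tsupport hx, zero_mul]
  have h2 : ∀ f : L2 n, ‖cutoffOp χ hc hs f‖ ≤ X * ‖restrictL2 (tsupport χ) hΩ f‖ := fun f => by
    refine Lp.norm_le_mul_norm_of_ae_le_mul ?_
    filter_upwards [coeFn_restrictL2 hΩ f, coeFn_cutoffOp hc hs f] with x e1 e2
    rw [e1, e2]
    by_cases hx : x ∈ tsupport χ
    · rw [indicator_of_mem hx, norm_mul]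
      exact mul_le_mul_of_nonneg_right (hX x) (norm_nonneg _)
    · rw [indicator_of_notMem hx, image_eq_zero_of_notMem_tsupport hx]
      simp
  have h3 : ‖cutoffOp χ hc hs g‖ ≤ X * ‖g‖ := by
    refine Lp.norm_le_mul_norm_of_ae_le_mul ?_
    filter_upwards [coeFn_cutoffOp hc hs g] with x e
    rw [e, norm_mul]
    exact mul_le_mul_of_nonneg_right (hX x) (norm_nonneg _)
  calc ‖cutoffOp χ hc hs (R (cutoffOp χ hc hs g))‖
      ≤ X * ‖restrictL2 (tsupport χ) hΩ (R (cutoffOp χ hc hs g))‖ := h2 _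
    _ ≤ X * (N * (X * ‖g‖)) := by
      gcongr
      exact (hR _ h1).trans (mul_le_mul_of_nonneg_left h3 hN)
    _ = X ^ 2 * N * ‖g‖ := by ring

/-- The constant of the local resolvent estimates. -/
def localConst (n : ℕ) (L T v₀ v₁ ρ : ℝ) : ℝ :=
  √((2 * sourceConst n L ρ v₀ * v₁ ^ 2 +
    8 * v₁ ^ 2 * absorbConst n L T v₀ v₁ ^ 2 / (L ^ 2 * v₀ / (8 * (L + ρ) ^ 3))) /
      (L ^ 2 * v₀ / (8 * (L + ρ) ^ 3) / 2))

lemma le_sqrt_div_mul {A P x y s : ℝ} (hA : 0 < A) (hP : 0 ≤ P) (hy : 0 ≤ y) (hs : 0 ≤ s)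
    (h : A * x ^ 2 ≤ P * s ^ 2 * y ^ 2) : x ≤ √(P / A) * s * y := by
  refine le_of_sq_le_sq ?_ (by positivity)
  rw [mul_pow, mul_pow, Real.sq_sqrt (by positivity)]
  have e : P / A * s ^ 2 * y ^ 2 = P * s ^ 2 * y ^ 2 / A := by ring
  rw [e, le_div_iff₀ hA]
  linarith

variable {V : Eucl n → ℝ} {v₀ v₁ : ℝ} {M : ℝ → ℝ} {R₀ R₁ L T k δ ρ : ℝ}
  {φ φ₁ φ₂ : ℝ → ℝ}

lemma CarlemanWeight.monotoneOn (W : CarlemanWeight M R₀ v₀ v₁ R₁ L T k δ φ φ₁ φ₂) :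
    MonotoneOn φ (Ici 0) :=
  monotoneOn_of_deriv_nonneg (convex_Ici 0) (fun r _ => (W.hasDerivAt r).continuousAt.continuousWithinAt)
    (fun r _ => (W.hasDerivAt r).differentiableAt.differentiableWithinAt) fun r hr => by
      rw [(W.hasDerivAt r).deriv]
      rw [interior_Ici] at hr
      exact W.nonneg₁ r (le_of_lt hr)

lemma CarlemanWeight.eq_of_le (W : CarlemanWeight M R₀ v₀ v₁ R₁ L T k δ φ φ₁ φ₂) {r : ℝ}
    (hr : R₁ ≤ r) : φ r = φ R₁ := by
  have h : ∀ s ∈ Ici R₁, HasDerivWithinAt φ 0 (Ici R₁) s := fun s hs => by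
    rw [← W.eq_zero₁ s hs]; exact (W.hasDerivAt s).hasDerivWithinAt
  have := (convex_Ici R₁).norm_image_sub_le_of_norm_hasDerivWithin_le (C := 0) h (fun s _ => by simp)
    (mem_Ici.2 le_rfl) (mem_Ici.2 hr)
  rw [zero_mul] at this
  exact sub_eq_zero.1 (norm_le_zero_iff.1 this)

lemma CarlemanWeight.le_apply (W : CarlemanWeight M R₀ v₀ v₁ R₁ L T k δ φ φ₁ φ₂) (hR₁ : 0 ≤ R₁)
    {r : ℝ} (hr : 0 ≤ r) : φ r ≤ φ R₁ := by
  rcases le_total r R₁ with h | h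
  · exact W.monotoneOn hr hR₁ h
  · exact (W.eq_of_le h).le

lemma CarlemanWeight.apply_nonneg (W : CarlemanWeight M R₀ v₀ v₁ R₁ L T k δ φ φ₁ φ₂)
    {r : ℝ} (hr : 0 ≤ r) : 0 ≤ φ r := by
  rw [← W.zero]; exact W.monotoneOn (mem_Ici.2 le_rfl) hr hr

lemma CarlemanWeight.apply_le (W : CarlemanWeight M R₀ v₀ v₁ R₁ L T k δ φ φ₁ φ₂) (hR₁ : 0 ≤ R₁) :
    φ R₁ ≤ T * R₁ := by
  have h := (convex_Icc 0 R₁).norm_image_sub_le_of_norm_hasDerivWithin_le (C := T) (f := φ) (f' := φ₁)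
    (fun s _ => (W.hasDerivAt s).hasDerivWithinAt) (fun s hs => by
      rw [Real.norm_of_nonneg (W.nonneg₁ s hs.1)]; exact W.le₁ s hs.1)
    (left_mem_Icc.2 hR₁) (right_mem_Icc.2 hR₁)
  rw [W.zero, sub_zero, sub_zero, Real.norm_of_nonneg hR₁] at h
  exact (le_abs_self _).trans h

/-- Apply the weighted estimate with `φ₀ = 0` and `Φ = φ R₁ ≤ T R₁`. The squared norms lose `E⁴`
with `E = exp(kφ(R₁))`, so the norms lose `E² ≤ exp(2kTR₁)`. -/
lemma norm_restrictL2_le_exp (hn : 3 ≤ n) (hL : 0 < L) (hR₁ : 0 ≤ R₁) (hM : Monotone M) (hδ : 0 < δ)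
    (hv₀ : 0 < v₀) (hk : 1 ≤ k) (hT : 0 ≤ T) (W : CarlemanWeight M R₀ v₀ v₁ R₁ L T k δ φ φ₁ φ₂)
    (hV : RayPotential M R₀ v₀ v₁ V) {z : ℂ} (hz : z.re = k ^ 2) (hz0 : 0 ≤ z.im)
    (hzk : z.im ≤ 4 * k) (hΩ : MeasurableSet Ω) (hρ : 0 ≤ ρ) (hΩρ : ∀ x ∈ Ω, ‖x‖ ≤ ρ)
    {f u : L2 n} (hf : restrictL2 Ω hΩ f = f)
    (hu : HasLaplacianL2 u (-(mulReal V hV.measurable (hV.abs_le hv₀) (f + z • u)))) :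
    ‖restrictL2 Ω hΩ u‖ ≤ localConst n L T v₀ v₁ ρ * Real.exp (2 * k * (T * R₁)) * ‖f‖ := by
  have h := norm_restrictL2_le hn hL hM hδ hv₀ hk hT W hV hz hz0 hzk hΩ hρ hΩρ
    (φ₀ := 0) (Φ := φ R₁) (fun x _ => W.apply_nonneg (norm_nonneg x))
    (fun r hr => W.le_apply hR₁ hr) hf hu
  have hv₁ : 0 < v₁ := hv₀.trans_le ((hV.lower 0).trans (hV.upper 0))
  set E := Real.exp (k * φ R₁) with hE
  have hE1 : 1 ≤ E := Real.one_le_exp (mul_nonneg (by linarith) (W.apply_nonneg hR₁))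
  have hE2 : E ^ 2 ≤ Real.exp (2 * k * (T * R₁)) := by
    rw [hE, ← Real.exp_nat_mul]
    refine Real.exp_le_exp.2 ?_
    have := mul_le_mul_of_nonneg_left (W.apply_le hR₁) (by linarith : 0 ≤ k)
    push_cast
    linarith
  have hs : 0 ≤ sourceConst n L ρ v₀ := by unfold sourceConst; positivity
  set B₁ := 2 * sourceConst n L ρ v₀ * v₁ ^ 2 with hB₁
  set B₂ := 8 * v₁ ^ 2 * absorbConst n L T v₀ v₁ ^ 2 / (L ^ 2 * v₀ / (8 * (L + ρ) ^ 3)) with hB₂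
  have hB₁0 : 0 ≤ B₁ := by positivity
  have hB₂0 : 0 ≤ B₂ := by positivity
  set A := L ^ 2 * v₀ / (8 * (L + ρ) ^ 3) / 2 with hA
  have hA0 : 0 < A := by positivity
  rw [mul_zero, Real.exp_zero, one_pow, mul_one, div_one] at h
  have h1 : A * ‖restrictL2 Ω hΩ u‖ ^ 2 ≤ (B₁ + B₂) * (E ^ 2) ^ 2 * ‖f‖ ^ 2 := by
    have h2 : A * ‖restrictL2 Ω hΩ u‖ ^ 2 ≤ A * k ^ 2 * ‖restrictL2 Ω hΩ u‖ ^ 2 := by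
      gcongr
      exact le_mul_of_one_le_right hA0.le (one_le_pow₀ hk)
    refine h2.trans (h.trans ?_)
    gcongr
    have h3 : E ^ 2 ≤ (E ^ 2) ^ 2 := by
      have := one_le_pow₀ hE1 (n := 2)
      nlinarith
    nlinarith
  refine (le_sqrt_div_mul hA0 (by positivity) (norm_nonneg f) (by positivity) h1).trans ?_
  change localConst n L T v₀ v₁ ρ * _ * _ ≤ _
  have : 0 ≤ localConst n L T v₀ v₁ ρ := Real.sqrt_nonneg _
  gcongr

/-- Beyond `R₁` the phase is constant and equal to its maximum, so `φ₀ = Φ`. The exponentials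
cancel, and the factor `k²` on the left gives `k⁻¹`. -/
lemma norm_restrictL2_le_div (hn : 3 ≤ n) (hL : 0 < L) (hR₁ : 0 ≤ R₁) (hM : Monotone M) (hδ : 0 < δ)
    (hv₀ : 0 < v₀) (hk : 1 ≤ k) (hT : 0 ≤ T) (W : CarlemanWeight M R₀ v₀ v₁ R₁ L T k δ φ φ₁ φ₂)
    (hV : RayPotential M R₀ v₀ v₁ V) {z : ℂ} (hz : z.re = k ^ 2) (hz0 : 0 ≤ z.im)
    (hzk : z.im ≤ 4 * k) (hΩ : MeasurableSet Ω) (hρ : 0 ≤ ρ) (hΩρ : ∀ x ∈ Ω, ‖x‖ ≤ ρ)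
    {f u : L2 n} (hf : restrictL2 Ω hΩ f = f)
    (hu : HasLaplacianL2 u (-(mulReal V hV.measurable (hV.abs_le hv₀) (f + z • u))))
    (hΩR : ∀ x ∈ Ω, R₁ ≤ ‖x‖) :
    ‖restrictL2 Ω hΩ u‖ ≤ localConst n L T v₀ v₁ ρ * k⁻¹ * ‖f‖ := by
  have h := norm_restrictL2_le hn hL hM hδ hv₀ hk hT W hV hz hz0 hzk hΩ hρ hΩρ
    (φ₀ := φ R₁) (Φ := φ R₁) (fun x hx => (W.eq_of_le (hΩR x hx)).ge)
    (fun r hr => W.le_apply hR₁ hr) hf hu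
  have hv₁ : 0 < v₁ := hv₀.trans_le ((hV.lower 0).trans (hV.upper 0))
  set E := Real.exp (k * φ R₁) with hE
  have hE0 : 0 < E := Real.exp_pos _
  have hs : 0 ≤ sourceConst n L ρ v₀ := by unfold sourceConst; positivity
  set B₁ := 2 * sourceConst n L ρ v₀ * v₁ ^ 2 with hB₁
  set B₂ := 8 * v₁ ^ 2 * absorbConst n L T v₀ v₁ ^ 2 / (L ^ 2 * v₀ / (8 * (L + ρ) ^ 3)) with hB₂
  have hB₁0 : 0 ≤ B₁ := by positivity
  have hB₂0 : 0 ≤ B₂ := by positivity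
  set A := L ^ 2 * v₀ / (8 * (L + ρ) ^ 3) / 2 with hA
  have hA0 : 0 < A := by positivity
  have hk0 : 0 < k := by linarith
  have h1 : A * ‖restrictL2 Ω hΩ u‖ ^ 2 ≤ (B₁ + B₂) * k⁻¹ ^ 2 * ‖f‖ ^ 2 := by
    have e : E ^ 4 / E ^ 2 = E ^ 2 := by field_simp
    rw [e] at h
    have h2 : E ^ 2 * k ^ 2 * (A * ‖restrictL2 Ω hΩ u‖ ^ 2) ≤
        E ^ 2 * k ^ 2 * ((B₁ + B₂) * k⁻¹ ^ 2 * ‖f‖ ^ 2) := by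
      have e2 : E ^ 2 * k ^ 2 * ((B₁ + B₂) * k⁻¹ ^ 2 * ‖f‖ ^ 2) = (B₁ * E ^ 2 + B₂ * E ^ 2) * ‖f‖ ^ 2 := by
        field_simp
      rw [e2]
      linarith
    exact le_of_mul_le_mul_left h2 (by positivity)
  exact le_sqrt_div_mul hA0 (by positivity) (norm_nonneg f) (by positivity) h1

lemma im_sq_eq (lam : ℂ) : (lam ^ 2).im = 2 * (lam.re * lam.im) := by
  rw [pow_two, Complex.mul_im]; ring

/-- Wave number and damping of a spectral parameter close to the real axis. -/
lemma exists_wave_number {lam : ℂ} (hre : 2 ≤ lam.re) (him : 0 ≤ lam.im) (him1 : lam.im ≤ 1) :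
    ∃ k, 1 ≤ k ∧ lam.re / 2 ≤ k ∧ k ≤ lam.re ∧ (lam ^ 2).re = k ^ 2 ∧ (lam ^ 2).im ≤ 4 * k := by
  have hzre : (lam ^ 2).re = lam.re ^ 2 - lam.im ^ 2 := by rw [pow_two, Complex.mul_re]; ring
  have hsq : (lam.re / 2) ^ 2 ≤ (lam ^ 2).re := by rw [hzre]; nlinarith
  have hkre : lam.re / 2 ≤ √((lam ^ 2).re) := Real.le_sqrt_of_sq_le hsq
  refine ⟨√((lam ^ 2).re), by linarith, hkre, Real.sqrt_le_iff.2 ⟨by linarith, ?_⟩,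
    (Real.sq_sqrt ((sq_nonneg _).trans hsq)).symm, ?_⟩
  · rw [hzre]; linarith [sq_nonneg lam.im]
  · rw [im_sq_eq]
    have := mul_le_mul_of_nonneg_left him1 (by linarith : 0 ≤ lam.re)
    linarith

lemma norm_le_of_im_sq_mul_le {lam : ℂ} {a b v₀ v₁ : ℝ} (hre : 0 < lam.re) (him : 1 ≤ lam.im)
    (hv₀ : 0 < v₀) (ha : 0 ≤ a) (h : (lam ^ 2).im * v₀ * a ≤ v₁ * b) :
    a ≤ v₁ / v₀ / lam.re * b := by
  rw [div_div, div_mul_eq_mul_div, le_div_iff₀ (by positivity)]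
  have h2 : lam.re ≤ (lam ^ 2).im := by
    rw [im_sq_eq]
    have := mul_le_mul_of_nonneg_left him hre.le
    linarith
  have h3 : lam.re * (v₀ * a) ≤ (lam ^ 2).im * (v₀ * a) := by gcongr
  linarith

lemma inv_four_mul_le_one {k r v : ℝ} (hk : 0 < k) (hv : 0 < v) (hrk : r / 2 ≤ k)
    (hr : 1 / (2 * v) ≤ r) : 1 / (4 * k * v) ≤ 1 := by
  rw [div_le_one (by positivity)]
  rw [div_le_iff₀ (by positivity)] at hr
  have := mul_le_mul_of_nonneg_right hrk hv.le
  linarith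

end Assembly

end

/-! ### Proof of the theorem -/

theorem propositionp (n : ℕ) (hn : 3 ≤ n)
    (c : Eucl n → ℝ) (hc : MemLp c ∞ volume)
    (hc_pos : ∃ c₀ : ℝ, 0 < c₀ ∧ ∀ᵐ x : Eucl n, c₀ ≤ c x)
    (hc_const : ∃ (c₁ : ℝ) (S : Set (Eucl n)), IsCompact S ∧ ∀ᵐ x : Eucl n, x ∉ S → c x = c₁)
    (ν : SignedMeasure (Eucl n)) (hν : IsRadialDerivative c ν)
    (hν_supp : IsCompactlySupported ν)
    (μ : Measure ℝ) [IsFiniteMeasure μ] (hνμ : SignedLE ν (radialMeasure n μ)) :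
    ∃ K : Set (Eucl n), IsCompact K ∧
      ∀ (χ₀ χ₁ : Eucl n → ℂ) (h₀ : ContDiff ℝ ∞ χ₀) (h₁ : ContDiff ℝ ∞ χ₁)
        (hs₀ : HasCompactSupport χ₀) (hs₁ : HasCompactSupport χ₁),
        Disjoint (tsupport χ₁) K →
        ∃ C : ℝ, 0 < C ∧ ∃ lam₁ : ℝ, 0 < lam₁ ∧
          ∀ lam : ℂ, 0 < lam.im → lam₁ ≤ lam.re →
            ∃ R : L2 n →L[ℂ] L2 n, IsResolvent c lam R ∧
              ‖cutoffOp χ₀ h₀.continuous hs₀ ∘L R ∘L cutoffOp χ₀ h₀.continuous hs₀‖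
                ≤ C * Real.exp (C * lam.re) ∧
              ‖cutoffOp χ₁ h₁.continuous hs₁ ∘L R ∘L cutoffOp χ₁ h₁.continuous hs₁‖
                ≤ C / lam.re := by
  obtain ⟨M, R₀, v₀, v₁, m, V, hR₀, hv₀, hM, hM0, hMm, hMc, hV, hcV⟩ :=
    exists_rayPotential (by omega) hc hc_pos hc_const hν hνμ
  have hv₁ : 0 < v₁ := hv₀.trans_le ((hV.lower 0).trans (hV.upper 0))
  obtain ⟨R₁, L, T, hR₀₁, hR₁L, hT, hweight⟩ := exists_carlemanWeight hM hM0 hMm hR₀ hMc hv₀ hv₁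
  have hR₁ : 0 < R₁ := hR₀.trans hR₀₁
  refine ⟨Metric.closedBall 0 R₁, isCompact_closedBall _ _, fun χ₀ χ₁ h₀ h₁ hs₀ hs₁ hdisj => ?_⟩
  obtain ⟨X₀, hX₀⟩ := hs₀.exists_bound_of_continuous h₀.continuous
  obtain ⟨X₁, hX₁⟩ := hs₁.exists_bound_of_continuous h₁.continuous
  obtain ⟨ρ₀, hρ₀, hχρ₀⟩ := exists_nonneg_radius hs₀
  obtain ⟨ρ₁, hρ₁, hχρ₁⟩ := exists_nonneg_radius hs₁
  set S₀ := localConst n L T v₀ v₁ ρ₀ with hS₀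
  set S₁ := localConst n L T v₀ v₁ ρ₁ with hS₁
  have hS₀0 : 0 ≤ S₀ := Real.sqrt_nonneg _
  have hS₁0 : 0 ≤ S₁ := Real.sqrt_nonneg _
  set C := 1 + 2 * (T * R₁) + X₀ ^ 2 * (S₀ + v₁ / v₀) + X₁ ^ 2 * (2 * S₁ + v₁ / v₀) with hC
  have hT0 : 0 ≤ T := by linarith
  have hC1 : 2 * (T * R₁) ≤ C := by
    have : 0 ≤ X₀ ^ 2 * (S₀ + v₁ / v₀) + X₁ ^ 2 * (2 * S₁ + v₁ / v₀) := by positivity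
    linarith
  have hC2 : X₀ ^ 2 * (S₀ + v₁ / v₀) ≤ C := by
    have : 0 ≤ 2 * (T * R₁) + X₁ ^ 2 * (2 * S₁ + v₁ / v₀) := by positivity
    linarith
  have hC3 : X₁ ^ 2 * (2 * S₁ + v₁ / v₀) ≤ C := by
    have : 0 ≤ 2 * (T * R₁) + X₀ ^ 2 * (S₀ + v₁ / v₀) := by positivity
    linarith
  -- The bound `Re λ ≥ 2` gives `k ≥ 1` when `Im λ ≤ 1`; the bound `Re λ ≥ 1/(2v₁)` gives `δ =
  -- 1/(4kv₁) ≤ 1`.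
  refine ⟨C, by positivity, max 2 (1 / (2 * v₁)), by positivity, fun lam him hre => ?_⟩
  obtain ⟨hre2, hrev⟩ := max_le_iff.1 hre
  have hre0 : 0 < lam.re := by linarith
  have hz : 0 < (lam ^ 2).im := by rw [im_sq_eq]; positivity
  obtain ⟨R, hR, hRb⟩ := exists_isResolvent hV.measurable (hV.abs_le hv₀) hv₀ hV.lower hcV hz
  have hlap : ∀ f, HasLaplacianL2 (R f)
      (-(mulReal V hV.measurable (hV.abs_le hv₀) (f + lam ^ 2 • R f))) := fun f =>
    (exists_laplacian_iff hV.measurable (hV.abs_le hv₀) hcV _ f (R f)).1 ((hR f (R f)).1 rfl)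
  have hexp : 1 ≤ Real.exp (2 * (T * R₁) * lam.re) := Real.one_le_exp (by positivity)
  -- the bounds on functions supported near the supports of the cutoffs
  obtain ⟨hN₀, hN₁⟩ :
      (∀ f, restrictL2 (tsupport χ₀) (isClosed_tsupport χ₀).measurableSet f = f →
        ‖restrictL2 (tsupport χ₀) (isClosed_tsupport χ₀).measurableSet (R f)‖ ≤
          ((S₀ + v₁ / v₀) * Real.exp (2 * (T * R₁) * lam.re)) * ‖f‖) ∧
      ∀ f, restrictL2 (tsupport χ₁) (isClosed_tsupport χ₁).measurableSet f = f →
        ‖restrictL2 (tsupport χ₁) (isClosed_tsupport χ₁).measurableSet (R f)‖ ≤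
          ((2 * S₁ + v₁ / v₀) / lam.re) * ‖f‖ := by
    -- For `Im λ ≥ 1` the elementary bound by `1 / Im λ²` suffices for both cutoffs. Otherwise the
    -- Carleman estimate is used with wave number `k`.
    rcases le_total 1 lam.im with him1 | him1
    · have hRn : ∀ f, ‖R f‖ ≤ v₁ / v₀ / lam.re * ‖f‖ := fun f =>
        norm_le_of_im_sq_mul_le hre0 him1 hv₀ (norm_nonneg _) (hRb f)
      refine ⟨fun f _ => ?_, fun f _ => ?_⟩
      · refine (norm_restrictL2_le_norm _ _).trans ((hRn f).trans ?_)
        gcongr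
        calc v₁ / v₀ / lam.re ≤ v₁ / v₀ := div_le_self (by positivity) (by linarith)
          _ ≤ (S₀ + v₁ / v₀) * 1 := by linarith
          _ ≤ _ := by gcongr
      · refine (norm_restrictL2_le_norm _ _).trans ((hRn f).trans ?_)
        gcongr
        linarith
    · obtain ⟨k, hk1, hkre, hkle, hk2, hzk⟩ := exists_wave_number hre2 him.le him1
      obtain ⟨φ, φ₁, φ₂, W⟩ := hweight k _ hk1 rfl (inv_four_mul_le_one (by linarith) hv₁ hkre hrev)
      have hδ : 0 < 1 / (4 * k * v₁) := by positivity
      have hL : 0 < L := hR₁.trans_le hR₁L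
      refine ⟨fun f hf => ?_, fun f hf => ?_⟩
      · refine (norm_restrictL2_le_exp hn hL hR₁.le hM hδ hv₀ hk1 hT0 W hV hk2 hz.le hzk _ hρ₀ hχρ₀ hf
          (hlap f)).trans ?_
        rw [← hS₀]
        have h1 : 2 * k * (T * R₁) ≤ 2 * (T * R₁) * lam.re := by
          have := mul_le_mul_of_nonneg_left hkle (by positivity : 0 ≤ T * R₁)
          linarith
        gcongr
        have : 0 ≤ v₁ / v₀ := by positivity
        linarith
      · refine (norm_restrictL2_le_div hn hL hR₁.le hM hδ hv₀ hk1 hT0 W hV hk2 hz.le hzk _ hρ₁ hχρ₁ hf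
          (hlap f) fun x hx => ?_).trans ?_
        -- The support of `χ₁` misses the closed ball of radius `R₁`, so the phase is constant on
        -- it.
        · have := hdisj.notMem_of_mem_left hx
          rw [mem_closedBall_zero_iff, not_le] at this
          exact this.le
        rw [← hS₁]
        gcongr
        have h1 : k⁻¹ ≤ 2 / lam.re := by
          rw [inv_le_comm₀ (by positivity) (by positivity), inv_div]
          exact hkre
        calc S₁ * k⁻¹ ≤ S₁ * (2 / lam.re) := by gcongr
          _ = (2 * S₁ + 0) / lam.re := by ring
          _ ≤ _ := by gcongr; positivity
  refine ⟨R, hR, ?_, ?_⟩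
  · refine (norm_cutoffOp_comp_le h₀.continuous hs₀ hX₀ (by positivity) hN₀).trans ?_
    rw [← mul_assoc]
    have h1 : 2 * (T * R₁) * lam.re ≤ C * lam.re := by gcongr
    gcongr
  · refine (norm_cutoffOp_comp_le h₁.continuous hs₁ hX₁ (by positivity) hN₁).trans ?_
    rw [← mul_div_assoc]
    gcongr
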